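/- Let $m,n\ge 1$ be integers and let $\mathcal O=S^2(m,n)$ be a spindle orbifold with a rotationally symmetric Riemannian orbifold metric. That is, away from the two poles (cone points of orders $m$ and $n$, smooth points if the order is $1$), $\mathcal O$ is $\mathbb R/2\pi\mathbb Z\times(0,M)\ni(\theta,s)$ with the metric $ds^2+r(s)^2\,d\theta^2$, where $M>0$ and $r:(0,M)\to(0,\infty)$ is smooth and extends to a smooth function on $\mathbb R$ that is odd about $s=0$ and about $s=M$ with $r'(0)=\frac1m$, $r'(M)=-\frac1n$. (Orbifold) geodesics are the paths that lift locally to geodesics in the manifold charts of $\mathcal O$, and $\mathcal O$ is called Besse if all its geodesics are closed. Let $s_0\in(0,M)$ be a critical point of $r$ such that $r(s_0)$ is minimal among the critical values of $r$ on $(0,M)$, and let $L=2\pi r(s_0)$ be the length of the corresponding equator $P_{s_0}=\{s=s_0\}$. Let $A$ be the open Birkhoff annulus of unit tangent vectors $\frac{\cos\beta}{r(s_0)}\partial_\theta+\sin\beta\,\partial_s$, $0<\beta<\pi$, at points of $P_{s_0}$, with coordinates $\xi=r(s_0)\theta\in\mathbb R/L\mathbb Z$ and $\eta=-\cos\beta\in(-1,1)$,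 and let $\tau$ and $\varphi$ be the first return time and the first return map to $A$ of the geodesic flow. Put $\alpha=0$ if $m+n$ is even and $\alpha=1$ if $m+n$ is odd. The generating function of $\varphi$ is the smooth even function $F:(-1,1)\to\mathbb R$ such that $$\tau(\xi,\eta)=F(\eta)-\eta F'(\eta),\qquad \varphi(\xi,\eta)=\bigl(\xi+F'(\eta)+\alpha\tfrac L2,\ \eta\bigr)\qquad\text{for all }(\xi,\eta)\in\mathbb R/L\mathbb Z\times(-1,1).$$ Then the generating function $F$ exists and is unique, and $F$ is constant if and only if $\mathcal O$ is Besse. -/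

import Mathlib

open scoped ContDiff

noncomputable section

/-- A rotationally symmetric spindle orbifold `S²(m,n)` in normal form: the metric
`ds² + r(s)² dθ²` on `(0,M) × ℝ/2πℤ`, completed by a cone point of order `m` at `s = 0` and a cone
point of order `n` at `s = M`. The completion is a smooth Riemannian orbifold exactly when `r`
extends smoothly and oddly across `s = 0` and across `s = M`, with slopes `1/m` and `-1/n` there;
`r` denotes this (unique, `2M`-periodic) extension to `ℝ`. -/
structure SpindleOrbifold where
  m : ℕ
  n : ℕ
  m_pos : 0 < m
  n_pos : 0 < n
  M : ℝ
  M_pos : 0 < M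
  r : ℝ → ℝ
  smooth : ContDiff ℝ ∞ r
  pos : ∀ s ∈ Set.Ioo 0 M, 0 < r s
  odd_zero : ∀ s, r (-s) = -r s
  odd_M : ∀ s, r (M + s) = -r (M - s)
  deriv_zero : deriv r 0 = 1 / m
  deriv_M : deriv r M = -(1 / n)

/-- The Riemannian metric `ds² + k² ρ(s)² dφ²` in polar coordinates `p = s e^{iφ}`, written in the
Cartesian coordinates of `ℂ = ℝ²`: with `ω(p,v) = Im (conj p * v)` the form `dφ` is `ω(p,·)/|p|²`
and the Euclidean metric is `ds² + s² dφ²`. At `p = 0` this is the Euclidean inner product. -/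
def coneMetric (k : ℕ) (ρ : ℝ → ℝ) (p u v : ℂ) : ℝ :=
  (u.re * v.re + u.im * v.im) +
    ((k * ρ ‖p‖ / ‖p‖) ^ 2 - 1) / ‖p‖ ^ 2 *
      ((p.re * u.im - p.im * u.re) * (p.re * v.im - p.im * v.re))

/-- `w` is, on the set `I` of times, a unit speed geodesic of the metric `g` on `D ⊆ ℂ = ℝ²`: it
satisfies the Euler-Lagrange equations `d/dt (g(w',u)) = ½ ∂_u g (w',w')` of the energy. -/
def IsUnitGeodesicOn (g : ℂ → ℂ → ℂ → ℝ) (D : Set ℂ) (w : ℝ → ℂ) (I : Set ℝ) : Prop :=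
  ∀ t ∈ I, w t ∈ D ∧ DifferentiableAt ℝ w t ∧ g (w t) (deriv w t) (deriv w t) = 1 ∧
    ∀ u : ℂ, HasDerivAt (fun x => g (w x) (deriv w x) u)
      (1 / 2 * fderiv ℝ (fun p => g p (deriv w t) (deriv w t)) (w t) u) t

namespace SpindleOrbifold

variable (S : SpindleOrbifold)

theorem r_zero : S.r 0 = 0 := by
  have h := S.odd_zero 0
  rw [neg_zero] at h
  linarith

theorem r_M : S.r S.M = 0 := by
  have h := S.odd_M 0
  rw [add_zero, sub_zero] at h
  linarith

theorem r_nonneg {s : ℝ} (hs : s ∈ Set.Icc 0 S.M) : 0 ≤ S.r s := by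
  rcases eq_or_lt_of_le hs.1 with h | h
  · rw [← h, S.r_zero]
  · rcases eq_or_lt_of_le hs.2 with h' | h'
    · rw [h', S.r_M]
    · exact (S.pos s ⟨h, h'⟩).le

/-- The underlying topological sphere `{(r(s) e^{iθ}, s) | 0 ≤ s ≤ M}`. -/
def Carrier : Set (ℂ × ℝ) := {p | p.2 ∈ Set.Icc 0 S.M ∧ ‖p.1‖ = S.r p.2}

/-- The parametrization `Φ(θ,s)`; for `0 < s < M` it parametrizes the complement of the two
poles. -/
def Phi (θ s : ℝ) : ℂ × ℝ := (S.r s * Complex.exp (θ * Complex.I), s)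

theorem chart_mem {k : ℕ} {s : ℝ} (w : ℂ) (hs : s ∈ Set.Icc 0 S.M) (h0 : w = 0 → S.r s = 0) :
    ((S.r s * (w / ‖w‖) ^ k : ℂ), s) ∈ S.Carrier := by
  refine ⟨hs, ?_⟩
  by_cases hw : w = 0
  · simp [h0 hw]
  · have h1 : ‖w‖ ≠ 0 := norm_ne_zero_iff.mpr hw
    simp [h1, abs_of_nonneg (S.r_nonneg hs)]

/-- The orbifold chart at the pole `s = 0`: the point with polar coordinates `(s, φ)` of the open
disc of radius `M` goes to `Φ(mφ, s)`. The chart group is the group of rotations of order `m`, the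
metric on the disc is `ds² + m² r(s)² dφ²`. -/
def chartZero (w : Metric.ball (0 : ℂ) S.M) : S.Carrier :=
  ⟨(S.r ‖(w : ℂ)‖ * ((w : ℂ) / ‖(w : ℂ)‖) ^ S.m, ‖(w : ℂ)‖),
    S.chart_mem _ ⟨norm_nonneg _, (mem_ball_zero_iff.mp w.2).le⟩
      (fun h => by rw [h, norm_zero, S.r_zero])⟩

/-- The orbifold chart at the pole `s = M`: the point with polar coordinates `(x, φ)` of the open
disc of radius `M` goes to `Φ(nφ, M - x)`. The chart group is the group of rotations of order `n`,
the metric on the disc is `dx² + n² r(M - x)² dφ²`. -/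
def chartM (w : Metric.ball (0 : ℂ) S.M) : S.Carrier :=
  ⟨(S.r (S.M - ‖(w : ℂ)‖) * ((w : ℂ) / ‖(w : ℂ)‖) ^ S.n, S.M - ‖(w : ℂ)‖),
    S.chart_mem _ ⟨sub_nonneg.mpr (mem_ball_zero_iff.mp w.2).le,
      sub_le_self _ (norm_nonneg _)⟩ (fun h => by rw [h, norm_zero, sub_zero, S.r_M])⟩

/-- A unit speed orbifold geodesic, defined for all times: a path that lifts, locally around each
time, to a unit speed geodesic in one of the two (covering) orbifold charts. -/
def IsGeodesic (γ : ℝ → S.Carrier) : Prop :=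
  ∀ t₀ : ℝ, ∃ I ∈ nhds t₀, ∃ w : ℝ → ℂ,
    (IsUnitGeodesicOn (coneMetric S.m S.r) (Metric.ball 0 S.M) w I ∧
      ∀ t ∈ I, ∃ h : w t ∈ Metric.ball (0 : ℂ) S.M, γ t = S.chartZero ⟨w t, h⟩) ∨
    (IsUnitGeodesicOn (coneMetric S.n (fun x => S.r (S.M - x))) (Metric.ball 0 S.M) w I ∧
      ∀ t ∈ I, ∃ h : w t ∈ Metric.ball (0 : ℂ) S.M, γ t = S.chartM ⟨w t, h⟩)

/-- All geodesics are closed. -/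
def IsBesse : Prop :=
  ∀ γ : ℝ → S.Carrier, S.IsGeodesic γ → ∃ T : ℝ, 0 < T ∧ Function.Periodic γ T

/-- At time `t` the path `γ` has the unit tangent vector
`Ψ(θ,β,s) = (cos β / r(s)) ∂_θ + sin β ∂_s` at the point `Φ(θ,s)` of the regular annulus. -/
def HasUnitTangent (γ : ℝ → S.Carrier) (t θ β s : ℝ) : Prop :=
  ∃ Θ σ : ℝ → ℝ, Θ t = θ ∧ σ t = s ∧
    HasDerivAt Θ (Real.cos β / S.r s) t ∧ HasDerivAt σ (Real.sin β) t ∧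
    ∀ᶠ x in nhds t, σ x ∈ Set.Ioo 0 S.M ∧ (γ x : ℂ × ℝ) = S.Phi (Θ x) (σ x)

/-- `φ^t Ψ(θ,β,s) = Ψ(θ',β',s')` for the geodesic flow `φ`. -/
def FlowsTo (t θ β s θ' β' s' : ℝ) : Prop :=
  ∃ γ : ℝ → S.Carrier, S.IsGeodesic γ ∧
    S.HasUnitTangent γ 0 θ β s ∧ S.HasUnitTangent γ t θ' β' s'

/-- `P_{s₀}` is an equator of minimal length: `s₀` is a critical point of `r` in `(0,M)` with
minimal critical value. -/
def IsMinimalEquator (s₀ : ℝ) : Prop :=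
  s₀ ∈ Set.Ioo 0 S.M ∧ deriv S.r s₀ = 0 ∧
    ∀ s ∈ Set.Ioo 0 S.M, deriv S.r s = 0 → S.r s₀ ≤ S.r s

/-- The length of the parallel `P_{s₀}`. -/
def equatorLength (s₀ : ℝ) : ℝ := 2 * Real.pi * S.r s₀

/-- In the open Birkhoff annulus `A = {Ψ(θ,β,s₀) | 0 < β < π}` over `P_{s₀}`, the coordinates of a
vector are `ξ = r(s₀) θ` (modulo `L`) and `η = -cos β ∈ (-1,1)`. `AnnulusFlow s₀ t ξ η ξ' η'` says
that `φ^t` sends the vector with coordinates `(ξ,η)` to the one with coordinates `(ξ',η')`. -/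
def AnnulusFlow (s₀ t ξ η ξ' η' : ℝ) : Prop :=
  S.FlowsTo t (ξ / S.r s₀) (Real.arccos (-η)) s₀ (ξ' / S.r s₀) (Real.arccos (-η')) s₀

/-- `τ` is the first return time, and `(ξ',η')` the image under the first return map, of the
vector `(ξ,η)` in the Birkhoff annulus over `P_{s₀}`. -/
def IsFirstReturn (s₀ ξ η τ ξ' η' : ℝ) : Prop :=
  IsLeast {t : ℝ | 0 < t ∧ ∃ x y : ℝ, y ∈ Set.Ioo (-1) 1 ∧ S.AnnulusFlow s₀ t ξ η x y} τ ∧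
    η' ∈ Set.Ioo (-1) 1 ∧ S.AnnulusFlow s₀ τ ξ η ξ' η'

/-- `F : (-1,1) → ℝ` is a generating function of the first return map `φ`: it is smooth and even,
the first return time is `τ(ξ,η) = F(η) - η F'(η)`, and
`φ(ξ,η) = (ξ + F'(η) + α L/2, η)` with `α ∈ {0,1}` the parity of `m + n`. -/
def IsGeneratingFunction (s₀ : ℝ) (F : ℝ → ℝ) : Prop :=
  ContDiffOn ℝ ∞ F (Set.Ioo (-1) 1) ∧
  (∀ η ∈ Set.Ioo (-1 : ℝ) 1, F (-η) = F η) ∧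
  ∀ ξ : ℝ, ∀ η ∈ Set.Ioo (-1 : ℝ) 1,
    S.IsFirstReturn s₀ ξ η (F η - η * deriv F η)
      (ξ + deriv F η + ((S.m + S.n) % 2 : ℕ) * (S.equatorLength s₀ / 2)) η

end SpindleOrbifold

end

/-! Write `R = r(s₀)`. A geodesic has a Clairaut constant `c = r cos β`, and a vector of the
Birkhoff annulus has `c = -η R`. Since `R` is the least critical value, `r` is strictly monotone
below the level `R` near each pole and at least `R` in between. Hence for `0 < |c| < R` a geodesic
oscillates between the two parallels `r = |c|`, one on each side of `s₀`, and it returns to the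
annulus for the first time after exactly one period (`Orbit.isFirstReturn`). A period sweeps the
angle `Θ(c) = 2 ∫ c / (r √(r² - c²)) ds` and lasts `T(c) = W(c) + c Θ(c)`, where `W(c) = 2 ∫ √(1 -
c²/r²) ds` is the radial action. On `0 < c < R` one has `W' = -Θ`, proved in integrated form by
Fubini (`integral_angle`).

The angle jumps at `c = 0`. In the variable `y = √(r² - c²)` the part near the first pole becomes `∫
m c / (c² + y²) dy` plus a smooth term, so this pole contributes `m π/2` on each passage as `c →
0+`, and the other pole `n π/2`. The excess `e(c) = Θ(c) - (m+n) π sign c` is therefore smooth and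
odd on `(-R, R)` (`contDiffOn_excess`). Its integral gives the smooth even function `P(c) = 2M - ∫₀ᶜ
e = W(c) + (m+n) π |c|`, and `F(η) = P(R η)` works: `F' = R e(c)` and `F - η F' = P(c) + c e(c) =
T(c)`. Replacing `Θ` by `e` changes the longitude by a multiple of `(m+n) π`, which is the half turn
`α L/2` up to full turns. For `η = 0` the geodesic is a meridian, which returns after time `2M` with
longitude turned by `(-1)^(m+n)`.

Uniqueness needs only the return time: the difference `h` of two generating functions satisfies `h =
η h'`, so it is linear on `(0,1)`, and evenness makes it vanish (`eq_zero_of_eq_mul_deriv`).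

`F` is constant exactly when `e` vanishes identically. If all geodesics close, `Θ(c)` is a rational
multiple of `2π` for every `c` in `(0, R)`; being continuous with countably many values, `e` is
constant there, and its limit at `0` is `0`. Conversely, `e = 0` bounds `Θ`. But if `r ≥ R` held on
a whole interval ending at `s₀`, then `Θ(c)` would diverge logarithmically as `c → R`
(`exists_lt_angle`). So `s₀` is the strict global maximum of `r`, and every geodesic is a meridian,
the equator, or an oscillating orbit with `Θ = ±(m+n) π`, which closes after two periods.

Two facts link these formulas to orbifold geodesics. Chart geodesics are solutions of the polar
equations or straight lines through a cone point (`IsGeodesic.local_structure`), and a geodesic is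
determined by its germ (`IsGeodesic.eq_of_eventuallyEq`). -/

section

open Set MeasureTheory

/-! ### Parameter integrals, Hadamard's lemma, and even functions as functions of the square -/

section SmoothAnalysis

/-- The derivative along the first factor. -/
theorem contDiffOn_fderiv_fst {U : Set (ℝ × ℝ)} (hU : IsOpen U) {f : ℝ × ℝ → ℝ}
    (hf : ContDiffOn ℝ ∞ f U) : ContDiffOn ℝ ∞ (fun p => fderiv ℝ f p (1, 0)) U :=
  ((contDiffOn_infty_iff_fderiv_of_isOpen hU).1 hf).2.clm_apply contDiffOn_const

/-- The partial derivative is bounded on the compact product of a small closed ball around `c` and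
the interval of integration, so a constant dominates it. -/
theorem hasDerivAt_intervalIntegral_param {U : Set (ℝ × ℝ)} (hU : IsOpen U) {f : ℝ × ℝ → ℝ}
    (hf : ContDiffOn ℝ ∞ f U) {I : Set ℝ} (hI : IsOpen I) {a b : ℝ}
    (hIU : ∀ c ∈ I, ∀ t ∈ uIcc a b, (c, t) ∈ U) {c : ℝ} (hc : c ∈ I) :
    HasDerivAt (fun c => ∫ t in a..b, f (c, t)) (∫ t in a..b, fderiv ℝ f (c, t) (1, 0)) c := by
  obtain ⟨ε, hε, hεI⟩ := Metric.nhds_basis_closedBall.mem_iff.1 (hI.mem_nhds hc)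
  have hcont : ∀ g : ℝ × ℝ → ℝ, ContinuousOn g U → ∀ c ∈ I,
      ContinuousOn (fun t => g (c, t)) (uIcc a b) := fun g hg c hc =>
    hg.comp (by fun_prop) fun t ht => hIU c hc t ht
  have hd := (contDiffOn_fderiv_fst hU hf).continuousOn
  have hK : IsCompact (Metric.closedBall c ε ×ˢ uIcc a b) :=
    (isCompact_closedBall c ε).prod isCompact_uIcc
  obtain ⟨C, hC⟩ := hK.exists_bound_of_continuousOn
    (hd.mono fun p hp => hIU p.1 (hεI hp.1) p.2 hp.2)
  have hmeas : ∀ g : ℝ × ℝ → ℝ, ContinuousOn g U → ∀ c ∈ I,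
      AEStronglyMeasurable (fun t => g (c, t)) (volume.restrict (uIoc a b)) := fun g hg c hc =>
    ((hcont g hg c hc).mono uIoc_subset_uIcc).aestronglyMeasurable measurableSet_uIoc
  refine (intervalIntegral.hasDerivAt_integral_of_dominated_loc_of_deriv_le
    (F := fun c t => f (c, t)) (F' := fun c t => fderiv ℝ f (c, t) (1, 0))
    (bound := fun _ => C) (s := Metric.closedBall c ε)
    (Metric.closedBall_mem_nhds c hε) ?_ ?_ ?_ ?_ ?_ ?_).2
  · filter_upwards [hI.mem_nhds hc] with x hx using hmeas f hf.continuousOn x hx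
  · exact (hcont f hf.continuousOn c hc).intervalIntegrable
  · exact hmeas _ hd c hc
  · exact .of_forall fun t ht x hx => hC (x, t) ⟨hx, uIoc_subset_uIcc ht⟩
  · exact intervalIntegrable_const
  · refine .of_forall fun t ht x hx => ?_
    have h1 : HasFDerivAt f (fderiv ℝ f (x, t)) (x, t) :=
      ((hf.contDiffAt (hU.mem_nhds (hIU x (hεI hx) t (uIoc_subset_uIcc ht)))).differentiableAt
        (by simp)).hasFDerivAt
    exact h1.comp_hasDerivAt x ((hasDerivAt_id x).prodMk (hasDerivAt_const x t))

/-- Each differentiation replaces the integrand by a partial derivative that is again smooth on `U`;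
for this reason the induction runs over all `f` at once. -/
theorem contDiffOn_intervalIntegral_param {U : Set (ℝ × ℝ)} (hU : IsOpen U) {f : ℝ × ℝ → ℝ}
    (hf : ContDiffOn ℝ ∞ f U) {I : Set ℝ} (hI : IsOpen I) {a b : ℝ}
    (hIU : ∀ c ∈ I, ∀ t ∈ uIcc a b, (c, t) ∈ U) :
    ContDiffOn ℝ ∞ (fun c => ∫ t in a..b, f (c, t)) I := by
  rw [contDiffOn_infty]
  intro n
  induction n generalizing f with
  | zero =>
    exact contDiffOn_zero.2 fun c hc =>
      (hasDerivAt_intervalIntegral_param hU hf hI hIU hc).continuousAt.continuousWithinAt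
  | succ n ih =>
    push_cast
    rw [contDiffOn_succ_iff_deriv_of_isOpen hI]
    refine ⟨fun c hc => (hasDerivAt_intervalIntegral_param hU hf hI hIU
      hc).differentiableAt.differentiableWithinAt, by simp, ?_⟩
    exact (ih (contDiffOn_fderiv_fst hU hf)).congr fun c hc =>
      (hasDerivAt_intervalIntegral_param hU hf hI hIU hc).deriv

/-- Hadamard's lemma on an open interval. -/
theorem exists_contDiffOn_eq_sub_mul {f : ℝ → ℝ} {α β a : ℝ} (ha : a ∈ Ioo α β)
    (hf : ContDiffOn ℝ ∞ f (Ioo α β)) (h0 : f a = 0) :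
    ∃ g : ℝ → ℝ, ContDiffOn ℝ ∞ g (Ioo α β) ∧ g a = deriv f a ∧
      ∀ x ∈ Ioo α β, f x = (x - a) * g x := by
  have hd := (contDiffOn_infty_iff_deriv_of_isOpen isOpen_Ioo).1 hf
  have hcv : ∀ x ∈ Ioo α β, ∀ t ∈ uIcc (0 : ℝ) 1, a + t * (x - a) ∈ Ioo α β := by
    intro x hx t ht
    rw [uIcc_of_le zero_le_one] at ht
    have := (convex_Ioo α β) ha hx (sub_nonneg.2 ht.2) ht.1 (by ring)
    simp only [smul_eq_mul] at this
    convert this using 1; ring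
  -- The quotient is the mean of `f'` over the segment from `a` to `x`.
  refine ⟨fun x => ∫ t in (0 : ℝ)..1, deriv f (a + t * (x - a)), ?_, by simp, ?_⟩
  · have hφ : ContDiff ℝ ∞ (fun p : ℝ × ℝ => a + p.2 * (p.1 - a)) := by fun_prop
    have hU : IsOpen ((fun p : ℝ × ℝ => a + p.2 * (p.1 - a)) ⁻¹' Ioo α β) :=
      isOpen_Ioo.preimage hφ.continuous
    exact contDiffOn_intervalIntegral_param (f := fun p => deriv f (a + p.2 * (p.1 - a))) hU
      (hd.2.comp hφ.contDiffOn fun p hp => hp) isOpen_Ioo hcv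
  · intro x hx
    have hF : ∀ t ∈ uIcc (0 : ℝ) 1, HasDerivAt (fun t => f (a + t * (x - a)))
        (deriv f (a + t * (x - a)) * (x - a)) t := by
      intro t ht
      have h1 : HasDerivAt f (deriv f (a + t * (x - a))) (a + t * (x - a)) :=
        ((hd.1 _ (hcv x hx t ht)).differentiableAt (isOpen_Ioo.mem_nhds (hcv x hx t ht))).hasDerivAt
      have h2 : HasDerivAt (fun t : ℝ => a + t * (x - a)) (x - a) t := by
        simpa using ((hasDerivAt_id t).mul_const (x - a)).const_add a
      exact h1.comp t h2
    have hint := intervalIntegral.integral_eq_sub_of_hasDerivAt hF (ContinuousOn.intervalIntegrable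
      ((hd.2.continuousOn.comp (by fun_prop) (hcv x hx)).mul continuousOn_const))
    rw [intervalIntegral.integral_mul_const] at hint
    simp only [one_mul, zero_mul, add_zero, h0, sub_zero] at hint
    rw [mul_comm, hint]
    congr 1; ring

theorem deriv_neg_of_even {f : ℝ → ℝ} {R : ℝ} (he : ∀ x ∈ Ioo (-R) R, f (-x) = f x)
    {x : ℝ} (hx : x ∈ Ioo (-R) R) : deriv f (-x) = -deriv f x := by
  have h : (fun y => f (-y)) =ᶠ[nhds x] f := by
    filter_upwards [isOpen_Ioo.mem_nhds hx] with y hy using he y hy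
  rw [← h.deriv_eq, deriv_comp_neg, neg_neg]

theorem deriv_neg_of_odd {f : ℝ → ℝ} {R : ℝ} (he : ∀ x ∈ Ioo (-R) R, f (-x) = -f x)
    {x : ℝ} (hx : x ∈ Ioo (-R) R) : deriv f (-x) = deriv f x := by
  have h : (fun y => f (-y)) =ᶠ[nhds x] -f := by
    filter_upwards [isOpen_Ioo.mem_nhds hx] with y hy using he y hy
  have h2 := h.deriv_eq
  rw [deriv_comp_neg, deriv.neg] at h2
  simpa using h2

/-- The derivative of an even function is odd, so it vanishes at `0` and can be divided by `x`,
leaving an even quotient. This drives the induction for `f(√u)`: its derivative `f'(√u) / (2√u)` is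
`g(√u) / 2`, with `g` of the same kind as `f`. -/
theorem exists_even_deriv_eq_mul {f : ℝ → ℝ} {R : ℝ} (hR : 0 < R)
    (hf : ContDiffOn ℝ ∞ f (Ioo (-R) R)) (he : ∀ x ∈ Ioo (-R) R, f (-x) = f x) :
    ∃ g : ℝ → ℝ, ContDiffOn ℝ ∞ g (Ioo (-R) R) ∧ (∀ x ∈ Ioo (-R) R, g (-x) = g x) ∧
      ∀ x ∈ Ioo (-R) R, deriv f x = x * g x := by
  have h0 : (0 : ℝ) ∈ Ioo (-R) R := ⟨by linarith, hR⟩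
  have hd0 : deriv f 0 = 0 := by
    have := deriv_neg_of_even he h0
    rw [neg_zero] at this; linarith
  obtain ⟨g, hg, -, hfg⟩ := exists_contDiffOn_eq_sub_mul h0
    ((contDiffOn_infty_iff_deriv_of_isOpen isOpen_Ioo).1 hf).2 hd0
  simp only [sub_zero] at hfg
  refine ⟨g, hg, fun x hx => ?_, hfg⟩
  rcases eq_or_ne x 0 with rfl | hx0
  · simp
  · have h1 := deriv_neg_of_even he hx
    rw [hfg x hx, hfg (-x) ⟨by linarith [hx.2], by linarith [hx.1]⟩] at h1
    have : x * (g (-x) - g x) = 0 := by linarith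
    rcases mul_eq_zero.1 this with h | h
    · exact absurd h hx0
    · linarith

theorem sqrt_mem_Ioo_of_mem_Ico {R u : ℝ} (hR : 0 < R) (hu : u ∈ Ico 0 (R ^ 2)) :
    Real.sqrt u ∈ Ioo (-R) R :=
  ⟨by linarith [Real.sqrt_nonneg u], (Real.sqrt_lt' hR).2 hu.2⟩

/-- A smooth even function is a smooth function of the square. -/
theorem contDiffOn_comp_sqrt_of_even {f : ℝ → ℝ} {R : ℝ} (hR : 0 < R)
    (hf : ContDiffOn ℝ ∞ f (Ioo (-R) R)) (he : ∀ x ∈ Ioo (-R) R, f (-x) = f x) :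
    ContDiffOn ℝ ∞ (fun u => f (Real.sqrt u)) (Ico 0 (R ^ 2)) := by
  have hud : UniqueDiffOn ℝ (Ico 0 (R ^ 2)) := uniqueDiffOn_Ico _ _
  have hcont : ∀ f : ℝ → ℝ, ContDiffOn ℝ ∞ f (Ioo (-R) R) →
      ContinuousOn (fun u => f (Real.sqrt u)) (Ico 0 (R ^ 2)) := fun f hf =>
    hf.continuousOn.comp Real.continuous_sqrt.continuousOn
      fun u hu => sqrt_mem_Ioo_of_mem_Ico hR hu
  rw [contDiffOn_infty]
  intro n
  induction n generalizing f with
  | zero => exact contDiffOn_zero.2 (hcont f hf)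
  | succ n ih =>
    obtain ⟨g, hg, hge, hfg⟩ := exists_even_deriv_eq_mul hR hf he
    have hder : ∀ u ∈ Ioo 0 (R ^ 2), HasDerivAt (fun u => f (Real.sqrt u))
        (g (Real.sqrt u) / 2) u := by
      intro u hu
      have hs := sqrt_mem_Ioo_of_mem_Ico hR ⟨hu.1.le, hu.2⟩
      have h1 : HasDerivAt f (deriv f (Real.sqrt u)) (Real.sqrt u) :=
        ((hf.contDiffAt (isOpen_Ioo.mem_nhds hs)).differentiableAt (by simp)).hasDerivAt
      have h2 := h1.comp u (Real.hasDerivAt_sqrt hu.1.ne')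
      have hpos := Real.sqrt_pos.2 hu.1
      refine h2.congr_deriv ?_
      rw [hfg _ hs]; field_simp
    have hder' : ∀ u ∈ Ico 0 (R ^ 2), HasDerivWithinAt (fun u => f (Real.sqrt u))
        (g (Real.sqrt u) / 2) (Ico 0 (R ^ 2)) u := by
      intro u hu
      rcases eq_or_lt_of_le hu.1 with h | h
      · subst h
        have hR2 : (0 : ℝ) < R ^ 2 := by positivity
        refine HasDerivWithinAt.mono (t := Ici 0) ?_ Ico_subset_Ici_self
        -- At `u = 0` the square root is not differentiable; the one-sided derivative is the limit
        -- of the derivatives at `u > 0`.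
        refine hasDerivWithinAt_Ici_of_tendsto_deriv (s := Ioo 0 (R ^ 2))
          (fun u hu => (hder u hu).differentiableAt.differentiableWithinAt)
          ((hcont f hf 0 ⟨le_rfl, hR2⟩).mono Ioo_subset_Ico_self) (Ioo_mem_nhdsGT hR2) ?_
        have h2 : Filter.Tendsto (fun u => g (Real.sqrt u) / 2) (nhdsWithin 0 (Ioi 0))
            (nhds (g (Real.sqrt 0) / 2)) := by
          refine Filter.Tendsto.div_const ?_ 2
          exact (hcont g hg 0 ⟨le_rfl, hR2⟩).tendsto.mono_left
            (nhdsWithin_le_iff.2 (Filter.mem_of_superset (Ioo_mem_nhdsGT hR2) Ioo_subset_Ico_self))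
        refine h2.congr' ?_
        filter_upwards [Ioo_mem_nhdsGT hR2] with u hu using (hder u hu).deriv.symm
      · exact (hder u ⟨h, hu.2⟩).hasDerivWithinAt
    push_cast
    rw [contDiffOn_succ_iff_derivWithin hud]
    refine ⟨fun u hu => (hder' u hu).differentiableWithinAt, by simp, ?_⟩
    exact ((ih hg hge).div_const 2).congr fun u hu => (hder' u hu).derivWithin (hud u hu)

/-- A smooth even function whose value at `0` is `v` is `v + x² k(x)` with `k` smooth and even. -/
theorem exists_even_eq_add_sq_mul {f : ℝ → ℝ} {R : ℝ} (hR : 0 < R)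
    (hf : ContDiffOn ℝ ∞ f (Ioo (-R) R)) (he : ∀ x ∈ Ioo (-R) R, f (-x) = f x) :
    ∃ k : ℝ → ℝ, ContDiffOn ℝ ∞ k (Ioo (-R) R) ∧ (∀ x ∈ Ioo (-R) R, k (-x) = k x) ∧
      ∀ x ∈ Ioo (-R) R, f x = f 0 + x ^ 2 * k x := by
  have h0 : (0 : ℝ) ∈ Ioo (-R) R := ⟨by linarith, hR⟩
  have hd0 : deriv f 0 = 0 := by
    have := deriv_neg_of_even he h0
    rw [neg_zero] at this; linarith
  obtain ⟨g, hg, hg0, hfg⟩ := exists_contDiffOn_eq_sub_mul h0 (hf.sub contDiffOn_const)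
    (sub_self (f 0))
  have hg0' : g 0 = 0 := hg0.trans ((deriv_sub_const (f := f) (x := (0 : ℝ)) (f 0)).trans hd0)
  obtain ⟨k, hk, -, hgk⟩ := exists_contDiffOn_eq_sub_mul h0 hg hg0'
  have hfk : ∀ x ∈ Ioo (-R) R, f x = f 0 + x ^ 2 * k x := by
    intro x hx
    have h1 := hfg x hx
    rw [hgk x hx] at h1
    linear_combination h1
  refine ⟨k, hk, fun x hx => ?_, hfk⟩
  rcases eq_or_ne x 0 with rfl | hx0
  · simp
  · have h1 := he x hx
    rw [hfk x hx, hfk (-x) ⟨by linarith [hx.2], by linarith [hx.1]⟩] at h1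
    have h2 : x ^ 2 ≠ 0 := pow_ne_zero 2 hx0
    have : x ^ 2 * k (-x) = x ^ 2 * k x := by linear_combination h1
    exact mul_left_cancel₀ h2 this

end SmoothAnalysis

/-! ### Reflection of the orbifold, and the profile near a pole with its inverse -/

namespace SpindleOrbifold
variable (S : SpindleOrbifold)

/-- The orbifold with the two poles exchanged. -/
def reflect : SpindleOrbifold where
  m := S.n
  n := S.m
  m_pos := S.n_pos
  n_pos := S.m_pos
  M := S.M
  M_pos := S.M_pos
  r s := S.r (S.M - s)
  smooth := S.smooth.comp (contDiff_const.sub contDiff_id)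
  pos s hs := S.pos _ ⟨by linarith [hs.2], by linarith [hs.1]⟩
  odd_zero s := by rw [sub_neg_eq_add]; exact S.odd_M s
  odd_M s := by
    rw [sub_add_cancel_left, sub_sub_cancel]; exact S.odd_zero s
  deriv_zero := by
    rw [deriv_comp_const_sub, sub_zero, S.deriv_M, neg_neg]
  deriv_M := by
    rw [deriv_comp_const_sub, sub_self, S.deriv_zero]

theorem reflect_r (s : ℝ) : S.reflect.r s = S.r (S.M - s) := rfl

theorem reflect_M : S.reflect.M = S.M := rfl

theorem deriv_reflect_r (s : ℝ) : deriv S.reflect.r s = -deriv S.r (S.M - s) :=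
  deriv_comp_const_sub (f := S.r) (a := S.M) (x := s)

variable {S}

theorem sub_mem_Ioo {s : ℝ} (hs : s ∈ Ioo 0 S.M) : S.M - s ∈ Ioo 0 S.M :=
  ⟨by linarith [hs.2], by linarith [hs.1]⟩

theorem IsMinimalEquator.reflect {s₀ : ℝ} (h : S.IsMinimalEquator s₀) :
    S.reflect.IsMinimalEquator (S.M - s₀) := by
  refine ⟨sub_mem_Ioo h.1, ?_, fun s hs hd => ?_⟩
  · rw [deriv_reflect_r, sub_sub_cancel, h.2.1, neg_zero]
  · rw [reflect_r, reflect_r, sub_sub_cancel]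
    rw [deriv_reflect_r, neg_eq_zero] at hd
    exact h.2.2 _ (sub_mem_Ioo hs) hd

variable (S)

theorem differentiable_r : Differentiable ℝ S.r := S.smooth.differentiable (by simp)

theorem hasDerivAt_r (s : ℝ) : HasDerivAt S.r (deriv S.r s) s :=
  (S.differentiable_r s).hasDerivAt

theorem smooth_deriv_r : ContDiff ℝ ∞ (deriv S.r) := (contDiff_infty_iff_deriv.1 S.smooth).2

theorem continuous_r : Continuous S.r := S.smooth.continuous

theorem deriv_r_neg (s : ℝ) : deriv S.r (-s) = deriv S.r s :=
  deriv_neg_of_odd (R := |s| + 1) (fun x _ => S.odd_zero x)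
    ⟨by linarith [neg_abs_le s], by linarith [le_abs_self s]⟩

variable {S}

theorem IsMinimalEquator.r_pos {s₀ : ℝ} (h : S.IsMinimalEquator s₀) : 0 < S.r s₀ := S.pos _ h.1

/-- Below the level of the minimal equator, the profile is increasing near the first pole. -/
theorem IsMinimalEquator.exists_left {s₀ : ℝ} (h : S.IsMinimalEquator s₀) :
    ∃ s₁, 0 < s₁ ∧ s₁ ≤ s₀ ∧ S.r s₁ = S.r s₀ ∧ (∀ s ∈ Ico 0 s₁, 0 < deriv S.r s) ∧
      (∀ s ∈ Ico 0 s₁, S.r s < S.r s₀) ∧ ∀ s ∈ Icc s₁ s₀, S.r s₀ ≤ S.r s := by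
  have hK : IsCompact (Icc 0 s₀ ∩ S.r ⁻¹' Ici (S.r s₀)) :=
    isCompact_Icc.inter_right (isClosed_Ici.preimage S.continuous_r)
  -- `s₁` is the first height at which the profile reaches the level of the equator.
  obtain ⟨s₁, ⟨⟨h10, h11⟩, h12⟩, hmin⟩ := hK.exists_isLeast ⟨s₀, ⟨h.1.1.le, le_rfl⟩, le_refl (S.r s₀)⟩
  have hlt : ∀ s ∈ Ico 0 s₁, S.r s < S.r s₀ := by
    intro s hs
    by_contra! hc
    exact absurd (hmin ⟨⟨hs.1, hs.2.le.trans h11⟩, hc⟩) (not_le.2 hs.2)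
  have hpos : 0 < s₁ := by
    rcases eq_or_lt_of_le h10 with h0 | h0
    · rw [← h0] at h12
      have : S.r s₀ ≤ S.r 0 := h12
      rw [S.r_zero] at this
      exact absurd h.r_pos (not_lt.2 this)
    · exact h0
  have heq : S.r s₁ = S.r s₀ := by
    refine le_antisymm ?_ h12
    have : s₁ ∈ closure (Ico 0 s₁) := by
      rw [closure_Ico hpos.ne]; exact ⟨hpos.le, le_rfl⟩
    exact closure_minimal (fun s hs => (hlt s hs).le)
      (isClosed_Iic.preimage S.continuous_r) this
  refine ⟨s₁, hpos, h11, heq, ?_, hlt, ?_⟩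
  · have h0 : 0 < deriv S.r 0 := by
      rw [S.deriv_zero]; exact one_div_pos.2 (Nat.cast_pos.2 S.m_pos)
    -- A critical point below `s₁` would have a critical value smaller than the minimal one. Then
    -- `r'` keeps the sign it has at the pole.
    have hne : ∀ s ∈ Ico 0 s₁, deriv S.r s ≠ 0 := by
      intro s hs hd
      rcases eq_or_lt_of_le hs.1 with h' | h'
      · rw [← h'] at hd; exact h0.ne' hd
      · exact absurd (h.2.2 s ⟨h', by linarith [hs.2, h.1.2]⟩ hd) (not_le.2 (hlt s hs))
    intro s hs
    by_contra! hc
    obtain ⟨x, hx, hx0⟩ := intermediate_value_Icc' hs.1 S.smooth_deriv_r.continuous.continuousOn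
      ⟨hc, h0.le⟩
    exact hne x ⟨hx.1, hx.2.trans_lt hs.2⟩ hx0
  · intro s hs
    obtain ⟨x, hx, hxm⟩ := isCompact_Icc.exists_isMinOn ⟨s, hs⟩ S.continuous_r.continuousOn
    -- A minimum of `r` on `[s₁, s₀]` below the level of the end points would be interior, hence a
    -- critical point with too small a value.
    refine le_trans ?_ (hxm hs)
    by_contra! hc
    have hx1 : s₁ < x := lt_of_le_of_ne hx.1 fun h' => by rw [← h', heq] at hc; exact hc.false
    have hx2 : x < s₀ := lt_of_le_of_ne hx.2 fun h' => by rw [h'] at hc; exact hc.false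
    have hd : deriv S.r x = 0 := (hxm.isLocalMin (Icc_mem_nhds hx1 hx2)).deriv_eq_zero
    exact absurd (h.2.2 x ⟨hpos.trans hx1, hx2.trans h.1.2⟩ hd) (not_le.2 hc)

variable (S) in
/-- `κ` is the inverse of the profile near the first pole, below the level `R`. -/
structure IsLeftInverse (R s₁ : ℝ) (κ : ℝ → ℝ) : Prop where
  smooth : ContDiffOn ℝ ∞ κ (Ioo (-R) R)
  mem : ∀ x ∈ Ioo (-R) R, κ x ∈ Ioo (-s₁) s₁
  r_mem : ∀ s ∈ Ioo (-s₁) s₁, S.r s ∈ Ioo (-R) R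
  r_apply : ∀ x ∈ Ioo (-R) R, S.r (κ x) = x
  apply_r : ∀ s ∈ Ioo (-s₁) s₁, κ (S.r s) = s
  deriv_pos : ∀ x ∈ Ioo (-R) R, 0 < deriv κ x
  deriv_zero : deriv κ 0 = S.m
  neg : ∀ x ∈ Ioo (-R) R, κ (-x) = -κ x
  strictMono : StrictMonoOn κ (Ioo (-R) R)

/-- Oddness of `r` carries the positivity of `r'` over to the symmetric interval, and the inverse
function theorem gives smoothness at each point. The symmetric interval matters: it makes `κ` smooth
and odd across the pole, so that `κ'` is even. -/
theorem exists_isLeftInverse {R s₁ : ℝ} (hs₁ : 0 < s₁) (hR : S.r s₁ = R) (hR0 : 0 < R)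
    (hd : ∀ s ∈ Ico 0 s₁, 0 < deriv S.r s) : ∃ κ, S.IsLeftInverse R s₁ κ := by
  have hd' : ∀ s ∈ Ioo (-s₁) s₁, 0 < deriv S.r s := by
    intro s hs
    rcases le_total 0 s with h | h
    · exact hd s ⟨h, hs.2⟩
    · rw [← S.deriv_r_neg]; exact hd _ ⟨by linarith, by linarith [hs.1]⟩
  have hmono : StrictMonoOn S.r (Icc (-s₁) s₁) :=
    strictMonoOn_of_deriv_pos (convex_Icc _ _) S.continuous_r.continuousOn
      (by rw [interior_Icc]; exact hd')
  have hmono' := hmono.mono Ioo_subset_Icc_self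
  have hneg : S.r (-s₁) = -R := by rw [S.odd_zero, hR]
  have hsurj : ∀ x ∈ Ioo (-R) R, ∃ s ∈ Ioo (-s₁) s₁, S.r s = x := by
    intro x hx
    have := intermediate_value_Ioo (by linarith : -s₁ ≤ s₁) S.continuous_r.continuousOn
    rw [hneg, hR] at this
    exact this hx
  have hmaps : ∀ s ∈ Ioo (-s₁) s₁, S.r s ∈ Ioo (-R) R := by
    intro s hs
    constructor
    · rw [← hneg]; exact hmono ⟨le_rfl, by linarith⟩ (Ioo_subset_Icc_self hs) hs.1
    · rw [← hR]; exact hmono (Ioo_subset_Icc_self hs) ⟨by linarith, le_rfl⟩ hs.2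
  choose! κ hκ1 hκ2 using hsurj
  have happ : ∀ s ∈ Ioo (-s₁) s₁, κ (S.r s) = s := fun s hs =>
    hmono'.injOn (hκ1 _ (hmaps s hs)) hs (hκ2 _ (hmaps s hs))
  have hloc : ∀ x ∈ Ioo (-R) R, ContDiffAt ℝ ∞ κ x := by
    intro x hx
    have hne := (hd' _ (hκ1 x hx)).ne'
    have hfd := (S.hasDerivAt_r (κ x)).hasFDerivAt_equiv hne
    have hcd : ContDiffAt ℝ ∞ S.r (κ x) := S.smooth.contDiffAt
    have h1 := hcd.to_localInverse hfd (by simp)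
    rw [hκ2 x hx] at h1
    refine h1.congr_of_eventuallyEq ?_
    have hst := hcd.hasStrictFDerivAt' hfd (by simp)
    have h2 : ∀ᶠ y in nhds x, S.r (hcd.localInverse hfd (by simp) y) = y := by
      have := hst.eventually_right_inverse
      rw [hκ2 x hx] at this
      exact this
    have h3 : ∀ᶠ y in nhds x, hcd.localInverse hfd (by simp) y ∈ Ioo (-s₁) s₁ := by
      have h4 := h1.continuousAt
      have h5 : hcd.localInverse hfd (by simp) x = κ x := by
        have := hcd.localInverse_apply_image hfd (by simp)
        rwa [hκ2 x hx] at this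
      rw [ContinuousAt, h5] at h4
      exact h4 (isOpen_Ioo.mem_nhds (hκ1 x hx))
    filter_upwards [h2, h3] with y hy hy'
    rw [← happ _ hy', hy]
  have hder : ∀ x ∈ Ioo (-R) R, deriv κ x * deriv S.r (κ x) = 1 := by
    intro x hx
    have h1 : HasDerivAt κ (deriv κ x) x := ((hloc x hx).differentiableAt (by simp)).hasDerivAt
    have h2 := (S.hasDerivAt_r (κ x)).comp x h1
    have h3 : HasDerivAt (S.r ∘ κ) 1 x := (hasDerivAt_id x).congr_of_eventuallyEq (by
      filter_upwards [isOpen_Ioo.mem_nhds hx] with y hy using hκ2 y hy)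
    rw [mul_comm]; exact h2.unique h3
  have hpos : ∀ x ∈ Ioo (-R) R, 0 < deriv κ x := fun x hx =>
    pos_of_mul_pos_left (by rw [hder x hx]; exact one_pos) (hd' _ (hκ1 x hx)).le
  have hsm : ContDiffOn ℝ ∞ κ (Ioo (-R) R) := fun x hx => (hloc x hx).contDiffWithinAt
  have h0R : (0 : ℝ) ∈ Ioo (-R) R := ⟨by linarith, hR0⟩
  have h0s : (0 : ℝ) ∈ Ioo (-s₁) s₁ := ⟨by linarith, hs₁⟩
  refine ⟨κ, hsm, hκ1, hmaps, hκ2, happ, hpos, ?_, ?_, ?_⟩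
  · have h0 : κ 0 = 0 := by have := happ 0 h0s; rwa [S.r_zero] at this
    have := hder 0 h0R
    rw [h0, S.deriv_zero] at this
    have hm : (S.m : ℝ) ≠ 0 := Nat.cast_ne_zero.2 S.m_pos.ne'
    field_simp at this
    exact this
  · intro x hx
    have hk := hκ1 x hx
    have := happ (-κ x) ⟨by linarith [hk.2], by linarith [hk.1]⟩
    rwa [S.odd_zero, hκ2 x hx] at this
  · refine strictMonoOn_of_deriv_pos (convex_Ioo _ _) hsm.continuousOn ?_
    rw [interior_Ioo]; exact hpos

theorem IsLeftInverse.zero {R s₁ : ℝ} {κ : ℝ → ℝ} (h : S.IsLeftInverse R s₁ κ) (hs₁ : 0 < s₁) :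
    κ 0 = 0 := by
  have := h.apply_r 0 ⟨by linarith, hs₁⟩
  rwa [S.r_zero] at this

theorem IsLeftInverse.mem_pos {R s₁ : ℝ} {κ : ℝ → ℝ} (h : S.IsLeftInverse R s₁ κ) (hs₁ : 0 < s₁)
    {x : ℝ} (hx : x ∈ Ioo 0 R) : κ x ∈ Ioo 0 s₁ := by
  have hx' : x ∈ Ioo (-R) R := ⟨by linarith [hx.1, hx.2], hx.2⟩
  refine ⟨?_, (h.mem x hx').2⟩
  have := h.strictMono ⟨by linarith [hx.1, hx.2], by linarith [hx.1, hx.2]⟩ hx' hx.1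
  rwa [h.zero hs₁] at this

/-- This splitting isolates the cone order: the constant `m` will produce the jump of the angle at
`c = 0`, and the factor `x²` in the rest cancels the singularity of the density. -/
theorem IsLeftInverse.exists_deriv_eq {R s₁ : ℝ} {κ : ℝ → ℝ} (h : S.IsLeftInverse R s₁ κ)
    (hR : 0 < R) : ∃ k : ℝ → ℝ, ContDiffOn ℝ ∞ (fun u => k (√u)) (Ico 0 (R ^ 2)) ∧
      ∀ x ∈ Ioo (-R) R, deriv κ x = S.m + x ^ 2 * k x := by
  obtain ⟨k, hk, hke, hfk⟩ := exists_even_eq_add_sq_mul hR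
    ((contDiffOn_infty_iff_deriv_of_isOpen isOpen_Ioo).1 h.smooth).2
    (fun x hx => deriv_neg_of_odd h.neg hx)
  rw [h.deriv_zero] at hfk
  exact ⟨k, contDiffOn_comp_sqrt_of_even hR hk hke, hfk⟩

end SpindleOrbifold

/-! ### The angle collected near a pole -/

namespace SpindleOrbifold
variable (S : SpindleOrbifold)

/-- The density `dθ/ds` along a geodesic with Clairaut constant `c`; it vanishes where
`r s ≤ c`. -/
noncomputable def angleDensity (c s : ℝ) : ℝ := c / (S.r s * √(S.r s ^ 2 - c ^ 2))

variable {S}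

theorem angleDensity_eq_zero {c s : ℝ} (h0 : 0 ≤ S.r s) (h : S.r s ≤ c) :
    S.angleDensity c s = 0 := by
  rw [angleDensity, Real.sqrt_eq_zero_of_nonpos, mul_zero, div_zero]
  nlinarith

/-- The singular part of the angle near a pole. It tends to `π/2` as `c → 0+`; the complementary
arctangent extends smoothly and oddly to `c ≤ 0`. -/
theorem integral_div_sq_add_sq {c Y : ℝ} (hc : 0 < c) (hY : 0 < Y) :
    ∫ y in (0 : ℝ)..Y, c / (c ^ 2 + y ^ 2) = Real.pi / 2 - Real.arctan (c / Y) := by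
  have h1 : ∀ y : ℝ, HasDerivAt (fun y => Real.arctan (y / c)) (c / (c ^ 2 + y ^ 2)) y := by
    intro y
    refine (((hasDerivAt_id y).div_const c).arctan).congr_deriv ?_
    have : c ^ 2 + y ^ 2 ≠ 0 := by positivity
    simp only [id]
    field_simp
  rw [intervalIntegral.integral_eq_sub_of_hasDerivAt (fun y _ => h1 y)]
  · rw [zero_div, Real.arctan_zero, sub_zero, ← inv_div c Y,
      Real.arctan_inv_of_pos (div_pos hc hY)]
  · refine Continuous.intervalIntegrable ?_ _ _
    exact continuous_const.div (by fun_prop) fun y => by positivity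

/-- The remainder of the angle collected near a pole. -/
noncomputable def angleRemainder (m ρ : ℝ) (k : ℝ → ℝ) (c : ℝ) : ℝ :=
  c * √(ρ ^ 2 - c ^ 2) * (∫ t in (0 : ℝ)..1, k (√(c ^ 2 + (ρ ^ 2 - c ^ 2) * t ^ 2))) -
    m * Real.arctan (c / √(ρ ^ 2 - c ^ 2))

theorem sq_lt_of_mem {c ρ : ℝ} (hc : c ∈ Ioo (-ρ) ρ) : 0 < ρ ^ 2 - c ^ 2 := by
  nlinarith [hc.1, hc.2]

/-- With the limits of integration rescaled to `[0, 1]`, the parameter enters `k` only through a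
polynomial under the root, with values in `[0, R²)`. Thus smoothness of `k(√u)`, one-sided at `u =
0`, is enough even at `c = 0`. -/
theorem contDiffOn_angleRemainder {m ρ R : ℝ} {k : ℝ → ℝ} (hρ : ρ ∈ Ioo 0 R)
    (hk : ContDiffOn ℝ ∞ (fun u => k (√u)) (Ico 0 (R ^ 2))) :
    ContDiffOn ℝ ∞ (angleRemainder m ρ k) (Ioo (-ρ) ρ) := by
  have hsq : ContDiffOn ℝ ∞ (fun c : ℝ => √(ρ ^ 2 - c ^ 2)) (Ioo (-ρ) ρ) :=
    ContDiffOn.sqrt (by fun_prop) fun c hc => (sq_lt_of_mem hc).ne'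
  have hint : ContDiffOn ℝ ∞
      (fun c : ℝ => ∫ t in (0 : ℝ)..1, k (√(c ^ 2 + (ρ ^ 2 - c ^ 2) * t ^ 2))) (Ioo (-ρ) ρ) := by
    have hφ : ContDiff ℝ ∞ (fun p : ℝ × ℝ => p.1 ^ 2 + (ρ ^ 2 - p.1 ^ 2) * p.2 ^ 2) := by fun_prop
    have hU : IsOpen ((fun p : ℝ × ℝ => p.1) ⁻¹' Ioo (-ρ) ρ ∩
        (fun p : ℝ × ℝ => p.1 ^ 2 + (ρ ^ 2 - p.1 ^ 2) * p.2 ^ 2) ⁻¹' Iio (R ^ 2)) :=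
      (isOpen_Ioo.preimage continuous_fst).inter (isOpen_Iio.preimage hφ.continuous)
    refine contDiffOn_intervalIntegral_param
      (f := fun p => k (√(p.1 ^ 2 + (ρ ^ 2 - p.1 ^ 2) * p.2 ^ 2))) hU ?_ isOpen_Ioo ?_
    · refine hk.comp hφ.contDiffOn fun p hp => ⟨?_, hp.2⟩
      have := sq_lt_of_mem hp.1
      positivity
    · intro c hc t ht
      rw [uIcc_of_le zero_le_one] at ht
      refine ⟨hc, ?_⟩
      have h1 := sq_lt_of_mem hc
      have h2 : t ^ 2 ≤ 1 := pow_le_one₀ ht.1 ht.2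
      have h3 : ρ ^ 2 < R ^ 2 := pow_lt_pow_left₀ hρ.2 hρ.1.le two_ne_zero
      show c ^ 2 + (ρ ^ 2 - c ^ 2) * t ^ 2 < R ^ 2
      nlinarith
  refine ((contDiffOn_id.mul hsq).mul hint).sub (contDiffOn_const.mul ?_)
  exact Real.contDiff_arctan.comp_contDiffOn (contDiffOn_id.div hsq fun c hc =>
    (Real.sqrt_pos.2 (sq_lt_of_mem hc)).ne')

theorem angleRemainder_neg (m ρ : ℝ) (k : ℝ → ℝ) (c : ℝ) :
    angleRemainder m ρ k (-c) = -angleRemainder m ρ k c := by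
  simp only [angleRemainder, neg_sq, neg_div, Real.arctan_neg]
  ring

theorem sqrt_level_mem {c y ρ : ℝ} (hc : c ∈ Ioo 0 ρ) (hy : y ∈ Icc 0 √(ρ ^ 2 - c ^ 2)) :
    √(c ^ 2 + y ^ 2) ∈ Icc c ρ := by
  have hρ : 0 < ρ := hc.1.trans hc.2
  constructor
  · exact Real.le_sqrt_of_sq_le (by nlinarith [sq_nonneg y])
  · rw [Real.sqrt_le_left hρ.le]
    have h1 : y ^ 2 ≤ ρ ^ 2 - c ^ 2 := by
      rw [← Real.sq_sqrt (sq_lt_of_mem (c := c) (ρ := ρ) ⟨by linarith [hc.1], hc.2⟩).le]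
      exact pow_le_pow_left₀ hy.1 hy.2 2
    linarith

/-- The change of variable `y = √(r² - c²)` between the levels `c` and `ρ`. It removes the inverse
square root singularity of the density at the turning point. -/
theorem IsLeftInverse.image_level {R s₁ : ℝ} {κ : ℝ → ℝ} (h : S.IsLeftInverse R s₁ κ)
    {ρ c : ℝ} (hs₁ : 0 < s₁) (hρ : ρ < R) (hc : c ∈ Ioo 0 ρ) :
    (fun y => κ (√(c ^ 2 + y ^ 2))) '' Ioo 0 √(ρ ^ 2 - c ^ 2) = Ioo (κ c) (κ ρ) := by
  have hρ0 : 0 < ρ := hc.1.trans hc.2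
  have hcR : c ∈ Ioo (-R) R := ⟨by linarith [hc.1], hc.2.trans hρ⟩
  have hρR : ρ ∈ Ioo (-R) R := ⟨by linarith, hρ⟩
  have hY := sq_lt_of_mem (c := c) (ρ := ρ) ⟨by linarith [hc.1], hc.2⟩
  ext s
  constructor
  · rintro ⟨y, hy, rfl⟩
    have hx1 : c < √(c ^ 2 + y ^ 2) := Real.lt_sqrt_of_sq_lt (by nlinarith [hy.1])
    have hx2 : √(c ^ 2 + y ^ 2) < ρ := by
      rw [Real.sqrt_lt' hρ0]
      have : y ^ 2 < √(ρ ^ 2 - c ^ 2) ^ 2 := pow_lt_pow_left₀ hy.2 hy.1.le two_ne_zero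
      rw [Real.sq_sqrt hY.le] at this
      linarith
    have hxR : √(c ^ 2 + y ^ 2) ∈ Ioo (-R) R := ⟨by linarith [hc.1], hx2.trans hρ⟩
    exact ⟨h.strictMono hcR hxR hx1, h.strictMono hxR hρR hx2⟩
  · intro hs
    have hκc := h.mem_pos hs₁ (x := c) ⟨hc.1, hcR.2⟩
    have hκρ := h.mem_pos hs₁ (x := ρ) ⟨hρ0, hρ⟩
    have hs' : s ∈ Ioo (-s₁) s₁ := ⟨by linarith [hκc.1, hs.1], hs.2.trans hκρ.2⟩
    have hx := h.r_mem s hs'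
    have hsx := h.apply_r s hs'
    have hx1 : c < S.r s := (h.strictMono.lt_iff_lt hcR hx).1 (by rw [hsx]; exact hs.1)
    have hx2 : S.r s < ρ := (h.strictMono.lt_iff_lt hx hρR).1 (by rw [hsx]; exact hs.2)
    have h1 : 0 < S.r s ^ 2 - c ^ 2 := sq_lt_of_mem ⟨by linarith [hc.1], hx1⟩
    refine ⟨√(S.r s ^ 2 - c ^ 2), ⟨Real.sqrt_pos.2 h1, Real.sqrt_lt_sqrt h1.le ?_⟩, ?_⟩
    · have : S.r s ^ 2 < ρ ^ 2 := pow_lt_pow_left₀ hx2 (by linarith [hc.1]) two_ne_zero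
      linarith
    · show κ _ = s
      rw [Real.sq_sqrt h1.le, add_sub_cancel, Real.sqrt_sq (by linarith [hc.1]), hsx]

/-- The angle collected near a pole. -/
theorem IsLeftInverse.integral_angleDensity {R s₁ : ℝ} {κ k : ℝ → ℝ} (h : S.IsLeftInverse R s₁ κ)
    {ρ c : ℝ} (hs₁ : 0 < s₁) (hs₁M : s₁ < S.M)
    (hk : ContDiffOn ℝ ∞ (fun u => k (√u)) (Ico 0 (R ^ 2)))
    (hκ : ∀ x ∈ Ioo (-R) R, deriv κ x = S.m + x ^ 2 * k x) (hρ : ρ < R) (hc : c ∈ Ioo 0 ρ) :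
    IntegrableOn (S.angleDensity c) (Ioo 0 (κ ρ)) ∧
      ∫ s in Ioo 0 (κ ρ), S.angleDensity c s = S.m * (Real.pi / 2) + angleRemainder S.m ρ k c := by
  have hρ0 : 0 < ρ := hc.1.trans hc.2
  have hcR : c ∈ Ioo (-R) R := ⟨by linarith [hc.1], hc.2.trans hρ⟩
  have hκc := h.mem_pos hs₁ (x := c) ⟨hc.1, hcR.2⟩
  have hκρ := h.mem_pos hs₁ (x := ρ) ⟨hρ0, hρ⟩
  set Y := √(ρ ^ 2 - c ^ 2) with hYdef
  have hY2 := sq_lt_of_mem (c := c) (ρ := ρ) ⟨by linarith [hc.1], hc.2⟩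
  have hY : 0 < Y := Real.sqrt_pos.2 hY2
  have hsub : Ioo (κ c) (κ ρ) ⊆ Ioo 0 (κ ρ) := Ioo_subset_Ioo_left hκc.1.le
  -- Below the turning point the root is taken of a nonpositive number, so root and quotient both
  -- have the value `0`; only the strip above it contributes.
  have hzero : ∀ s ∈ Ioo 0 (κ ρ) \ Ioo (κ c) (κ ρ), S.angleDensity c s = 0 := by
    rintro s ⟨hs, hs2⟩
    have hsc : s ≤ κ c := by
      by_contra! hcon
      exact hs2 ⟨hcon, hs.2⟩
    have hs' : s ∈ Ioo (-s₁) s₁ := ⟨by linarith [hs.1], hs.2.trans hκρ.2⟩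
    refine angleDensity_eq_zero (S.pos s ⟨hs.1, hs'.2.trans hs₁M⟩).le ?_
    refine (h.strictMono.le_iff_le (h.r_mem s hs') hcR).1 ?_
    rwa [h.apply_r s hs']
  have hx : ∀ y ∈ Icc 0 Y, √(c ^ 2 + y ^ 2) ∈ Ioo (-R) R := fun y hy => by
    have := sqrt_level_mem hc hy
    exact ⟨by linarith [this.1, hc.1], by linarith [this.2]⟩
  have hφ : ∀ y ∈ Ioo 0 Y, HasDerivAt (fun y => κ (√(c ^ 2 + y ^ 2)))
      (deriv κ (√(c ^ 2 + y ^ 2)) * (y / √(c ^ 2 + y ^ 2))) y := by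
    intro y hy
    have hpos : 0 < c ^ 2 + y ^ 2 := by have := hc.1; positivity
    have h1 : HasDerivAt κ (deriv κ (√(c ^ 2 + y ^ 2))) (√(c ^ 2 + y ^ 2)) :=
      ((h.smooth.contDiffAt (isOpen_Ioo.mem_nhds (hx y (Ioo_subset_Icc_self hy)))).differentiableAt
        (by simp)).hasDerivAt
    have h2 : HasDerivAt (fun y : ℝ => √(c ^ 2 + y ^ 2)) (y / √(c ^ 2 + y ^ 2)) y := by
      refine (HasDerivAt.sqrt ((hasDerivAt_pow 2 y).const_add (c ^ 2)) hpos.ne').congr_deriv ?_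
      have := (Real.sqrt_pos.2 hpos).ne'
      field_simp
      norm_num
    exact h1.comp y h2
  have hinj : InjOn (fun y => κ (√(c ^ 2 + y ^ 2))) (Ioo 0 Y) := by
    intro y hy z hz hyz
    have h1 := h.strictMono.injOn (hx y (Ioo_subset_Icc_self hy)) (hx z (Ioo_subset_Icc_self hz)) hyz
    rw [Real.sqrt_inj (by positivity) (by positivity), add_right_inj] at h1
    exact (pow_left_inj₀ hy.1.le hz.1.le two_ne_zero).1 h1
  -- With `x² = c² + y²` the Jacobian is `κ'(x) y / x` and the density is `c / (x y)`. Their product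
  -- `c κ'(x) / x²` splits according to `κ' = m + x² k`.
  have hint : ∀ y ∈ Ioo 0 Y, |deriv κ (√(c ^ 2 + y ^ 2)) * (y / √(c ^ 2 + y ^ 2))| •
      S.angleDensity c (κ (√(c ^ 2 + y ^ 2))) =
        S.m * (c / (c ^ 2 + y ^ 2)) + c * k (√(c ^ 2 + y ^ 2)) := by
    intro y hy
    have hpos : 0 < c ^ 2 + y ^ 2 := by have := hc.1; positivity
    have hxy := hx y (Ioo_subset_Icc_self hy)
    have hxpos := Real.sqrt_pos.2 hpos
    have hy0 := hy.1
    rw [abs_of_nonneg (mul_nonneg (h.deriv_pos _ hxy).le (div_nonneg hy.1.le hxpos.le)),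
      angleDensity, h.r_apply _ hxy, hκ _ hxy, Real.sq_sqrt hpos.le, add_sub_cancel_left,
      Real.sqrt_sq hy.1.le, smul_eq_mul]
    have h3 : √(c ^ 2 + y ^ 2) * √(c ^ 2 + y ^ 2) = c ^ 2 + y ^ 2 := Real.mul_self_sqrt hpos.le
    have h4 : (S.m + (c ^ 2 + y ^ 2) * k √(c ^ 2 + y ^ 2)) * (y / √(c ^ 2 + y ^ 2)) *
        (c / (√(c ^ 2 + y ^ 2) * y)) = (S.m + (c ^ 2 + y ^ 2) * k √(c ^ 2 + y ^ 2)) * c /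
          (√(c ^ 2 + y ^ 2) * √(c ^ 2 + y ^ 2)) := by
      field_simp
    rw [h4, h3]
    field_simp
  have hkc : ContinuousOn (fun y => k (√(c ^ 2 + y ^ 2))) (Icc 0 Y) := by
    refine hk.continuousOn.comp (f := fun y : ℝ => c ^ 2 + y ^ 2) (by fun_prop) fun y hy => ?_
    refine ⟨by positivity, ?_⟩
    have := sqrt_level_mem hc hy
    rw [← Real.sqrt_lt' (hρ0.trans hρ)]
    exact this.2.trans_lt hρ
  have hc1 : ContinuousOn (fun y : ℝ => c / (c ^ 2 + y ^ 2)) (Icc 0 Y) := by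
    refine ContinuousOn.div (by fun_prop) (by fun_prop) fun y _ => ?_
    have := hc.1
    positivity
  have hI1 : IntervalIntegrable (fun y : ℝ => (S.m : ℝ) * (c / (c ^ 2 + y ^ 2))) volume 0 Y :=
    ContinuousOn.intervalIntegrable (by rw [uIcc_of_le hY.le]; exact continuousOn_const.mul hc1)
  have hI2 : IntervalIntegrable (fun y : ℝ => c * k (√(c ^ 2 + y ^ 2))) volume 0 Y :=
    ContinuousOn.intervalIntegrable (by rw [uIcc_of_le hY.le]; exact continuousOn_const.mul hkc)
  have himg := h.image_level hs₁ hρ hc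
  constructor
  · refine IntegrableOn.of_forall_sdiff_eq_zero (s := Ioo (κ c) (κ ρ)) ?_ measurableSet_Ioo hzero
    rw [← himg, integrableOn_image_iff_integrableOn_abs_deriv_smul measurableSet_Ioo
      (fun y hy => (hφ y hy).hasDerivWithinAt) hinj, integrableOn_congr_fun hint measurableSet_Ioo]
    exact ((intervalIntegrable_iff_integrableOn_Ioo_of_le hY.le).1 (hI1.add hI2))
  · rw [setIntegral_eq_of_subset_of_forall_sdiff_eq_zero measurableSet_Ioo hsub hzero, ← himg,
      integral_image_eq_integral_abs_deriv_smul measurableSet_Ioo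
      (fun y hy => (hφ y hy).hasDerivWithinAt) hinj, setIntegral_congr_fun measurableSet_Ioo hint,
      ← integral_Ioc_eq_integral_Ioo, ← intervalIntegral.integral_of_le hY.le,
      intervalIntegral.integral_add hI1 hI2, intervalIntegral.integral_const_mul,
      intervalIntegral.integral_const_mul, integral_div_sq_add_sq hc.1 hY, angleRemainder]
    have h5 : ∫ y in (0 : ℝ)..Y, k √(c ^ 2 + y ^ 2) =
        Y * ∫ t in (0 : ℝ)..1, k √(c ^ 2 + (ρ ^ 2 - c ^ 2) * t ^ 2) := by
      have h6 := intervalIntegral.smul_integral_comp_mul_left (a := 0) (b := 1)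
        (fun y => k √(c ^ 2 + y ^ 2)) Y
      rw [mul_zero, mul_one, smul_eq_mul] at h6
      rw [← h6]
      congr 2
      ext t
      rw [mul_pow, hYdef, Real.sq_sqrt hY2.le]
    rw [h5]
    ring

end SpindleOrbifold

/-! ### Smoothness of the normalized angle -/

namespace SpindleOrbifold
variable (S : SpindleOrbifold)

/-- The angle swept during one period by a geodesic with Clairaut constant `c ≠ 0`. -/
noncomputable def angle (c : ℝ) : ℝ := 2 * ∫ s in Ioo 0 S.M, S.angleDensity c s

/-- The angle swept during one period, normalized to be continuous at `c = 0`. -/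
noncomputable def excess (c : ℝ) : ℝ := S.angle c - (S.m + S.n) * Real.pi * Real.sign c

theorem angleDensity_neg (c s : ℝ) : S.angleDensity (-c) s = -S.angleDensity c s := by
  rw [angleDensity, angleDensity, neg_sq, neg_div]

theorem angle_neg (c : ℝ) : S.angle (-c) = -S.angle c := by
  simp only [angle, angleDensity_neg, integral_neg, mul_neg]

theorem excess_neg (c : ℝ) : S.excess (-c) = -S.excess c := by
  rw [excess, excess, angle_neg, Real.sign_neg]; ring

theorem excess_zero : S.excess 0 = 0 := by
  have := S.excess_neg 0
  rw [neg_zero] at this; linarith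

theorem excess_of_pos {c : ℝ} (hc : 0 < c) :
    S.excess c = S.angle c - (S.m + S.n) * Real.pi := by
  rw [excess, Real.sign_of_pos hc, mul_one]

variable {S}

/-- Away from the poles `r ≥ ρ > |c|`, so the density is smooth in both variables and nothing
happens at `c = 0`. -/
theorem contDiffOn_integral_angleDensity {ρ a b : ℝ} (ha : 0 < a) (hab : a ≤ b) (hb : b < S.M)
    (hr : ∀ s ∈ Icc a b, ρ ≤ S.r s) :
    ContDiffOn ℝ ∞ (fun c => ∫ s in a..b, S.angleDensity c s) (Ioo (-ρ) ρ) := by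
  have hU : IsOpen ((univ ×ˢ Ioo 0 S.M) ∩
      (fun p : ℝ × ℝ => S.r p.2 ^ 2 - p.1 ^ 2) ⁻¹' Ioi 0) := by
    refine (isOpen_univ.prod isOpen_Ioo).inter (isOpen_Ioi.preimage ?_)
    have := S.continuous_r
    fun_prop
  refine contDiffOn_intervalIntegral_param (f := fun p => S.angleDensity p.1 p.2) hU ?_
    isOpen_Ioo ?_
  · have h2 : ContDiff ℝ ∞ (fun p : ℝ × ℝ => S.r p.2) := S.smooth.comp contDiff_snd
    refine contDiff_fst.contDiffOn.div (h2.contDiffOn.mul (ContDiffOn.sqrt ?_ ?_)) ?_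
    · exact ((h2.pow 2).sub (contDiff_fst.pow 2)).contDiffOn
    · exact fun p hp => hp.2.ne'
    · exact fun p hp => (mul_pos (S.pos _ hp.1.2) (Real.sqrt_pos.2 hp.2)).ne'
  · intro c hc s hs
    rw [uIcc_of_le hab] at hs
    refine ⟨⟨mem_univ _, ⟨ha.trans_le hs.1, hs.2.trans_lt hb⟩⟩, ?_⟩
    have h1 := sq_lt_of_mem hc
    have h2 : ρ ^ 2 ≤ S.r s ^ 2 := pow_le_pow_left₀ (by linarith [hc.1, hc.2]) (hr s hs) 2
    show 0 < S.r s ^ 2 - c ^ 2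
    linarith

theorem continuousOn_angleDensity {ρ a b c : ℝ} (ha : 0 < a) (hb : b < S.M)
    (hr : ∀ s ∈ Icc a b, ρ ≤ S.r s) (hc : c ∈ Ioo (-ρ) ρ) :
    ContinuousOn (S.angleDensity c) (Icc a b) := by
  have hr' := S.continuous_r
  refine continuousOn_const.div (by fun_prop) fun s hs => ?_
  have h1 := sq_lt_of_mem hc
  have h2 : ρ ^ 2 ≤ S.r s ^ 2 := pow_le_pow_left₀ (by linarith [hc.1, hc.2]) (hr s hs) 2
  exact (mul_pos (S.pos _ ⟨ha.trans_le hs.1, hs.2.trans_lt hb⟩)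
    (Real.sqrt_pos.2 (by linarith))).ne'

theorem angleDensity_reflect (c s : ℝ) :
    S.reflect.angleDensity c s = S.angleDensity c (S.M - s) := rfl

theorem integral_angleDensity_reflect (c b : ℝ) :
    ∫ s in (S.M - b)..S.M, S.angleDensity c s = ∫ s in (0 : ℝ)..b, S.reflect.angleDensity c s := by
  simp only [angleDensity_reflect]
  rw [intervalIntegral.integral_comp_sub_left (S.angleDensity c) S.M, sub_zero]

theorem intervalIntegrable_angleDensity_reflect {c b : ℝ}
    (h : IntervalIntegrable (S.reflect.angleDensity c) volume 0 b) :
    IntervalIntegrable (S.angleDensity c) volume (S.M - b) S.M := by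
  have := (h.comp_sub_left S.M).symm
  rw [sub_zero] at this
  refine this.congr fun s _ => ?_
  simp only [angleDensity_reflect, sub_sub_cancel]

/-- The angle function is smooth up to the contributions of the poles. -/
theorem IsMinimalEquator.exists_angle_eq {s₀ : ℝ} (h : S.IsMinimalEquator s₀) {ρ : ℝ}
    (hρ : ρ ∈ Ioo 0 (S.r s₀)) :
    ∃ w : ℝ → ℝ, ContDiffOn ℝ ∞ w (Ioo (-ρ) ρ) ∧ (∀ c, w (-c) = -w c) ∧
      ∀ c ∈ Ioo 0 ρ, IntegrableOn (S.angleDensity c) (Ioo 0 S.M) ∧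
        S.angle c = (S.m + S.n) * Real.pi + w c := by
  obtain ⟨s₁, hs₁, hs₁₀, hrs₁, hd₁, -, hge₁⟩ := h.exists_left
  obtain ⟨s₂, hs₂, hs₂₀, hrs₂, hd₂, -, hge₂⟩ := h.reflect.exists_left
  rw [reflect_r _ (S.M - s₀), sub_sub_cancel] at hrs₂ hge₂
  obtain ⟨κ₁, hκ₁⟩ := exists_isLeftInverse hs₁ hrs₁ h.r_pos hd₁
  obtain ⟨κ₂, hκ₂⟩ := exists_isLeftInverse hs₂ hrs₂ h.r_pos hd₂
  obtain ⟨k₁, hk₁, hdk₁⟩ := hκ₁.exists_deriv_eq h.r_pos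
  obtain ⟨k₂, hk₂, hdk₂⟩ := hκ₂.exists_deriv_eq h.r_pos
  have hρ' : ρ ∈ Ioo (-S.r s₀) (S.r s₀) := ⟨by linarith [hρ.1, hρ.2], hρ.2⟩
  have ha₁ := hκ₁.mem_pos hs₁ hρ
  have ha₂ := hκ₂.mem_pos hs₂ hρ
  set a₁ := κ₁ ρ with hadef₁
  set a₂ := κ₂ ρ with hadef₂
  have hab : a₁ < S.M - a₂ := by linarith [ha₁.2, ha₂.2]
  have hbM : S.M - a₂ < S.M := by linarith [ha₂.1]
  -- On either side of `s₀`, a point of the middle range lies on the monotone branch above the level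
  -- `ρ`, or beyond it, where `r` is at least the level of the equator.
  have hr : ∀ s ∈ Icc a₁ (S.M - a₂), ρ ≤ S.r s := by
    intro s hs
    rcases le_total s s₀ with hs0 | hs0
    · rcases lt_or_ge s s₁ with hs1 | hs1
      · have hs' : s ∈ Ioo (-s₁) s₁ := ⟨by linarith [ha₁.1, hs.1], hs1⟩
        refine (hκ₁.strictMono.le_iff_le hρ' (hκ₁.r_mem s hs')).1 ?_
        rw [hκ₁.apply_r s hs']; exact hs.1
      · exact hρ.2.le.trans (hge₁ s ⟨hs1, hs0⟩)
    · have hrr : S.r s = S.reflect.r (S.M - s) := by rw [reflect_r, sub_sub_cancel]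
      rw [hrr]
      rcases lt_or_ge (S.M - s) s₂ with hs1 | hs1
      · have hs' : S.M - s ∈ Ioo (-s₂) s₂ := ⟨by linarith [ha₂.1, hs.2], hs1⟩
        refine (hκ₂.strictMono.le_iff_le hρ' (hκ₂.r_mem _ hs')).1 ?_
        rw [hκ₂.apply_r _ hs']; linarith [hs.2]
      · exact hρ.2.le.trans (hge₂ _ ⟨hs1, by linarith⟩)
  -- Two pole remainders and the middle integral; the factor `2` counts the way up and the way down.
  refine ⟨fun c => 2 * (angleRemainder S.m ρ k₁ c + (∫ s in a₁..(S.M - a₂), S.angleDensity c s) +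
    angleRemainder S.n ρ k₂ c), ?_, ?_, ?_⟩
  · exact contDiffOn_const.mul (((contDiffOn_angleRemainder hρ hk₁).add
      (contDiffOn_integral_angleDensity ha₁.1 hab.le hbM hr)).add
        (contDiffOn_angleRemainder hρ hk₂))
  · intro c
    simp only [angleRemainder_neg, angleDensity_neg, intervalIntegral.integral_neg]
    ring
  · intro c hc
    obtain ⟨hi₁, he₁⟩ := hκ₁.integral_angleDensity hs₁ (by linarith [h.1.2]) hk₁ hdk₁ hρ.2 hc
    obtain ⟨hi₂, he₂⟩ := hκ₂.integral_angleDensity hs₂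
      (by rw [reflect_M]; linarith [h.1.1]) hk₂ hdk₂ hρ.2 hc
    rw [← intervalIntegrable_iff_integrableOn_Ioo_of_le ha₁.1.le] at hi₁
    rw [← intervalIntegrable_iff_integrableOn_Ioo_of_le ha₂.1.le] at hi₂
    rw [← integral_Ioc_eq_integral_Ioo, ← intervalIntegral.integral_of_le ha₁.1.le] at he₁
    rw [← integral_Ioc_eq_integral_Ioo, ← intervalIntegral.integral_of_le ha₂.1.le,
      ← integral_angleDensity_reflect] at he₂
    replace hi₂ := intervalIntegrable_angleDensity_reflect hi₂
    have him : IntervalIntegrable (S.angleDensity c) volume a₁ (S.M - a₂) := by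
      refine ContinuousOn.intervalIntegrable ?_
      rw [uIcc_of_le hab.le]
      exact continuousOn_angleDensity ha₁.1 hbM hr ⟨by linarith [hc.1, hc.2], hc.2⟩
    constructor
    · rw [← intervalIntegrable_iff_integrableOn_Ioo_of_le S.M_pos.le]
      exact (hi₁.trans him).trans hi₂
    · rw [angle, ← integral_Ioc_eq_integral_Ioo, ← intervalIntegral.integral_of_le S.M_pos.le,
        ← intervalIntegral.integral_add_adjacent_intervals (hi₁.trans him) hi₂,
        ← intervalIntegral.integral_add_adjacent_intervals hi₁ him, he₁, he₂]
      show _ = (S.m + S.n) * Real.pi + _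
      have : (S.reflect.m : ℝ) = S.n := rfl
      rw [this]
      ring

theorem IsMinimalEquator.exists_between_abs {s₀ : ℝ} {c : ℝ} (hc : c ∈ Ioo (-S.r s₀) (S.r s₀)) :
    ∃ ρ ∈ Ioo 0 (S.r s₀), c ∈ Ioo (-ρ) ρ := by
  obtain ⟨ρ, h1, h2⟩ := exists_between (abs_lt.2 ⟨hc.1, hc.2⟩)
  exact ⟨ρ, ⟨(abs_nonneg c).trans_lt h1, h2⟩, abs_lt.1 h1⟩

theorem IsMinimalEquator.integrableOn_angleDensity {s₀ : ℝ} (h : S.IsMinimalEquator s₀) {c : ℝ}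
    (hc : c ∈ Ioo 0 (S.r s₀)) : IntegrableOn (S.angleDensity c) (Ioo 0 S.M) := by
  obtain ⟨ρ, h1, h2⟩ := exists_between hc.2
  obtain ⟨w, -, -, hw⟩ := h.exists_angle_eq ⟨hc.1.trans h1, h2⟩
  exact (hw c ⟨hc.1, h1⟩).1

/-- For each level `ρ < R` the excess is the smooth odd function `w` on all of `(-ρ, ρ)`: for `c >
0` the jump term cancels, for `c < 0` both sides are odd, and at `0` both vanish. -/
theorem IsMinimalEquator.contDiffOn_excess {s₀ : ℝ} (h : S.IsMinimalEquator s₀) :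
    ContDiffOn ℝ ∞ S.excess (Ioo (-S.r s₀) (S.r s₀)) := by
  intro c hc
  obtain ⟨ρ, hρ, hcρ⟩ := exists_between_abs hc
  obtain ⟨w, hw, hodd, hw'⟩ := h.exists_angle_eq hρ
  refine ((hw.contDiffAt (isOpen_Ioo.mem_nhds hcρ)).congr_of_eventuallyEq ?_).contDiffWithinAt
  have hpos : ∀ x ∈ Ioo 0 ρ, S.excess x = w x := by
    intro x hx
    rw [S.excess_of_pos hx.1, (hw' x hx).2]; ring
  filter_upwards [isOpen_Ioo.mem_nhds hcρ] with x hx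
  rcases lt_trichotomy x 0 with h0 | h0 | h0
  · have := hpos (-x) ⟨by linarith, by linarith [hx.1]⟩
    rw [S.excess_neg, hodd] at this
    linarith
  · rw [h0, S.excess_zero]
    have := hodd 0
    rw [neg_zero] at this; linarith
  · exact hpos x ⟨h0, hx.2⟩

end SpindleOrbifold

/-! ### The radial action and the potential -/

theorem integral_div_mul_sqrt_of_le {r c : ℝ} (hc : 0 ≤ c) (hcr : c ≤ r) (hr : 0 < r) :
    IntervalIntegrable (fun x => x / (r * √(r ^ 2 - x ^ 2))) volume 0 c ∧
      ∫ x in (0 : ℝ)..c, x / (r * √(r ^ 2 - x ^ 2)) = 1 - √(1 - c ^ 2 / r ^ 2) := by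
  have hcont : ContinuousOn (fun x : ℝ => -√(1 - x ^ 2 / r ^ 2)) (Icc 0 c) := by fun_prop
  have hder : ∀ x ∈ Ioo 0 c, HasDerivAt (fun x : ℝ => -√(1 - x ^ 2 / r ^ 2))
      (x / (r * √(r ^ 2 - x ^ 2))) x := by
    intro x hx
    have h1 : 0 < r ^ 2 - x ^ 2 := by nlinarith [hx.1, hx.2]
    have h2 : 1 - x ^ 2 / r ^ 2 = (r ^ 2 - x ^ 2) / r ^ 2 := by field_simp
    have h3 : 0 < 1 - x ^ 2 / r ^ 2 := by rw [h2]; positivity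
    refine ((((hasDerivAt_pow 2 x).div_const (r ^ 2)).const_sub 1).sqrt h3.ne').neg.congr_deriv ?_
    have h4 : √(1 - x ^ 2 / r ^ 2) = √(r ^ 2 - x ^ 2) / r := by
      rw [h2, Real.sqrt_div h1.le, Real.sqrt_sq hr.le]
    have h5 := (Real.sqrt_pos.2 h1).ne'
    rw [h4]
    field_simp
    norm_num
  have hint : IntervalIntegrable (fun x => x / (r * √(r ^ 2 - x ^ 2))) volume 0 c :=
    (intervalIntegrable_iff_integrableOn_Ioc_of_le hc).2
      (intervalIntegral.integrableOn_deriv_of_nonneg hcont hder fun x hx =>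
        div_nonneg hx.1.le (mul_nonneg hr.le (Real.sqrt_nonneg _)))
  refine ⟨hint, ?_⟩
  rw [intervalIntegral.integral_eq_sub_of_hasDerivAt_of_le hc hcont hder hint]
  norm_num
  ring

/-- Past `x = r` the integrand vanishes, and so does the root on the right. The formula therefore
holds for all `c ≥ 0`, and in a double integral no turning point has to be tracked. -/
theorem integral_div_mul_sqrt {r c : ℝ} (hc : 0 ≤ c) (hr : 0 < r) :
    IntervalIntegrable (fun x => x / (r * √(r ^ 2 - x ^ 2))) volume 0 c ∧
      ∫ x in (0 : ℝ)..c, x / (r * √(r ^ 2 - x ^ 2)) = 1 - √(1 - c ^ 2 / r ^ 2) := by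
  rcases le_total c r with hcr | hcr
  · exact integral_div_mul_sqrt_of_le hc hcr hr
  · obtain ⟨h1, h2⟩ := integral_div_mul_sqrt_of_le hr.le le_rfl hr
    have hz : ∀ x ∈ Ioc r c, (0 : ℝ) = x / (r * √(r ^ 2 - x ^ 2)) := by
      intro x hx
      rw [Real.sqrt_eq_zero_of_nonpos (by nlinarith [hx.1]), mul_zero, div_zero]
    have h3 : IntervalIntegrable (fun x => x / (r * √(r ^ 2 - x ^ 2))) volume r c := by
      rw [intervalIntegrable_iff_integrableOn_Ioc_of_le hcr]
      exact (integrableOn_congr_fun hz measurableSet_Ioc).1 integrableOn_zero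
    refine ⟨h1.trans h3, ?_⟩
    rw [← intervalIntegral.integral_add_adjacent_intervals h1 h3, h2,
      intervalIntegral.integral_of_le hcr, ← setIntegral_congr_fun measurableSet_Ioc hz,
      integral_zero, add_zero, div_self (pow_ne_zero 2 hr.ne'), sub_self, Real.sqrt_zero,
      Real.sqrt_eq_zero_of_nonpos]
    rw [sub_nonpos, one_le_div (by positivity)]
    exact pow_le_pow_left₀ hr.le hcr 2

namespace SpindleOrbifold
variable (S : SpindleOrbifold)

/-- The radial action of a geodesic with Clairaut constant `c`. -/
noncomputable def action (c : ℝ) : ℝ := 2 * ∫ s in Ioo 0 S.M, √(1 - c ^ 2 / S.r s ^ 2)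

/-- The angle is minus the derivative of the action, in integrated form. Exchanging the two
integrations makes the inner one elementary and avoids differentiating an integral with moving
singular limits. -/
theorem integral_angle {c : ℝ} (hc : 0 ≤ c) :
    ∫ x in (0 : ℝ)..c, S.angle x = 2 * S.M - S.action c := by
  have hr := S.continuous_r
  have hmeas : Measurable (Function.uncurry S.angleDensity) := by
    unfold Function.uncurry angleDensity
    have : Measurable S.r := hr.measurable
    fun_prop
  have hae : ∀ᵐ s ∂(volume.restrict (Ioo 0 S.M)), 0 < S.r s := by
    filter_upwards [ae_restrict_mem measurableSet_Ioo] with s hs using S.pos s hs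
  have hmr : Measurable fun s => 1 - √(1 - c ^ 2 / S.r s ^ 2) := by
    have : Measurable S.r := hr.measurable
    fun_prop
  have hsq1 : ∀ s, √(1 - c ^ 2 / S.r s ^ 2) ≤ 1 := fun s => by
    have : 0 ≤ c ^ 2 / S.r s ^ 2 := by positivity
    exact Real.sqrt_le_one.2 (by linarith)
  have hbd : Integrable (fun s => 1 - √(1 - c ^ 2 / S.r s ^ 2))
      (volume.restrict (Ioo 0 S.M)) := by
    refine Integrable.of_bound (C := 1) hmr.aestronglyMeasurable (.of_forall fun s => ?_)
    rw [Real.norm_eq_abs, abs_le]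
    constructor <;> linarith [hsq1 s, Real.sqrt_nonneg (1 - c ^ 2 / S.r s ^ 2)]
  have hprod : Integrable (Function.uncurry S.angleDensity)
      ((volume.restrict (Ioc 0 c)).prod (volume.restrict (Ioo 0 S.M))) := by
    rw [integrable_prod_iff' hmeas.aestronglyMeasurable]
    constructor
    · filter_upwards [hae] with s hs
      exact (intervalIntegrable_iff_integrableOn_Ioc_of_le hc).1 (integral_div_mul_sqrt hc hs).1
    · refine hbd.congr ?_
      filter_upwards [hae] with s hs
      rw [← (integral_div_mul_sqrt hc hs).2, intervalIntegral.integral_of_le hc]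
      refine setIntegral_congr_fun measurableSet_Ioc fun x hx => ?_
      exact (Real.norm_of_nonneg (div_nonneg hx.1.le (mul_nonneg hs.le (Real.sqrt_nonneg _)))).symm
  have hswap := integral_integral_swap hprod
  rw [intervalIntegral.integral_of_le hc]
  simp only [angle, integral_const_mul]
  rw [hswap]
  have h1 : ∫ s in Ioo 0 S.M, ∫ x in Ioc 0 c, S.angleDensity x s =
      ∫ s in Ioo 0 S.M, (1 - √(1 - c ^ 2 / S.r s ^ 2)) := by
    refine integral_congr_ae ?_
    filter_upwards [hae] with s hs
    rw [← (integral_div_mul_sqrt hc hs).2, intervalIntegral.integral_of_le hc]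
    rfl
  have h2 : Integrable (fun s => √(1 - c ^ 2 / S.r s ^ 2)) (volume.restrict (Ioo 0 S.M)) := by
    refine ((integrable_const (1 : ℝ)).sub hbd).congr (.of_forall fun s => ?_)
    simp
  rw [h1, integral_sub (integrable_const _) h2, action, integral_const]
  simp only [measureReal_restrict_apply_univ, Real.volume_real_Ioo_of_le S.M_pos.le, smul_eq_mul]
  ring

/-- The generating function, as a function of the Clairaut constant. -/
noncomputable def potential (c : ℝ) : ℝ := 2 * S.M - ∫ x in (0 : ℝ)..c, S.excess x

theorem potential_zero : S.potential 0 = 2 * S.M := by simp [potential]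

theorem potential_neg (c : ℝ) : S.potential (-c) = S.potential c := by
  have h := intervalIntegral.integral_comp_neg (a := 0) (b := c) S.excess
  simp only [excess_neg, intervalIntegral.integral_neg, neg_zero] at h
  rw [intervalIntegral.integral_symm 0 (-c)] at h
  rw [potential, potential]
  linarith

variable {S}

theorem IsMinimalEquator.hasDerivAt_potential {s₀ : ℝ} (h : S.IsMinimalEquator s₀) {c : ℝ}
    (hc : c ∈ Ioo (-S.r s₀) (S.r s₀)) : HasDerivAt S.potential (-S.excess c) c := by
  have h0 : (0 : ℝ) ∈ Ioo (-S.r s₀) (S.r s₀) := ⟨by linarith [h.r_pos], h.r_pos⟩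
  have hcont := h.contDiffOn_excess.continuousOn
  have hsub : uIcc 0 c ⊆ Ioo (-S.r s₀) (S.r s₀) := ordConnected_Ioo.uIcc_subset h0 hc
  exact (intervalIntegral.integral_hasDerivAt_right (hcont.mono hsub).intervalIntegrable
    (hcont.stronglyMeasurableAtFilter isOpen_Ioo c hc)
    (hcont.continuousAt (isOpen_Ioo.mem_nhds hc))).const_sub _

theorem IsMinimalEquator.contDiffOn_potential {s₀ : ℝ} (h : S.IsMinimalEquator s₀) :
    ContDiffOn ℝ ∞ S.potential (Ioo (-S.r s₀) (S.r s₀)) := by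
  rw [contDiffOn_infty_iff_deriv_of_isOpen isOpen_Ioo]
  exact ⟨fun c hc => (h.hasDerivAt_potential hc).differentiableAt.differentiableWithinAt,
    h.contDiffOn_excess.neg.congr fun c hc => (h.hasDerivAt_potential hc).deriv⟩

/-- Since the excess is the angle minus a constant for `c > 0`, the potential differs from the
action by a linear term. That term is what makes the even extension smooth at `c = 0`. -/
theorem IsMinimalEquator.potential_eq {s₀ : ℝ} (h : S.IsMinimalEquator s₀) {c : ℝ}
    (hc : c ∈ Ioo 0 (S.r s₀)) : S.potential c = S.action c + (S.m + S.n) * Real.pi * c := by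
  have h0 : (0 : ℝ) ∈ Ioo (-S.r s₀) (S.r s₀) := ⟨by linarith [h.r_pos], h.r_pos⟩
  have hc' : c ∈ Ioo (-S.r s₀) (S.r s₀) := ⟨by linarith [hc.1, h.r_pos], hc.2⟩
  have hcont := h.contDiffOn_excess.continuousOn
  have hsub : uIcc 0 c ⊆ Ioo (-S.r s₀) (S.r s₀) := ordConnected_Ioo.uIcc_subset h0 hc'
  have hint := (hcont.mono hsub).intervalIntegrable (μ := volume)
  have h1 : ∫ x in (0 : ℝ)..c, S.angle x =
      ∫ x in (0 : ℝ)..c, (S.excess x + (S.m + S.n) * Real.pi) := by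
    rw [intervalIntegral.integral_of_le hc.1.le, intervalIntegral.integral_of_le hc.1.le]
    refine setIntegral_congr_fun measurableSet_Ioc fun x hx => ?_
    show S.angle x = S.excess x + (S.m + S.n) * Real.pi
    rw [S.excess_of_pos hx.1]; ring
  rw [integral_angle S hc.1.le, intervalIntegral.integral_add hint intervalIntegrable_const,
    intervalIntegral.integral_const, sub_zero, smul_eq_mul] at h1
  rw [potential]
  linarith

/-- The return time, expressed through the generating function. -/
theorem IsMinimalEquator.potential_add {s₀ : ℝ} (h : S.IsMinimalEquator s₀) {c : ℝ}
    (hc : c ∈ Ioo 0 (S.r s₀)) :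
    S.potential c + c * S.excess c = S.action c + c * S.angle c := by
  rw [h.potential_eq hc, S.excess_of_pos hc.1]; ring

end SpindleOrbifold

/-! ### Oscillating radial motion -/

/-- An autonomous equation `U' = g(U)` with `g` positive and periodic. -/
theorem exists_solution_of_periodic {g : ℝ → ℝ} (hg : Continuous g) (hpos : ∀ u, 0 < g u)
    (hper : Function.Periodic g (2 * Real.pi)) :
    ∃ (U : ℝ → ℝ) (T : ℝ), 0 < T ∧ U 0 = 0 ∧ StrictMono U ∧ Function.Surjective U ∧
      (∀ t, U (t + T) = U t + 2 * Real.pi) ∧ (∀ t, HasDerivAt U (g (U t)) t) ∧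
      T = ∫ u in (0 : ℝ)..2 * Real.pi, (g u)⁻¹ := by
  have hc : Continuous fun u => (g u)⁻¹ := hg.inv₀ fun u => (hpos u).ne'
  have hip : ∀ u, 0 < (g u)⁻¹ := fun u => inv_pos.2 (hpos u)
  have hpi : Function.Periodic (fun u => (g u)⁻¹) (2 * Real.pi) := fun u => by
    show (g (u + 2 * Real.pi))⁻¹ = (g u)⁻¹
    rw [hper u]
  have hii : ∀ a b, IntervalIntegrable (fun u => (g u)⁻¹) volume a b := fun a b =>
    hc.intervalIntegrable a b
  -- Separation of variables: `τ u` is the time at which the phase `u` is reached, and the solution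
  -- is its inverse.
  set τ : ℝ → ℝ := fun u => ∫ x in (0 : ℝ)..u, (g x)⁻¹ with hτ
  have hd : ∀ u, HasDerivAt τ (g u)⁻¹ u := fun u => hc.integral_hasStrictDerivAt 0 u |>.hasDerivAt
  have hcτ : Continuous τ := continuous_iff_continuousAt.2 fun u => (hd u).continuousAt
  have hmono : StrictMono τ := strictMono_of_deriv_pos fun u => by rw [(hd u).deriv]; exact hip u
  have hsurj : Function.Surjective τ :=
    hcτ.surjective (hpi.tendsto_atTop_intervalIntegral_of_pos' (hii _ _) hip Real.two_pi_pos)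
      (hpi.tendsto_atBot_intervalIntegral_of_pos' (hii _ _) hip Real.two_pi_pos)
  set e := hmono.orderIsoOfSurjective τ hsurj with he
  have heτ : ∀ u, e u = τ u := fun u => rfl
  have hτe : ∀ t, τ (e.symm t) = t := fun t => e.apply_symm_apply t
  have heτ' : ∀ u, e.symm (τ u) = u := fun u => e.symm_apply_apply u
  have hadd : ∀ u, τ (u + 2 * Real.pi) = τ u + τ (2 * Real.pi) := by
    intro u
    have h1 := intervalIntegral.integral_add_adjacent_intervals (hii 0 u) (hii u (u + 2 * Real.pi))
    have h2 := hpi.intervalIntegral_add_eq u 0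
    rw [zero_add] at h2
    simp only [hτ]
    rw [← h1, h2]
  have h0 : τ 0 = 0 := intervalIntegral.integral_same
  refine ⟨e.symm, τ (2 * Real.pi), ?_, ?_, e.symm.strictMono, e.symm.surjective, ?_, ?_, rfl⟩
  · rw [← h0]; exact hmono Real.two_pi_pos
  · have := heτ' 0
    rwa [h0] at this
  · intro t
    rw [← heτ' (e.symm t + 2 * Real.pi), hadd, hτe]
  · intro t
    have := HasDerivAt.of_local_left_inverse (f := τ) (g := e.symm) (a := t)
      e.symm.continuous.continuousAt (hd (e.symm t)) (hip _).ne' (.of_forall hτe)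
    rwa [inv_inv] at this

namespace SpindleOrbifold
variable {S : SpindleOrbifold}

theorem IsMinimalEquator.exists_turning_left {s₀ : ℝ} (h : S.IsMinimalEquator s₀) {c : ℝ}
    (hc : c ∈ Ioo 0 (S.r s₀)) : ∃ p ∈ Ioo 0 s₀, S.r p = c ∧ 0 < deriv S.r p ∧
      (∀ s ∈ Ioo 0 p, S.r s < c) ∧ ∀ s ∈ Ioc p s₀, c < S.r s := by
  obtain ⟨s₁, hs₁, hs₁₀, hrs₁, hd, -, hge⟩ := h.exists_left
  have hmono : StrictMonoOn S.r (Icc 0 s₁) :=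
    strictMonoOn_of_deriv_pos (convex_Icc _ _) S.continuous_r.continuousOn
      (by rw [interior_Icc]; exact fun s hs => hd s ⟨hs.1.le, hs.2⟩)
  have := intermediate_value_Ioo hs₁.le S.continuous_r.continuousOn
  rw [S.r_zero, hrs₁] at this
  obtain ⟨p, hp, hpc⟩ := this hc
  refine ⟨p, ⟨hp.1, hp.2.trans_le hs₁₀⟩, hpc, hd p ⟨hp.1.le, hp.2⟩, ?_, ?_⟩
  · intro s hs
    rw [← hpc]
    exact hmono ⟨hs.1.le, (hs.2.trans hp.2).le⟩ (Ioo_subset_Icc_self hp) hs.2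
  · intro s hs
    rcases le_or_gt s s₁ with h1 | h1
    · rw [← hpc]
      exact hmono (Ioo_subset_Icc_self hp) ⟨(hp.1.trans hs.1).le, h1⟩ hs.1
    · exact hc.2.trans_le (hge s ⟨h1.le, hs.2⟩)

theorem IsMinimalEquator.exists_turning_right {s₀ : ℝ} (h : S.IsMinimalEquator s₀) {c : ℝ}
    (hc : c ∈ Ioo 0 (S.r s₀)) : ∃ q ∈ Ioo s₀ S.M, S.r q = c ∧ deriv S.r q < 0 ∧
      (∀ s ∈ Ioo q S.M, S.r s < c) ∧ ∀ s ∈ Ico s₀ q, c < S.r s := by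
  obtain ⟨p, hp, hpc, hd, h1, h2⟩ := h.reflect.exists_turning_left
    (by rwa [reflect_r, sub_sub_cancel] : c ∈ Ioo 0 (S.reflect.r (S.M - s₀)))
  simp only [reflect_r] at hpc h1 h2
  rw [deriv_reflect_r] at hd
  refine ⟨S.M - p, ⟨by linarith [hp.2], by linarith [hp.1]⟩, hpc, by linarith, ?_, ?_⟩
  · intro s hs
    have := h1 (S.M - s) ⟨by linarith [hs.2], by linarith [hs.1]⟩
    rwa [sub_sub_cancel] at this
  · intro s hs
    have := h2 (S.M - s) ⟨by linarith [hs.2], by linarith [hs.1]⟩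
    rwa [sub_sub_cancel] at this

/-- A function positive on `(p,q)` with simple zeros at `p` and `q`. -/
theorem exists_eq_mul_mul {E : ℝ → ℝ} {α β p q : ℝ} (hp : p ∈ Ioo α β) (hq : q ∈ Ioo α β)
    (hpq : p < q) (hE : ContDiffOn ℝ ∞ E (Ioo α β)) (hEp : E p = 0) (hEq : E q = 0)
    (hdp : 0 < deriv E p) (hdq : deriv E q < 0) (hpos : ∀ s ∈ Ioo p q, 0 < E s) :
    ∃ Q : ℝ → ℝ, ContDiffOn ℝ ∞ Q (Ioo α β) ∧ (∀ s ∈ Ioo α β, E s = (s - p) * (q - s) * Q s) ∧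
      ∀ s ∈ Icc p q, 0 < Q s := by
  obtain ⟨E₁, hE₁, hE₁p, hEE₁⟩ := exists_contDiffOn_eq_sub_mul hp hE hEp
  have hE₁q : E₁ q = 0 := by
    have := hEE₁ q hq
    rw [hEq, eq_comm, mul_eq_zero] at this
    exact this.resolve_left (sub_pos.2 hpq).ne'
  obtain ⟨E₂, hE₂, hE₂q, hE₁E₂⟩ := exists_contDiffOn_eq_sub_mul hq hE₁ hE₁q
  refine ⟨fun s => -E₂ s, hE₂.neg, fun s hs => by rw [hEE₁ s hs, hE₁E₂ s hs]; ring, ?_⟩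
  intro s hs
  rcases eq_or_lt_of_le hs.1 with h1 | h1
  · rw [← h1]
    have := hE₁E₂ p hp
    rw [hE₁p] at this
    nlinarith
  rcases eq_or_lt_of_le hs.2 with h2 | h2
  · show 0 < -E₂ s
    rw [h2, hE₂q]
    have hd1 : HasDerivAt E₁ (deriv E₁ q) q :=
      ((hE₁.contDiffAt (isOpen_Ioo.mem_nhds hq)).differentiableAt (by simp)).hasDerivAt
    have hd2 := (((hasDerivAt_id q).sub_const p).mul hd1).congr_of_eventuallyEq (f₁ := E) (by
      filter_upwards [isOpen_Ioo.mem_nhds hq] with s hs using hEE₁ s hs)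
    have := hd2.deriv
    rw [this] at hdq
    simp only [id, hE₁q] at hdq
    nlinarith
  · have h3 := hpos s ⟨h1, h2⟩
    rw [hEE₁ s ⟨hp.1.trans h1, h2.trans hq.2⟩, hE₁E₂ s ⟨hp.1.trans h1, h2.trans hq.2⟩] at h3
    have h4 : 0 < (s - p) * (q - s) := mul_pos (sub_pos.2 h1) (sub_pos.2 h2)
    show 0 < -E₂ s
    by_contra! hcon
    nlinarith [mul_nonneg h4.le (by linarith : 0 ≤ E₂ s)]

end SpindleOrbifold

/-- The parametrization of `[p,q]` by an angle. -/
noncomputable def swing (p q u : ℝ) : ℝ := (p + q) / 2 - (q - p) / 2 * Real.cos u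

theorem hasDerivAt_swing (p q u : ℝ) :
    HasDerivAt (swing p q) ((q - p) / 2 * Real.sin u) u := by
  refine (((Real.hasDerivAt_cos u).const_mul ((q - p) / 2)).const_sub _).congr_deriv ?_
  ring

theorem continuous_swing (p q : ℝ) : Continuous (swing p q) := by unfold swing; fun_prop

theorem swing_mem {p q : ℝ} (hpq : p < q) (u : ℝ) : swing p q u ∈ Icc p q := by
  have h1 := Real.neg_one_le_cos u
  have h2 := Real.cos_le_one u
  constructor <;> unfold swing <;> nlinarith

theorem swing_periodic (p q : ℝ) : Function.Periodic (swing p q) (2 * Real.pi) := fun u => by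
  simp [swing]

theorem swing_two_pi_sub (p q u : ℝ) : swing p q (2 * Real.pi - u) = swing p q u := by
  simp [swing, Real.cos_two_pi_sub]

theorem swing_sub_mul (p q u : ℝ) :
    (swing p q u - p) * (q - swing p q u) = ((q - p) / 2 * Real.sin u) ^ 2 := by
  unfold swing
  rw [mul_pow, Real.sin_sq]; ring

theorem swing_image {p q : ℝ} (hpq : p < q) : swing p q '' Ioo 0 Real.pi = Ioo p q := by
  ext s
  constructor
  · rintro ⟨u, hu, rfl⟩
    have h1 : Real.cos u < 1 := by
      rw [← Real.cos_zero]
      exact Real.strictAntiOn_cos ⟨le_rfl, Real.pi_pos.le⟩ (Ioo_subset_Icc_self hu) hu.1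
    have h2 : -1 < Real.cos u := by
      rw [← Real.cos_pi]
      exact Real.strictAntiOn_cos (Ioo_subset_Icc_self hu) ⟨Real.pi_pos.le, le_rfl⟩ hu.2
    constructor <;> unfold swing <;> nlinarith
  · intro hs
    have h0 : 0 < q - p := sub_pos.2 hpq
    have h1 : -1 < (p + q - 2 * s) / (q - p) := by rw [lt_div_iff₀ h0]; linarith [hs.2]
    have h2 : (p + q - 2 * s) / (q - p) < 1 := by rw [div_lt_one h0]; linarith [hs.1]
    refine ⟨Real.arccos ((p + q - 2 * s) / (q - p)),
      ⟨Real.arccos_pos.2 h2, Real.arccos_lt_pi.2 h1⟩, ?_⟩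
    unfold swing
    rw [Real.cos_arccos h1.le h2.le]
    field_simp
    ring

theorem swing_injOn {p q : ℝ} (hpq : p < q) : InjOn (swing p q) (Ioo 0 Real.pi) := by
  intro u hu v hv huv
  have h0 : (q - p) / 2 ≠ 0 := by linarith [sub_pos.2 hpq] |> fun h : 0 < (q - p) / 2 => h.ne'
  refine Real.injOn_cos (Ioo_subset_Icc_self hu) (Ioo_subset_Icc_self hv) ?_
  unfold swing at huv
  exact mul_left_cancel₀ h0 (by linarith)

namespace SpindleOrbifold
variable (S : SpindleOrbifold)

/-- The radial motion of a geodesic with Clairaut constant `c` oscillating between the parallels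
`s = p` and `s = q`, with phase `U` and period `T`. -/
structure Orbit (s₀ c : ℝ) where
  p : ℝ
  q : ℝ
  T : ℝ
  g : ℝ → ℝ
  U : ℝ → ℝ
  p_mem : p ∈ Ioo 0 s₀
  q_mem : q ∈ Ioo s₀ S.M
  T_pos : 0 < T
  g_pos : ∀ u, 0 < g u
  U_zero : U 0 = 0
  U_strictMono : StrictMono U
  U_surjective : Function.Surjective U
  U_add : ∀ t, U (t + T) = U t + 2 * Real.pi
  hasDerivAt_U : ∀ t, HasDerivAt U (g (U t)) t
  hasDerivAt_velocity : ∀ t, HasDerivAt (fun t => (q - p) / 2 * Real.sin (U t) * g (U t))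
    (c ^ 2 * deriv S.r (swing p q (U t)) / S.r (swing p q (U t)) ^ 3) t
  energy : ∀ u, ((q - p) / 2 * Real.sin u * g u) ^ 2 = 1 - c ^ 2 / S.r (swing p q u) ^ 2
  T_eq : T = S.action c + c * S.angle c
  angle_eq : ∫ t in (0 : ℝ)..T, c / S.r (swing p q (U t)) ^ 2 = S.angle c
  mem_of_le : ∀ s ∈ Ioo 0 S.M, c ^ 2 ≤ S.r s ^ 2 → s ∈ Icc p q

theorem action_neg (c : ℝ) : S.action (-c) = S.action c := by simp only [action, neg_sq]

variable {S}

/-- The orbit with reversed Clairaut constant. -/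
def Orbit.neg {s₀ c : ℝ} (O : S.Orbit s₀ c) : S.Orbit s₀ (-c) where
  __ := O
  hasDerivAt_velocity := by simpa only [neg_sq] using O.hasDerivAt_velocity
  energy := by simpa only [neg_sq] using O.energy
  T_eq := by rw [S.action_neg, S.angle_neg, neg_mul_neg]; exact O.T_eq
  angle_eq := by
    simp only [neg_div, intervalIntegral.integral_neg, S.angle_neg]
    rw [O.angle_eq]
  mem_of_le := by simpa only [neg_sq] using O.mem_of_le

/-- The way down retraces the way up, by the reflection `u ↦ 2π - u` of the phase. -/
theorem integral_swing_period {f : ℝ → ℝ} (hf : Continuous f)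
    (hsymm : ∀ u, f (2 * Real.pi - u) = f u) :
    ∫ u in (0 : ℝ)..2 * Real.pi, f u = 2 * ∫ u in Ioo 0 Real.pi, f u := by
  have h1 := intervalIntegral.integral_comp_sub_left (a := 0) (b := Real.pi) f (2 * Real.pi)
  simp only [hsymm, sub_zero] at h1
  rw [show 2 * Real.pi - Real.pi = Real.pi by ring] at h1
  rw [← intervalIntegral.integral_add_adjacent_intervals (hf.intervalIntegrable 0 Real.pi)
    (hf.intervalIntegrable _ _), ← h1, intervalIntegral.integral_of_le Real.pi_pos.le,
    integral_Ioc_eq_integral_Ioo, two_mul]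

theorem setIntegral_swing {p q : ℝ} (hpq : p < q) {f h : ℝ → ℝ}
    (hfh : ∀ u ∈ Ioo 0 Real.pi, h u = (q - p) / 2 * Real.sin u * f (swing p q u)) :
    ∫ s in Ioo p q, f s = ∫ u in Ioo 0 Real.pi, h u := by
  rw [← swing_image hpq, integral_image_eq_integral_abs_deriv_smul measurableSet_Ioo
    (fun u _ => (hasDerivAt_swing p q u).hasDerivWithinAt) (swing_injOn hpq)]
  refine setIntegral_congr_fun measurableSet_Ioo fun u hu => ?_
  have : 0 ≤ (q - p) / 2 * Real.sin u :=
    mul_nonneg (by linarith) (Real.sin_pos_of_pos_of_lt_pi hu.1 hu.2).le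
  simp only [smul_eq_mul, abs_of_nonneg this, hfh u hu]

theorem hasDerivAt_potentialEnergy {c s : ℝ} (hs : 0 < S.r s) :
    HasDerivAt (fun s => 1 - c ^ 2 / S.r s ^ 2) (2 * (c ^ 2 * deriv S.r s / S.r s ^ 3)) s := by
  refine (((hasDerivAt_const s (c ^ 2)).div ((S.hasDerivAt_r s).pow 2)
    (pow_pos hs 2).ne').const_sub 1).congr_deriv ?_
  have := hs.ne'
  field_simp
  norm_num
  ring

/-- The squared radial speed `E = 1 - c²/r²` has simple zeros at the turning points, so `E = (s -
p)(q - s) Q` with `Q > 0`. For `s = swing p q u` the product `(s - p)(q - s)` is a perfect square,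
and `s'² = E` is solved by `u' = √Q`, whose right side is positive and periodic. The phase thus
passes the turning points without the degeneracy of `s' = ±√E`. -/
theorem IsMinimalEquator.exists_orbit_of_pos {s₀ : ℝ} (h : S.IsMinimalEquator s₀) {c : ℝ}
    (hc : c ∈ Ioo 0 (S.r s₀)) : Nonempty (S.Orbit s₀ c) := by
  obtain ⟨p, hp, hrp, hdp, hltp, hgtp⟩ := h.exists_turning_left hc
  obtain ⟨q, hq, hrq, hdq, hltq, hgtq⟩ := h.exists_turning_right hc
  have hpq : p < q := hp.2.trans hq.1
  have hpM : p ∈ Ioo 0 S.M := ⟨hp.1, hp.2.trans h.1.2⟩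
  have hqM : q ∈ Ioo 0 S.M := ⟨h.1.1.trans hq.1, hq.2⟩
  have hc0 := hc.1
  have hgt : ∀ s ∈ Ioo p q, c < S.r s := fun s hs =>
    (le_total s s₀).elim (fun h1 => hgtp s ⟨hs.1, h1⟩) fun h1 => hgtq s ⟨h1, hs.2⟩
  have hle : ∀ s ∈ Ioo 0 S.M \ Ioo p q, S.r s ≤ c := by
    rintro s ⟨hs, hs'⟩
    rcases lt_trichotomy s p with h1 | h1 | h1
    · exact (hltp s ⟨hs.1, h1⟩).le
    · rw [h1, hrp]
    · rcases lt_trichotomy s q with h2 | h2 | h2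
      · exact absurd ⟨h1, h2⟩ hs'
      · rw [h2, hrq]
      · exact (hltq s ⟨h2, hs.2⟩).le
  have hsub : Ioo p q ⊆ Ioo 0 S.M := Ioo_subset_Ioo hpM.1.le hqM.2.le
  set E : ℝ → ℝ := fun s => 1 - c ^ 2 / S.r s ^ 2 with hE
  have hEd : ∀ s ∈ Ioo 0 S.M, HasDerivAt E (2 * (c ^ 2 * deriv S.r s / S.r s ^ 3)) s :=
    fun s hs => hasDerivAt_potentialEnergy (S.pos s hs)
  have hEs : ContDiffOn ℝ ∞ E (Ioo 0 S.M) :=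
    contDiffOn_const.sub (contDiffOn_const.div (S.smooth.pow 2).contDiffOn
      fun s hs => (pow_pos (S.pos s hs) 2).ne')
  obtain ⟨Q, hQ, hEQ, hQpos⟩ := exists_eq_mul_mul hpM hqM hpq hEs
    (by simp only [hE, hrp]; rw [div_self (pow_pos hc0 2).ne', sub_self])
    (by simp only [hE, hrq]; rw [div_self (pow_pos hc0 2).ne', sub_self])
    (by rw [(hEd p hpM).deriv, hrp]; positivity)
    (by
      rw [(hEd q hqM).deriv, hrq]
      have : c ^ 2 * deriv S.r q / c ^ 3 = deriv S.r q / c := by field_simp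
      rw [this]
      have := div_neg_of_neg_of_pos hdq hc0
      linarith)
    (fun s hs => by
      have h1 := hgt s hs
      have h2 : c ^ 2 < S.r s ^ 2 := pow_lt_pow_left₀ h1 hc0.le two_ne_zero
      rw [hE]
      simp only
      rw [sub_pos, div_lt_one (by nlinarith)]
      exact h2)
  have hAmem : ∀ u, swing p q u ∈ Ioo 0 S.M := fun u =>
    ⟨hpM.1.trans_le (swing_mem hpq u).1, (swing_mem hpq u).2.trans_lt hqM.2⟩
  have hr0 : ∀ u, 0 < S.r (swing p q u) := fun u => S.pos _ (hAmem u)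
  have hAc := continuous_swing p q
  have hQA : ∀ u, 0 < Q (swing p q u) := fun u => hQpos _ (swing_mem hpq u)
  set g : ℝ → ℝ := fun u => √(Q (swing p q u)) with hg
  have hgpos : ∀ u, 0 < g u := fun u => Real.sqrt_pos.2 (hQA u)
  have hg2 : ∀ u, g u ^ 2 = Q (swing p q u) := fun u => Real.sq_sqrt (hQA u).le
  have hgc : Continuous g := Real.continuous_sqrt.comp
    (hQ.continuousOn.comp_continuous hAc hAmem)
  have hgper : Function.Periodic g (2 * Real.pi) := fun u => by
    simp only [hg, swing_periodic p q u]
  obtain ⟨U, T, hT, hU0, hUm, hUs, hUadd, hUd, hTeq⟩ := exists_solution_of_periodic hgc hgpos hgper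
  have henergy : ∀ u, ((q - p) / 2 * Real.sin u * g u) ^ 2 = E (swing p q u) := by
    intro u
    rw [mul_pow, hg2, hEQ _ (hAmem u), swing_sub_mul]
  have hgd : ∀ u, HasDerivAt g (deriv Q (swing p q u) * ((q - p) / 2 * Real.sin u) / (2 * g u)) u :=
    fun u => ((((hQ.contDiffAt (isOpen_Ioo.mem_nhds (hAmem u))).differentiableAt
      (by simp)).hasDerivAt.comp u (hasDerivAt_swing p q u)).sqrt (hQA u).ne')
  -- Half the derivative of `E`, once from its definition and once from the factorization.
  have hder : ∀ u, c ^ 2 * deriv S.r (swing p q u) / S.r (swing p q u) ^ 3 =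
      (q - p) / 2 * Real.cos u * Q (swing p q u) +
        ((q - p) / 2 * Real.sin u) ^ 2 * deriv Q (swing p q u) / 2 := by
    intro u
    have h1 := hEd _ (hAmem u)
    have h2 : HasDerivAt Q (deriv Q (swing p q u)) (swing p q u) :=
      ((hQ.contDiffAt (isOpen_Ioo.mem_nhds (hAmem u))).differentiableAt (by simp)).hasDerivAt
    have h3 := ((((hasDerivAt_id (swing p q u)).sub_const p).mul
      ((hasDerivAt_id (swing p q u)).const_sub q)).mul h2).congr_of_eventuallyEq (f₁ := E) (by
        filter_upwards [isOpen_Ioo.mem_nhds (hAmem u)] with s hs using hEQ s hs)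
    have h4 := h1.unique h3
    simp only [Pi.mul_apply, id] at h4
    have h5 := swing_sub_mul p q u
    have h6 : q - swing p q u - (swing p q u - p) = 2 * ((q - p) / 2 * Real.cos u) := by
      unfold swing; ring
    linear_combination h4 / 2 + Q (swing p q u) / 2 * h6 + deriv Q (swing p q u) / 2 * h5
  have hangle : ∫ u in (0 : ℝ)..2 * Real.pi, c / (S.r (swing p q u) ^ 2 * g u) = S.angle c := by
    have hrc := S.continuous_r
    rw [integral_swing_period, angle,
      setIntegral_eq_of_subset_of_forall_sdiff_eq_zero measurableSet_Ioo hsub fun s hs =>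
        angleDensity_eq_zero (S.pos s hs.1).le (hle s hs), setIntegral_swing hpq]
    · intro u hu
      have hsin := Real.sin_pos_of_pos_of_lt_pi hu.1 hu.2
      have h1 : √(S.r (swing p q u) ^ 2 - c ^ 2) =
          S.r (swing p q u) * ((q - p) / 2 * Real.sin u * g u) := by
        rw [Real.sqrt_eq_iff_mul_self_eq_of_pos]
        · have := henergy u
          rw [hE] at this
          have h2 := (hr0 u).ne'
          simp only at this
          rw [mul_mul_mul_comm, ← pow_two, ← pow_two, this]
          field_simp
        · have := hr0 u; have := hgpos u; have := sub_pos.2 hpq; positivity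
      rw [angleDensity, h1]
      have h2 := (hr0 u).ne'
      have h3 := (hgpos u).ne'
      have h4 := (sub_pos.2 hpq).ne'
      field_simp
    · exact continuous_const.div (by fun_prop) fun u =>
        (mul_pos (pow_pos (hr0 u) 2) (hgpos u)).ne'
    · intro u
      simp only [hg, swing_two_pi_sub]
  have haction : ∫ u in (0 : ℝ)..2 * Real.pi, ((q - p) / 2 * Real.sin u) ^ 2 * g u =
      S.action c := by
    rw [integral_swing_period, action,
      setIntegral_eq_of_subset_of_forall_sdiff_eq_zero measurableSet_Ioo hsub fun s hs => ?_,
      setIntegral_swing hpq]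
    · intro u hu
      have hsin := Real.sin_pos_of_pos_of_lt_pi hu.1 hu.2
      have h1 := henergy u
      simp only [hE] at h1
      have h2 : 0 ≤ (q - p) / 2 * Real.sin u * g u := by
        have := hgpos u; have := sub_pos.2 hpq; positivity
      rw [← h1, Real.sqrt_sq h2]
      ring
    · have h1 := hle s hs
      have h2 := S.pos s hs.1
      refine Real.sqrt_eq_zero_of_nonpos ?_
      rw [sub_nonpos, one_le_div (by positivity)]
      exact pow_le_pow_left₀ h2.le h1 2
    · fun_prop
    · intro u
      simp only [hg, swing_two_pi_sub, Real.sin_two_pi_sub]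
      ring
  refine ⟨⟨p, q, T, g, U, hp, hq, hT, hgpos, hU0, hUm, hUs, hUadd, hUd, ?_, henergy, ?_, ?_, ?_⟩⟩
  · intro t
    refine (((((hUd t).sin).const_mul ((q - p) / 2)).mul
      ((hgd (U t)).comp t (hUd t)))).congr_deriv ?_
    rw [hder]
    have h1 := hg2 (U t)
    have h2 := (hgpos (U t)).ne'
    simp only [Function.comp]
    rw [← h1]
    field_simp
  -- The period is `∫ du / g`, and the energy identity splits `1/g` into the action density `((q -
  -- p)/2 · sin u)² g` and `c` times the angle density `c / (r² g)`.
  · rw [hTeq, ← haction, ← hangle, ← intervalIntegral.integral_const_mul,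
      ← intervalIntegral.integral_add]
    · refine intervalIntegral.integral_congr fun u _ => ?_
      have h1 := henergy u
      have h2 := (hgpos u).ne'
      have h3 := (hr0 u).ne'
      simp only [hE] at h1
      field_simp at h1 ⊢
      linear_combination -h1
    · exact Continuous.intervalIntegrable (by fun_prop) _ _
    · have hrc := S.continuous_r
      refine Continuous.intervalIntegrable (continuous_const.mul (continuous_const.div
        (by fun_prop) fun u => (mul_pos (pow_pos (hr0 u) 2) (hgpos u)).ne')) _ _
  · have hrc := S.continuous_r
    have hUc : Continuous U := continuous_iff_continuousAt.2 fun t => (hUd t).continuousAt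
    have hU2 : U T = 2 * Real.pi := by have := hUadd 0; rwa [zero_add, hU0, zero_add] at this
    have h1 := intervalIntegral.integral_comp_mul_deriv (a := 0) (b := T)
      (g := fun u => c / (S.r (swing p q u) ^ 2 * g u))
      (fun t _ => hUd t) (by fun_prop) (continuous_const.div
        (by fun_prop) fun u => (mul_pos (pow_pos (hr0 u) 2) (hgpos u)).ne')
    rw [hU0, hU2, hangle] at h1
    rw [← h1]
    refine intervalIntegral.integral_congr fun t _ => ?_
    have h2 := (hgpos (U t)).ne'
    have h3 := (hr0 (U t)).ne'
    simp only [Function.comp]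
    field_simp
  · intro s hs hcs
    by_contra hcon
    have h1 : s ∈ Ioo 0 S.M \ Ioo p q := ⟨hs, fun h' => hcon (Ioo_subset_Icc_self h')⟩
    have h2 := S.pos s hs
    -- Outside `(p, q)` the profile is at most `c`, with equality only at `p` and `q`.
    have h3 : S.r s = c := le_antisymm (hle s h1) ((pow_le_pow_iff_left₀ hc0.le h2.le two_ne_zero).1 hcs)
    rcases lt_or_ge s p with h4 | h4
    · exact (hltp s ⟨hs.1, h4⟩).ne h3
    · rcases lt_or_ge q s with h5 | h5
      · exact (hltq s ⟨h5, hs.2⟩).ne h3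
      · exact hcon ⟨h4, h5⟩

theorem IsMinimalEquator.exists_orbit {s₀ : ℝ} (h : S.IsMinimalEquator s₀) {c : ℝ}
    (hc : c ∈ Ioo (-S.r s₀) (S.r s₀)) (hc0 : c ≠ 0) : Nonempty (S.Orbit s₀ c) := by
  rcases lt_or_gt_of_ne hc0 with h0 | h0
  · obtain ⟨O⟩ := h.exists_orbit_of_pos (c := -c) ⟨by linarith, by linarith [hc.1]⟩
    have := O.neg
    rw [neg_neg] at this
    exact ⟨this⟩
  · exact h.exists_orbit_of_pos ⟨h0, hc.2⟩

end SpindleOrbifold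

/-! ### The cone metric in Cartesian coordinates and its derivative at the cone point -/

/-- The coefficient of the angular part of the cone metric. -/
noncomputable def coneFactor (k : ℕ) (ρ : ℝ → ℝ) (x : ℝ) : ℝ := ((k * ρ x / x) ^ 2 - 1) / x ^ 2

/-- The cross product of plane vectors. -/
def cross (p u : ℂ) : ℝ := p.re * u.im - p.im * u.re

/-- The Euclidean inner product of plane vectors. -/
def dot (p u : ℂ) : ℝ := p.re * u.re + p.im * u.im

theorem coneMetric_eq (k : ℕ) (ρ : ℝ → ℝ) (p u v : ℂ) :
    coneMetric k ρ p u v = dot u v + coneFactor k ρ ‖p‖ * (cross p u * cross p v) := rfl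

theorem dot_self_eq (w : ℂ) : dot w w = ‖w‖ ^ 2 := by
  rw [← Complex.normSq_eq_norm_sq, Complex.normSq_apply]; rfl

theorem dot_sq_add_cross_sq (w v : ℂ) : dot w v ^ 2 + cross w v ^ 2 = ‖w‖ ^ 2 * dot v v := by
  rw [← dot_self_eq]; simp only [dot, cross]; ring

theorem coneMetric_expand (k : ℕ) (ρ : ℝ → ℝ) (p v u : ℂ) :
    coneMetric k ρ p v u = u.re * coneMetric k ρ p v 1 + u.im * coneMetric k ρ p v Complex.I := by
  simp only [coneMetric_eq, dot, cross, Complex.one_re, Complex.one_im, Complex.I_re, Complex.I_im]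
  ring

theorem hasDerivAt_re {w : ℝ → ℂ} {w' : ℂ} {t : ℝ} (h : HasDerivAt w w' t) :
    HasDerivAt (fun t => (w t).re) w'.re t :=
  (Complex.reCLM.hasFDerivAt.comp_hasDerivAt t h :)

theorem hasDerivAt_im {w : ℝ → ℂ} {w' : ℂ} {t : ℝ} (h : HasDerivAt w w' t) :
    HasDerivAt (fun t => (w t).im) w'.im t :=
  (Complex.imCLM.hasFDerivAt.comp_hasDerivAt t h :)

theorem hasDerivAt_of_re_im {w : ℝ → ℂ} {w' : ℂ} {t : ℝ}
    (hr : HasDerivAt (fun t => (w t).re) w'.re t) (hi : HasDerivAt (fun t => (w t).im) w'.im t) :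
    HasDerivAt w w' t := by
  have h := hr.ofReal_comp.add (hi.ofReal_comp.mul_const Complex.I)
  rw [Complex.re_add_im] at h
  refine h.congr_of_eventuallyEq (.of_forall fun x => ?_)
  exact (Complex.re_add_im (w x)).symm

theorem hasDerivAt_norm {w : ℝ → ℂ} {w' : ℂ} {t : ℝ} (h : HasDerivAt w w' t) (h0 : w t ≠ 0) :
    HasDerivAt (fun t => ‖w t‖) (dot (w t) w' / ‖w t‖) t := by
  have h1 : ∀ x : ℝ, ‖w x‖ = √((w x).re ^ 2 + (w x).im ^ 2) := fun x =>
    Complex.norm_eq_sqrt_sq_add_sq _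
  have h2 : (w t).re ^ 2 + (w t).im ^ 2 ≠ 0 := by
    have h3 := dot_self_eq (w t)
    have h4 := norm_pos_iff.2 h0
    have h5 : 0 < ‖w t‖ ^ 2 := by positivity
    simp only [dot] at h3
    nlinarith
  have h3 := ((((hasDerivAt_re h).pow 2).add ((hasDerivAt_im h).pow 2)).sqrt h2)
  refine (h3.congr_of_eventuallyEq (.of_forall h1)).congr_deriv ?_
  simp only [Pi.add_apply, Pi.pow_apply, ← h1]
  have := (norm_pos_iff.2 h0).ne'
  simp only [dot]
  field_simp
  norm_num
  ring

theorem hasDerivAt_coneFactor {k : ℕ} {ρ : ℝ → ℝ} {x ρ' : ℝ} (hx : x ≠ 0)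
    (h : HasDerivAt ρ ρ' x) : HasDerivAt (coneFactor k ρ)
      (2 * k ^ 2 * ρ x * ρ' / x ^ 4 - 4 * k ^ 2 * ρ x ^ 2 / x ^ 5 + 2 / x ^ 3) x := by
  refine ((((h.const_mul (k : ℝ)).div (hasDerivAt_id x) hx).pow 2).sub_const 1).div
    (hasDerivAt_pow 2 x) (pow_ne_zero 2 hx) |>.congr_deriv ?_
  simp only [id, Pi.div_apply, Pi.pow_apply, Nat.cast_ofNat, Nat.add_one_sub_one, pow_one]
  field_simp
  ring

/-- The derivative of the metric coefficients away from the cone point. -/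
theorem fderiv_coneMetric {k : ℕ} {ρ : ℝ → ℝ} {w : ℂ} {f' : ℝ} (hw : w ≠ 0)
    (hf : HasDerivAt (coneFactor k ρ) f' ‖w‖) (v u : ℂ) :
    fderiv ℝ (fun p => coneMetric k ρ p v v) w u =
      f' * (dot w u / ‖w‖) * cross w v ^ 2 + 2 * coneFactor k ρ ‖w‖ * cross w v * cross u v := by
  have hdiff : DifferentiableAt ℝ (fun p => coneMetric k ρ p v v) w := by
    have h1 : DifferentiableAt ℝ (fun p : ℂ => coneFactor k ρ ‖p‖) w :=
      hf.differentiableAt.comp w ((contDiffAt_norm ℝ hw (n := 1)).differentiableAt (by simp))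
    have h2 : DifferentiableAt ℝ (fun p : ℂ => cross p v) w := by
      have hr : DifferentiableAt ℝ (fun p : ℂ => p.re) w := Complex.reCLM.differentiableAt
      have hi : DifferentiableAt ℝ (fun p : ℂ => p.im) w := Complex.imCLM.differentiableAt
      exact (hr.mul_const _).sub (hi.mul_const _)
    exact (h1.mul (h2.mul h2)).const_add _
  have hline : HasDerivAt (fun t : ℝ => w + t * u) u 0 := by
    simpa using ((Complex.ofRealCLM.hasDerivAt (x := (0 : ℝ))).mul_const u).const_add w
  have h0 : w + ((0 : ℝ) : ℂ) * u = w := by simp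
  have h1 : HasDerivAt (fun t : ℝ => coneMetric k ρ (w + t * u) v v)
      (fderiv ℝ (fun p => coneMetric k ρ p v v) w u) 0 := by
    have := hdiff.hasFDerivAt
    rw [← h0] at this
    have := this.comp_hasDerivAt (0 : ℝ) hline
    rwa [h0] at this
  have hn := hasDerivAt_norm hline (by rwa [h0])
  rw [h0] at hn
  have hf2 : HasDerivAt (fun t : ℝ => coneFactor k ρ ‖w + t * u‖) (f' * (dot w u / ‖w‖)) 0 := by
    have hf1 := hf
    rw [← h0] at hf1
    exact hf1.comp (0 : ℝ) hn
  have hcr : HasDerivAt (fun t : ℝ => cross (w + t * u) v) (cross u v) 0 := by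
    have := ((hasDerivAt_re hline).mul_const v.im).sub ((hasDerivAt_im hline).mul_const v.re)
    exact this
  have h2 := (hf2.mul (hcr.mul hcr)).const_add (dot v v)
  have h3 := h1.unique h2
  rw [h3]
  simp only [Pi.mul_apply, h0]
  ring

namespace SpindleOrbifold
variable (S : SpindleOrbifold)

theorem m_ne : (S.m : ℝ) ≠ 0 := Nat.cast_ne_zero.2 S.m_pos.ne'

/-- Near the cone point the cone metric is Euclidean to first order. -/
theorem hasDerivAt_coneCoefficient :
    Filter.Tendsto (fun x => ((S.m * S.r x / x) ^ 2 - 1) / x) (nhdsWithin 0 {0}ᶜ) (nhds 0) := by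
  have h0 : (0 : ℝ) ∈ Ioo (-1 : ℝ) 1 := by norm_num
  obtain ⟨g, hg, hg0, hrg⟩ := exists_contDiffOn_eq_sub_mul h0 S.smooth.contDiffOn S.r_zero
  rw [S.deriv_zero] at hg0
  simp only [sub_zero] at hrg
  have hev : ∀ x ∈ Ioo (-1 : ℝ) 1, g (-x) = g x := by
    intro x hx
    rcases eq_or_ne x 0 with rfl | hx0
    · rw [neg_zero]
    · have h1 := S.odd_zero x
      rw [hrg x hx, hrg (-x) ⟨by linarith [hx.2], by linarith [hx.1]⟩] at h1
      exact mul_left_cancel₀ hx0 (by linarith)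
  have hd0 : deriv g 0 = 0 := by
    have := deriv_neg_of_even hev h0
    rw [neg_zero] at this; linarith
  have hgd : HasDerivAt g 0 0 := by
    have := ((hg.contDiffAt (isOpen_Ioo.mem_nhds h0)).differentiableAt (by simp)).hasDerivAt
    rwa [hd0] at this
  -- Here `r = x g` with `g` even and `m g(0) = 1`, so the quotient in question is a difference
  -- quotient of `(m g)²` at `0`, where the derivative is zero.
  have hF : HasDerivAt (fun x => (S.m * g x) ^ 2) 0 0 := by
    exact ((hgd.const_mul (S.m : ℝ)).pow 2).congr_deriv (by simp)
  have hs := hF.tendsto_slope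
  refine hs.congr' ?_
  filter_upwards [self_mem_nhdsWithin, nhdsWithin_le_nhds (isOpen_Ioo.mem_nhds h0)] with x hx0 hx
  have hx0' : x ≠ 0 := hx0
  have hm := S.m_ne
  rw [slope_def_field, hg0, hrg x hx, sub_zero]
  congr 2
  · field_simp
  · field_simp

/-- The angular coefficient is `o(1/‖p‖)` and it multiplies the square of a cross product, which is
`O(‖p‖²)`. To first order the metric at the cone point is thus Euclidean, and the value of the
coefficient at `0` itself is irrelevant. -/
theorem fderiv_coneMetric_zero (v : ℂ) :
    fderiv ℝ (fun p => coneMetric S.m S.r p v v) 0 = 0 := by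
  refine HasFDerivAt.fderiv ?_
  rw [hasFDerivAt_iff_isLittleO_nhds_zero]
  have h1 := S.hasDerivAt_coneCoefficient
  rw [Asymptotics.isLittleO_iff]
  intro ε hε
  have h2 : ∀ᶠ x in nhdsWithin (0 : ℝ) {0}ᶜ, |((S.m * S.r x / x) ^ 2 - 1) / x| ≤
      ε / (‖v‖ ^ 2 + 1) := by
    have := h1.abs
    rw [abs_zero] at this
    exact this.eventually_le_const (by positivity)
  rw [eventually_nhdsWithin_iff] at h2
  have h3 : Filter.Tendsto (fun p : ℂ => ‖p‖) (nhds 0) (nhds 0) := by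
    simpa using (continuous_norm (E := ℂ)).tendsto 0
  filter_upwards [h3.eventually h2] with p hp
  simp only [zero_add, coneMetric_eq, zero_apply, sub_zero]
  have hc0 : cross 0 v = 0 := by simp [cross]
  rw [hc0, zero_mul, mul_zero, add_zero, add_sub_cancel_left]
  rcases eq_or_ne p 0 with rfl | hp0
  · rw [hc0]; simp
  · have hn := norm_pos_iff.2 hp0
    have h4 := hp hn.ne'
    have h5 : cross p v * cross p v ≤ ‖p‖ ^ 2 * ‖v‖ ^ 2 := by
      have := dot_sq_add_cross_sq p v
      rw [dot_self_eq] at this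
      nlinarith [sq_nonneg (dot p v)]
    have h7 : 0 ≤ cross p v * cross p v / ‖p‖ := div_nonneg (mul_self_nonneg _) hn.le
    have h6 : coneFactor S.m S.r ‖p‖ * (cross p v * cross p v) =
        (((S.m * S.r ‖p‖ / ‖p‖) ^ 2 - 1) / ‖p‖) * (cross p v * cross p v / ‖p‖) := by
      rw [coneFactor]
      field_simp
    rw [h6, Real.norm_eq_abs, abs_mul, abs_of_nonneg h7]
    calc _ ≤ ε / (‖v‖ ^ 2 + 1) * (‖p‖ ^ 2 * ‖v‖ ^ 2 / ‖p‖) := by gcongr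
      _ = ε * ‖p‖ * (‖v‖ ^ 2 / (‖v‖ ^ 2 + 1)) := by field_simp
      _ ≤ ε * ‖p‖ * 1 := by
        gcongr
        rw [div_le_one (by positivity)]
        linarith
      _ = ε * ‖p‖ := mul_one _

end SpindleOrbifold

/-- The Euler-Lagrange equation is given for constant test vectors; linearity and the product rule
extend it to a moving one. The vector `i w` then yields Clairaut's relation, and `w` the radial
equation. -/
theorem hasDerivAt_coneMetric_apply {k : ℕ} {ρ : ℝ → ℝ} {D : Set ℂ} {w : ℝ → ℂ} {I : Set ℝ}
    (h : IsUnitGeodesicOn (coneMetric k ρ) D w I) {t : ℝ} (ht : t ∈ I) {X : ℝ → ℂ} {X' : ℂ}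
    (hX : HasDerivAt X X' t) :
    HasDerivAt (fun x => coneMetric k ρ (w x) (deriv w x) (X x))
      (coneMetric k ρ (w t) (deriv w t) X' +
        1 / 2 * fderiv ℝ (fun p => coneMetric k ρ p (deriv w t) (deriv w t)) (w t) (X t)) t := by
  obtain ⟨-, -, -, h2⟩ := h t ht
  have h3 := ((hasDerivAt_re hX).mul (h2 1)).add ((hasDerivAt_im hX).mul (h2 Complex.I))
  refine (h3.congr_of_eventuallyEq (.of_forall fun x => ?_)).congr_deriv ?_
  · exact coneMetric_expand k ρ (w x) (deriv w x) (X x)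
  · rw [coneMetric_expand k ρ (w t) (deriv w t) X']
    have h4 : X t = (X t).re • (1 : ℂ) + (X t).im • Complex.I := by
      simp [Complex.re_add_im]
    have h5 : ∀ L : ℂ →L[ℝ] ℝ, L (X t) = (X t).re * L 1 + (X t).im * L Complex.I := by
      intro L
      conv_lhs => rw [h4]
      rw [map_add, map_smul, map_smul, smul_eq_mul, smul_eq_mul]
    rw [h5]
    ring

theorem cross_I_mul_left (w v : ℂ) : cross (Complex.I * w) v = -dot w v := by
  simp [cross, dot]; ring

theorem cross_I_mul_right (w v : ℂ) : cross w (Complex.I * v) = dot w v := by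
  simp [cross, dot]

theorem dot_I_mul_right (w v : ℂ) : dot w (Complex.I * v) = -cross w v := by
  simp [cross, dot]; ring

theorem cross_same (w : ℂ) : cross w w = 0 := by simp [cross, mul_comm]

theorem cross_zero_left (v : ℂ) : cross 0 v = 0 := by simp [cross]

theorem dot_comm (u v : ℂ) : dot u v = dot v u := by simp [dot, mul_comm]

/-! ### Clairaut's relation, polar form of chart geodesics, lines through the cone point -/

namespace SpindleOrbifold
variable {S : SpindleOrbifold}

theorem hasDerivAt_coneFactor_r {x : ℝ} (hx : x ≠ 0) :
    HasDerivAt (coneFactor S.m S.r) (2 * S.m ^ 2 * S.r x * deriv S.r x / x ^ 4 -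
      4 * S.m ^ 2 * S.r x ^ 2 / x ^ 5 + 2 / x ^ 3) x :=
  hasDerivAt_coneFactor hx (S.hasDerivAt_r x)

/-- Clairaut's relation in the chart. -/
theorem hasDerivAt_clairaut {D : Set ℂ} {w : ℝ → ℂ} {I : Set ℝ}
    (h : IsUnitGeodesicOn (coneMetric S.m S.r) D w I) {t : ℝ} (ht : t ∈ I) :
    HasDerivAt (fun x => coneMetric S.m S.r (w x) (deriv w x) (Complex.I * w x)) 0 t := by
  have h1 := hasDerivAt_coneMetric_apply h ht ((h t ht).2.1.hasDerivAt.const_mul Complex.I)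
  refine h1.congr_deriv ?_
  rcases eq_or_ne (w t) 0 with h0 | h0
  · rw [h0, mul_zero, map_zero, mul_zero, add_zero, coneMetric_eq, cross_zero_left, zero_mul,
      mul_zero, add_zero, dot_I_mul_right, cross_same, neg_zero]
  · rw [fderiv_coneMetric h0 (hasDerivAt_coneFactor_r (norm_ne_zero_iff.2 h0)), coneMetric_eq,
      dot_I_mul_right, dot_I_mul_right, cross_same, cross_same, cross_I_mul_left,
      cross_I_mul_right]
    ring

theorem one_add_coneFactor {w : ℂ} (h0 : w ≠ 0) :
    1 + coneFactor S.m S.r ‖w‖ * ‖w‖ ^ 2 = (S.m * S.r ‖w‖) ^ 2 / ‖w‖ ^ 2 := by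
  have := norm_ne_zero_iff.2 h0
  rw [coneFactor]
  field_simp
  ring

theorem clairaut_eq (w v : ℂ) : coneMetric S.m S.r w v (Complex.I * w) =
    cross w v * (1 + coneFactor S.m S.r ‖w‖ * ‖w‖ ^ 2) := by
  rw [coneMetric_eq, dot_I_mul_right, cross_I_mul_right, dot_self_eq]
  simp only [cross]; ring

/-- The Clairaut constant of a chart geodesic is constant on intervals. -/
theorem exists_clairaut {D : Set ℂ} {w : ℝ → ℂ} {a b : ℝ}
    (h : IsUnitGeodesicOn (coneMetric S.m S.r) D w (Ioo a b)) :
    ∃ C, ∀ t ∈ Ioo a b,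
      cross (w t) (deriv w t) * (1 + coneFactor S.m S.r ‖w t‖ * ‖w t‖ ^ 2) = C := by
  obtain ⟨C, hC⟩ := isOpen_Ioo.exists_is_const_of_deriv_eq_zero isPreconnected_Ioo
    (fun t ht => (hasDerivAt_clairaut h ht).differentiableAt.differentiableWithinAt)
    (fun t ht => (hasDerivAt_clairaut h ht).deriv)
  refine ⟨C, fun t ht => ?_⟩
  rw [← clairaut_eq]
  exact hC t ht

variable (S) in
/-- The geodesic equations in the coordinates `s = σ` and `Z = exp (iθ)`, with Clairaut constant
`c`. -/
def IsPolarOn (c : ℝ) (σ v : ℝ → ℝ) (Z : ℝ → ℂ) (J : Set ℝ) : Prop :=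
  ∀ t ∈ J, σ t ∈ Ioo 0 S.M ∧ HasDerivAt σ (v t) t ∧
    HasDerivAt v (c ^ 2 * deriv S.r (σ t) / S.r (σ t) ^ 3) t ∧
    v t ^ 2 = 1 - c ^ 2 / S.r (σ t) ^ 2 ∧
    HasDerivAt Z ((c / S.r (σ t) ^ 2 : ℝ) * Complex.I * Z t) t

theorem hasDerivAt_div_norm {w : ℝ → ℂ} {w' : ℂ} {t : ℝ} (h : HasDerivAt w w' t) (h0 : w t ≠ 0) :
    HasDerivAt (fun t => w t / (‖w t‖ : ℂ))
      ((cross (w t) w' / ‖w t‖ ^ 2 : ℝ) * Complex.I * (w t / (‖w t‖ : ℂ))) t := by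
  have hn := norm_ne_zero_iff.2 h0
  have hn' : (‖w t‖ : ℂ) ≠ 0 := Complex.ofReal_ne_zero.2 hn
  refine (h.div (hasDerivAt_norm h h0).ofReal_comp hn').congr_deriv ?_
  have h1 : w' * (‖w t‖ : ℂ) ^ 2 = (dot (w t) w' + cross (w t) w' * Complex.I) * w t := by
    rw [← Complex.ofReal_pow, ← dot_self_eq]
    apply Complex.ext <;> simp [dot, cross] <;> ring
  push_cast
  field_simp
  linear_combination h1

/-- A chart geodesic avoiding the cone point satisfies the geodesic equations in polar
coordinates. -/
theorem isPolarOn_of_chart {w : ℝ → ℂ} {a b : ℝ}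
    (h : IsUnitGeodesicOn (coneMetric S.m S.r) (Metric.ball 0 S.M) w (Ioo a b))
    (h0 : ∀ t ∈ Ioo a b, w t ≠ 0) :
    ∃ c v, S.IsPolarOn c (fun t => ‖w t‖) v (fun t => (w t / (‖w t‖ : ℂ)) ^ S.m) (Ioo a b) := by
  obtain ⟨C, hC⟩ := exists_clairaut h
  refine ⟨C / S.m, fun t => dot (w t) (deriv w t) / ‖w t‖, fun t ht => ?_⟩
  have hw0 := h0 t ht
  obtain ⟨hD, hw, hu, -⟩ := h t ht
  have hn := norm_pos_iff.2 hw0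
  have hmem : ‖w t‖ ∈ Ioo 0 S.M := ⟨hn, mem_ball_zero_iff.1 hD⟩
  have hr := S.pos _ hmem
  have hm := S.m_ne
  have hCt := hC t ht
  have hA := hCt
  rw [one_add_coneFactor hw0] at hA
  set A := cross (w t) (deriv w t) with hAdef
  have hA' : A = C * ‖w t‖ ^ 2 / (S.m * S.r ‖w t‖) ^ 2 := by
    rw [← hA]; field_simp
  rw [coneMetric_eq] at hu
  have hlag := dot_sq_add_cross_sq (w t) (deriv w t)
  have hden := hasDerivAt_norm hw.hasDerivAt hw0
  refine ⟨hmem, hden, ?_, ?_, ?_⟩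
  · have hN := hasDerivAt_coneMetric_apply h ht hw.hasDerivAt
    rw [fderiv_coneMetric hw0 (hasDerivAt_coneFactor_r hn.ne'), dot_self_eq, (h t ht).2.2.1] at hN
    have hN' : HasDerivAt (fun t => dot (w t) (deriv w t)) _ t :=
      hN.congr_of_eventuallyEq (.of_forall fun x => by
        show dot (w x) (deriv w x) = coneMetric S.m S.r (w x) (deriv w x) (w x)
        rw [coneMetric_eq, cross_same, mul_zero, mul_zero, add_zero, dot_comm])
    refine (hN'.div hden hn.ne').congr_deriv ?_
    have h1 : dot (deriv w t) (deriv w t) = 1 - coneFactor S.m S.r ‖w t‖ * A ^ 2 := by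
      rw [pow_two]; linarith
    rw [h1] at hlag
    have h2 : dot (w t) (deriv w t) ^ 2 =
        ‖w t‖ ^ 2 * (1 - coneFactor S.m S.r ‖w t‖ * A ^ 2) - A ^ 2 := by linarith
    have h3 : dot (w t) (deriv w t) * (dot (w t) (deriv w t) / ‖w t‖) =
        dot (w t) (deriv w t) ^ 2 / ‖w t‖ := by ring
    rw [h3, h2, ← hAdef, hA', coneFactor]
    field_simp
    ring
  · have h1 : dot (deriv w t) (deriv w t) = 1 - coneFactor S.m S.r ‖w t‖ * A ^ 2 := by
      rw [pow_two]; linarith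
    rw [h1] at hlag
    rw [div_pow, show dot (w t) (deriv w t) ^ 2 =
        ‖w t‖ ^ 2 * (1 - coneFactor S.m S.r ‖w t‖ * A ^ 2) - A ^ 2 by linarith, hA', coneFactor]
    field_simp
    ring
  · have h1 := (hasDerivAt_div_norm hw.hasDerivAt hw0).pow S.m
    refine h1.congr_deriv ?_
    rw [← hAdef, hA']
    have h2 : (w t / (‖w t‖ : ℂ)) ^ S.m = (w t / (‖w t‖ : ℂ)) ^ (S.m - 1) * (w t / (‖w t‖ : ℂ)) := by
      rw [← pow_succ, Nat.sub_add_cancel S.m_pos]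
    have hrc : (S.r ‖w t‖ : ℂ) ≠ 0 := Complex.ofReal_ne_zero.2 hr.ne'
    have hnc : (‖w t‖ : ℂ) ≠ 0 := Complex.ofReal_ne_zero.2 hn.ne'
    have hmc : (S.m : ℂ) ≠ 0 := Nat.cast_ne_zero.2 S.m_pos.ne'
    beta_reduce
    rw [h2]
    generalize (w t / (‖w t‖ : ℂ)) ^ (S.m - 1) = P
    generalize w t / (‖w t‖ : ℂ) = W
    push_cast
    field_simp

theorem cross_eq_zero_of_clairaut {w v : ℂ} (hw : w ∈ Metric.ball (0 : ℂ) S.M)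
    (h : cross w v * (1 + coneFactor S.m S.r ‖w‖ * ‖w‖ ^ 2) = 0) : cross w v = 0 := by
  rcases eq_or_ne w 0 with rfl | h0
  · exact cross_zero_left v
  · have hn := norm_pos_iff.2 h0
    have hr := S.pos _ ⟨hn, mem_ball_zero_iff.1 hw⟩
    have hm : 0 < (S.m : ℝ) := Nat.cast_pos.2 S.m_pos
    rw [one_add_coneFactor h0] at h
    exact (mul_eq_zero.1 h).resolve_right (by positivity)

/-- A chart geodesic through the cone point is a straight line. -/
theorem eq_line_of_chart {w : ℝ → ℂ} {a b t₀ : ℝ}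
    (h : IsUnitGeodesicOn (coneMetric S.m S.r) (Metric.ball 0 S.M) w (Ioo a b))
    (ht₀ : t₀ ∈ Ioo a b) (hw₀ : w t₀ = 0) :
    ∃ e : ℂ, ‖e‖ = 1 ∧ ∀ t ∈ Ioo a b, w t = (t - t₀ : ℝ) * e := by
  obtain ⟨C, hC⟩ := exists_clairaut h
  -- Passing through the centre forces the Clairaut constant to vanish, so position and velocity are
  -- parallel at all times. Then the metric derivative in the Euler-Lagrange equation vanishes and
  -- the velocity is constant.
  have hC0 : C = 0 := by rw [← hC t₀ ht₀, hw₀, cross_zero_left, zero_mul]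
  have hcr : ∀ t ∈ Ioo a b, cross (w t) (deriv w t) = 0 := fun t ht =>
    cross_eq_zero_of_clairaut (h t ht).1 ((hC t ht).trans hC0)
  have hfd : ∀ t ∈ Ioo a b, ∀ u : ℂ,
      fderiv ℝ (fun p => coneMetric S.m S.r p (deriv w t) (deriv w t)) (w t) u = 0 := by
    intro t ht u
    rcases eq_or_ne (w t) 0 with h0 | h0
    · rw [h0, fderiv_coneMetric_zero]; rfl
    · rw [fderiv_coneMetric h0 (hasDerivAt_coneFactor_r (norm_ne_zero_iff.2 h0)), hcr t ht]
      ring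
  have hdot : ∀ u : ℂ, ∀ t ∈ Ioo a b, HasDerivAt (fun x => dot (deriv w x) u) 0 t := by
    intro u t ht
    have h1 := (h t ht).2.2.2 u
    rw [hfd t ht, mul_zero] at h1
    refine h1.congr_of_eventuallyEq ?_
    filter_upwards [isOpen_Ioo.mem_nhds ht] with x hx
    rw [coneMetric_eq, hcr x hx, zero_mul, mul_zero, add_zero]
  have hconst : ∀ u : ℂ, ∀ t ∈ Ioo a b, dot (deriv w t) u = dot (deriv w t₀) u := by
    intro u t ht
    exact isOpen_Ioo.is_const_of_deriv_eq_zero isPreconnected_Ioo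
      (fun t ht => (hdot u t ht).differentiableAt.differentiableWithinAt)
      (fun t ht => (hdot u t ht).deriv) ht ht₀
  have hd : ∀ t ∈ Ioo a b, deriv w t = deriv w t₀ := by
    intro t ht
    have h1 := hconst 1 t ht
    have h2 := hconst Complex.I t ht
    simp only [dot, Complex.one_re, Complex.one_im, Complex.I_re, Complex.I_im, mul_one, mul_zero,
      add_zero, zero_add] at h1 h2
    exact Complex.ext h1 h2
  refine ⟨deriv w t₀, ?_, ?_⟩
  · have h1 := (h t₀ ht₀).2.2.1
    rw [coneMetric_eq, hcr t₀ ht₀, zero_mul, mul_zero, add_zero, dot_self_eq] at h1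
    exact (pow_eq_one_iff_of_nonneg (norm_nonneg _) two_ne_zero).1 h1
  · have h1 : ∀ t ∈ Ioo a b, HasDerivAt (fun x => w x - (x - t₀ : ℝ) * deriv w t₀) 0 t := by
      intro t ht
      have h2 := (h t ht).2.1.hasDerivAt
      rw [hd t ht] at h2
      have h3 := (((hasDerivAt_id t).sub_const t₀).ofReal_comp).mul_const (deriv w t₀)
      exact (h2.sub h3).congr_deriv (by simp)
    intro t ht
    have h2 := isOpen_Ioo.is_const_of_deriv_eq_zero isPreconnected_Ioo
      (fun t ht => (h1 t ht).differentiableAt.differentiableWithinAt)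
      (fun t ht => (h1 t ht).deriv) ht ht₀
    simp only [hw₀, sub_self, Complex.ofReal_zero, zero_mul] at h2
    exact sub_eq_zero.1 h2

end SpindleOrbifold

/-! ### From polar solutions back to charts, and the local structure of geodesics -/

namespace SpindleOrbifold
variable {S : SpindleOrbifold}

/-- Solutions of the geodesic equations in polar coordinates are chart geodesics. -/
theorem isUnitGeodesicOn_of_polar {c : ℝ} {σ v θ : ℝ → ℝ} {J : Set ℝ} (hJ : IsOpen J)
    (h : ∀ t ∈ J, σ t ∈ Ioo 0 S.M ∧ HasDerivAt σ (v t) t ∧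
      HasDerivAt v (c ^ 2 * deriv S.r (σ t) / S.r (σ t) ^ 3) t ∧
      v t ^ 2 = 1 - c ^ 2 / S.r (σ t) ^ 2 ∧ HasDerivAt θ (c / S.r (σ t) ^ 2) t) :
    IsUnitGeodesicOn (coneMetric S.m S.r) (Metric.ball 0 S.M)
      (fun t => ⟨σ t * Real.cos (θ t / S.m), σ t * Real.sin (θ t / S.m)⟩) J := by
  set w : ℝ → ℂ := fun t => ⟨σ t * Real.cos (θ t / S.m), σ t * Real.sin (θ t / S.m)⟩ with hw
  set φ' : ℝ → ℝ := fun t => c / S.r (σ t) ^ 2 / S.m with hφ'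
  have hm := S.m_ne
  have hwd : ∀ t ∈ J, HasDerivAt w
      ⟨v t * Real.cos (θ t / S.m) - σ t * φ' t * Real.sin (θ t / S.m),
        v t * Real.sin (θ t / S.m) + σ t * φ' t * Real.cos (θ t / S.m)⟩ t := by
    intro t ht
    obtain ⟨-, hσ, -, -, hθ⟩ := h t ht
    refine hasDerivAt_of_re_im ?_ ?_
    · refine (hσ.mul (hθ.div_const S.m).cos).congr_deriv ?_
      simp only [hφ']; ring
    · refine (hσ.mul (hθ.div_const S.m).sin).congr_deriv ?_
      simp only [hφ']; ring
  have hnorm : ∀ t ∈ J, ‖w t‖ = σ t := by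
    intro t ht
    have h1 := dot_self_eq (w t)
    have h2 : dot (w t) (w t) = σ t ^ 2 := by
      simp only [dot, hw]
      linear_combination σ t ^ 2 * Real.cos_sq_add_sin_sq (θ t / S.m)
    rw [h2] at h1
    exact ((pow_left_inj₀ (h t ht).1.1.le (norm_nonneg _) two_ne_zero).1 h1).symm
  -- The momentum in the orthonormal polar frame has radial part `v` and angular part `m c / σ`; in
  -- this form it is easily differentiated.
  have hG : ∀ u : ℂ, ∀ t ∈ J, coneMetric S.m S.r (w t) (deriv w t) u =
      v t * (Real.cos (θ t / S.m) * u.re + Real.sin (θ t / S.m) * u.im) +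
        S.m * c / σ t * (Real.cos (θ t / S.m) * u.im - Real.sin (θ t / S.m) * u.re) := by
    intro u t ht
    have hr := (S.pos _ (h t ht).1).ne'
    have hσ0 := (h t ht).1.1.ne'
    have hcs := Real.cos_sq_add_sin_sq (θ t / S.m)
    rw [(hwd t ht).deriv, coneMetric_eq, hnorm t ht]
    have h1 : cross (w t) ⟨v t * Real.cos (θ t / S.m) - σ t * φ' t * Real.sin (θ t / S.m),
        v t * Real.sin (θ t / S.m) + σ t * φ' t * Real.cos (θ t / S.m)⟩ = σ t ^ 2 * φ' t := by
      simp only [cross, hw]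
      linear_combination σ t ^ 2 * φ' t * hcs
    rw [h1]
    simp only [dot, cross, hw, coneFactor, hφ']
    field_simp
    ring
  intro t ht
  obtain ⟨hmem, hσ, hv, hE, hθ⟩ := h t ht
  have hr := (S.pos _ hmem).ne'
  have hσ0 := hmem.1.ne'
  have hcs := Real.cos_sq_add_sin_sq (θ t / S.m)
  have hw0 : w t ≠ 0 := norm_ne_zero_iff.1 (by rw [hnorm t ht]; exact hσ0)
  refine ⟨?_, (hwd t ht).differentiableAt, ?_, ?_⟩
  · rw [mem_ball_zero_iff, hnorm t ht]; exact hmem.2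
  · rw [hG _ t ht, (hwd t ht).deriv]
    simp only [hφ']
    have h1 : v t ^ 2 + c ^ 2 / S.r (σ t) ^ 2 = 1 := by rw [hE]; ring
    have h2 : (S.m : ℝ) * c / σ t * (σ t * (c / S.r (σ t) ^ 2 / S.m)) = c ^ 2 / S.r (σ t) ^ 2 := by
      field_simp
    linear_combination (v t ^ 2 + c ^ 2 / S.r (σ t) ^ 2) * hcs + h1 +
      (Real.cos (θ t / S.m) ^ 2 + Real.sin (θ t / S.m) ^ 2) * h2
  · intro u
    have h1 := (hv.mul (((hθ.div_const S.m).cos.mul_const u.re).add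
      ((hθ.div_const S.m).sin.mul_const u.im))).add
      (((hasDerivAt_const t ((S.m : ℝ) * c)).div hσ hσ0).mul
        (((hθ.div_const S.m).cos.mul_const u.im).sub ((hθ.div_const S.m).sin.mul_const u.re)))
    refine (h1.congr_of_eventuallyEq ?_).congr_deriv ?_
    · filter_upwards [hJ.mem_nhds ht] with x hx using hG u x hx
    · rw [fderiv_coneMetric hw0 (hasDerivAt_coneFactor_r (by rw [hnorm t ht]; exact hσ0)),
        (hwd t ht).deriv, hnorm t ht]
      have h1 : cross (w t) ⟨v t * Real.cos (θ t / S.m) - σ t * φ' t * Real.sin (θ t / S.m),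
          v t * Real.sin (θ t / S.m) + σ t * φ' t * Real.cos (θ t / S.m)⟩ = σ t ^ 2 * φ' t := by
        simp only [cross, hw]
        linear_combination σ t ^ 2 * φ' t * hcs
      rw [h1]
      simp only [Pi.div_apply, Pi.add_apply, Pi.sub_apply, dot, cross, hw,
        coneFactor, hφ']
      field_simp
      ring

/-- Unit speed straight lines through the cone point are chart geodesics. -/
theorem isUnitGeodesicOn_line (t₀ : ℝ) {e : ℂ} (he : ‖e‖ = 1) :
    IsUnitGeodesicOn (coneMetric S.m S.r) (Metric.ball 0 S.M) (fun t => (t - t₀ : ℝ) * e)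
      (Ioo (t₀ - S.M) (t₀ + S.M)) := by
  have hd : ∀ t, HasDerivAt (fun t : ℝ => ((t - t₀ : ℝ) : ℂ) * e) e t := fun t =>
    ((((hasDerivAt_id t).sub_const t₀).ofReal_comp).mul_const e).congr_deriv (by simp)
  have hcr : ∀ t : ℝ, cross (((t - t₀ : ℝ) : ℂ) * e) e = 0 := fun t => by
    simp only [cross, Complex.re_ofReal_mul, Complex.im_ofReal_mul]; ring
  intro t ht
  refine ⟨?_, (hd t).differentiableAt, ?_, fun u => ?_⟩
  · rw [mem_ball_zero_iff, norm_mul, he, mul_one, Complex.norm_real, Real.norm_eq_abs, abs_lt]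
    constructor <;> linarith [ht.1, ht.2]
  · rw [(hd t).deriv, coneMetric_eq, hcr, zero_mul, mul_zero, add_zero, dot_self_eq, he, one_pow]
  · have h1 : ∀ x, coneMetric S.m S.r (((x - t₀ : ℝ) : ℂ) * e)
        (deriv (fun t : ℝ => ((t - t₀ : ℝ) : ℂ) * e) x) u = dot e u := fun x => by
      rw [(hd x).deriv, coneMetric_eq, hcr, zero_mul, mul_zero, add_zero]
    simp only [h1]
    refine (hasDerivAt_const t _).congr_deriv ?_
    rw [(hd t).deriv]
    rcases eq_or_ne (((t - t₀ : ℝ) : ℂ) * e) 0 with h0 | h0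
    · rw [h0, fderiv_coneMetric_zero, zero_apply, mul_zero]
    · rw [fderiv_coneMetric h0 (hasDerivAt_coneFactor_r (norm_ne_zero_iff.2 h0)), hcr]
      ring

theorem IsPolarOn.congr {c : ℝ} {σ σ' v : ℝ → ℝ} {Z Z' : ℝ → ℂ} {J : Set ℝ}
    (h : S.IsPolarOn c σ v Z J) (hJ : IsOpen J) (hσ : ∀ t ∈ J, σ' t = σ t)
    (hZ : ∀ t ∈ J, Z' t = Z t) : S.IsPolarOn c σ' v Z' J := by
  intro t ht
  obtain ⟨h1, h2, h3, h4, h5⟩ := h t ht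
  have e1 : σ' =ᶠ[nhds t] σ := by filter_upwards [hJ.mem_nhds ht] with x hx using hσ x hx
  have e2 : Z' =ᶠ[nhds t] Z := by filter_upwards [hJ.mem_nhds ht] with x hx using hZ x hx
  rw [hσ t ht, hZ t ht]
  exact ⟨h1, h2.congr_of_eventuallyEq e1, h3, h4, h5.congr_of_eventuallyEq e2⟩

theorem IsPolarOn.of_reflect {c : ℝ} {σ v : ℝ → ℝ} {Z : ℝ → ℂ} {J : Set ℝ}
    (h : S.reflect.IsPolarOn c σ v Z J) :
    S.IsPolarOn c (fun t => S.M - σ t) (fun t => -v t) Z J := by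
  intro t ht
  obtain ⟨h1, h2, h3, h4, h5⟩ := h t ht
  rw [reflect_r] at h3 h4 h5
  rw [deriv_reflect_r] at h3
  refine ⟨sub_mem_Ioo h1, h2.const_sub S.M, h3.neg.congr_deriv (by ring), ?_, h5⟩
  rw [neg_sq]; exact h4

/-- The distance of `γ t` to the first pole. -/
def height (γ : ℝ → S.Carrier) (t : ℝ) : ℝ := (γ t : ℂ × ℝ).2

/-- The unit complex number `exp (iθ)` at `γ t`. -/
noncomputable def dir (γ : ℝ → S.Carrier) (t : ℝ) : ℂ := (γ t : ℂ × ℝ).1 / (S.r (height γ t) : ℂ)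

theorem norm_dir {γ : ℝ → S.Carrier} {t : ℝ} (h : height γ t ∈ Ioo 0 S.M) : ‖dir γ t‖ = 1 := by
  have h1 : ‖(γ t : ℂ × ℝ).1‖ = S.r (height γ t) := (γ t).2.2
  have hr := S.pos _ h
  rw [dir, norm_div, h1, Complex.norm_real, Real.norm_of_nonneg hr.le, div_self hr.ne']

theorem eq_of_height_eq_of_dir_eq {γ₁ γ₂ : ℝ → S.Carrier} {t : ℝ}
    (h : height γ₁ t ∈ Ioo 0 S.M) (h1 : height γ₁ t = height γ₂ t) (h2 : dir γ₁ t = dir γ₂ t) :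
    γ₁ t = γ₂ t := by
  have hr : (S.r (height γ₂ t) : ℂ) ≠ 0 := by
    rw [← h1]; exact Complex.ofReal_ne_zero.2 (S.pos _ h).ne'
  rw [dir, dir, h1, div_left_inj' hr] at h2
  exact Subtype.ext (Prod.ext h2 h1)

/-- The point at signed distance `x` from the first pole on the line in direction `e`. -/
noncomputable def linePoint (S : SpindleOrbifold) (e : ℂ) (x : ℝ) : ℂ × ℝ :=
  (S.r |x| * ((x / |x| : ℝ) * e) ^ S.m, |x|)

theorem chartZero_line {e : ℂ} (he : ‖e‖ = 1) {x : ℝ}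
    (h : ((x : ℝ) : ℂ) * e ∈ Metric.ball (0 : ℂ) S.M) :
    (S.chartZero ⟨(x : ℂ) * e, h⟩ : ℂ × ℝ) = S.linePoint e x := by
  have h1 : ‖(x : ℂ) * e‖ = |x| := by rw [norm_mul, he, mul_one, Complex.norm_real]; rfl
  simp only [chartZero, linePoint, h1]
  push_cast
  rw [mul_div_right_comm]

theorem exists_Ioo_subset {I : Set ℝ} {t : ℝ} (h : I ∈ nhds t) :
    ∃ a b, t ∈ Ioo a b ∧ Ioo a b ⊆ I := mem_nhds_iff_exists_Ioo_subset.1 h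

theorem IsUnitGeodesicOn.mono {g : ℂ → ℂ → ℂ → ℝ} {D : Set ℂ} {w : ℝ → ℂ} {I J : Set ℝ}
    (h : IsUnitGeodesicOn g D w I) (hJ : J ⊆ I) : IsUnitGeodesicOn g D w J :=
  fun t ht => h t (hJ ht)

/-- The local structure of a path lifting to a geodesic in the first chart. -/
theorem local_structure_of_chart {t₀ : ℝ} {I : Set ℝ} (hI : I ∈ nhds t₀) {w : ℝ → ℂ}
    (hw : IsUnitGeodesicOn (coneMetric S.m S.r) (Metric.ball 0 S.M) w I) {γ : ℝ → ℂ × ℝ}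
    (hγ : ∀ t ∈ I, γ t = (S.r ‖w t‖ * (w t / (‖w t‖ : ℂ)) ^ S.m, ‖w t‖)) :
    ∃ a b, t₀ ∈ Ioo a b ∧
      ((∃ c v, S.IsPolarOn c (fun t => (γ t).2) v (fun t => (γ t).1 / (S.r (γ t).2 : ℂ)) (Ioo a b)) ∨
        ∃ e : ℂ, ‖e‖ = 1 ∧ ∀ t ∈ Ioo a b, |t - t₀| < S.M ∧ γ t = S.linePoint e (t - t₀)) := by
  rcases eq_or_ne (w t₀) 0 with h0 | h0
  · obtain ⟨a, b, hab, hsub⟩ := exists_Ioo_subset hI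
    refine ⟨a, b, hab, .inr ?_⟩
    obtain ⟨e, he, hline⟩ := eq_line_of_chart (IsUnitGeodesicOn.mono hw hsub) hab h0
    refine ⟨e, he, fun t ht => ?_⟩
    have hball := (hw t (hsub ht)).1
    rw [hline t ht] at hball
    constructor
    · rwa [mem_ball_zero_iff, norm_mul, he, mul_one, Complex.norm_real] at hball
    · rw [hγ t (hsub ht), hline t ht, ← chartZero_line he hball]
      rfl
  · have hc : ContinuousAt w t₀ := (hw t₀ (mem_of_mem_nhds hI)).2.1.continuousAt
    obtain ⟨a, b, hab, hsub⟩ := exists_Ioo_subset (Filter.inter_mem hI (hc.eventually_ne h0))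
    refine ⟨a, b, hab, .inl ?_⟩
    obtain ⟨c, v, hp⟩ := isPolarOn_of_chart
      (IsUnitGeodesicOn.mono hw (hsub.trans inter_subset_left)) fun t ht => (hsub ht).2
    refine ⟨c, v, hp.congr isOpen_Ioo (fun t ht => ?_) fun t ht => ?_⟩
    · rw [hγ t (hsub ht).1]
    · rw [hγ t (hsub ht).1]
      have hr := (S.pos _ (hp t ht).1).ne'
      exact mul_div_cancel_left₀ _ (Complex.ofReal_ne_zero.2 hr)

/-- Near each time a geodesic solves the geodesic equations in polar coordinates or passes through
a pole along a line. -/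
theorem IsGeodesic.local_structure {γ : ℝ → S.Carrier} (hγ : S.IsGeodesic γ) (t₀ : ℝ) :
    ∃ a b, t₀ ∈ Ioo a b ∧ ((∃ c v, S.IsPolarOn c (height γ) v (dir γ) (Ioo a b)) ∨
      (∃ e : ℂ, ‖e‖ = 1 ∧ ∀ t ∈ Ioo a b, |t - t₀| < S.M ∧
        (γ t : ℂ × ℝ) = S.linePoint e (t - t₀)) ∨
      ∃ e : ℂ, ‖e‖ = 1 ∧ ∀ t ∈ Ioo a b, |t - t₀| < S.M ∧
        ((γ t : ℂ × ℝ).1, S.M - (γ t : ℂ × ℝ).2) = S.reflect.linePoint e (t - t₀)) := by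
  obtain ⟨I, hI, w, ⟨hw, h⟩ | ⟨hw, h⟩⟩ := hγ t₀
  · obtain ⟨a, b, hab, hor⟩ := local_structure_of_chart hI hw (γ := fun t => γ t) fun t ht => by
      obtain ⟨h1, h2⟩ := h t ht
      rw [h2]; rfl
    exact ⟨a, b, hab, hor.imp id .inl⟩
  · obtain ⟨a, b, hab, hor⟩ := local_structure_of_chart (S := S.reflect) hI hw
      (γ := fun t => ((γ t : ℂ × ℝ).1, S.M - (γ t : ℂ × ℝ).2)) fun t ht => by
        obtain ⟨h1, h2⟩ := h t ht
        rw [h2]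
        simp only [chartM, sub_sub_cancel]
        rfl
    refine ⟨a, b, hab, hor.imp ?_ .inr⟩
    rintro ⟨c, v, hp⟩
    refine ⟨c, _, hp.of_reflect.congr isOpen_Ioo (fun t _ => ?_) fun t _ => ?_⟩
    · exact (sub_sub_cancel _ _).symm
    · show _ = _ / (S.r (S.M - (S.M - _)) : ℂ)
      rw [sub_sub_cancel]; rfl

end SpindleOrbifold

/-! ### Uniqueness of geodesics -/

namespace SpindleOrbifold
variable {S : SpindleOrbifold}

/-- The geodesic vector field with Clairaut constant `c` in polar coordinates. -/
noncomputable def polarField (S : SpindleOrbifold) (c : ℝ) (x : ℝ × ℝ × ℂ) : ℝ × ℝ × ℂ :=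
  (x.2.1, c ^ 2 * deriv S.r x.1 / S.r x.1 ^ 3, (c / S.r x.1 ^ 2 : ℝ) * Complex.I * x.2.2)

theorem contDiffAt_polarField (c : ℝ) {x : ℝ × ℝ × ℂ} (hx : x.1 ∈ Ioo 0 S.M) :
    ContDiffAt ℝ 1 (S.polarField c) x := by
  have hr : ContDiffAt ℝ 1 (fun x : ℝ × ℝ × ℂ => S.r x.1) x :=
    ((S.smooth.of_le (by simp)).comp contDiff_fst).contDiffAt
  have hr' : ContDiffAt ℝ 1 (fun x : ℝ × ℝ × ℂ => deriv S.r x.1) x :=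
    ((S.smooth_deriv_r.of_le (by simp)).comp contDiff_fst).contDiffAt
  have h0 := (S.pos _ hx).ne'
  refine ContDiffAt.prodMk (by fun_prop) (ContDiffAt.prodMk ?_ ?_)
  · exact (contDiffAt_const.mul hr').div (hr.pow 3) (pow_ne_zero 3 h0)
  · refine ContDiffAt.mul (ContDiffAt.mul ?_ contDiffAt_const) (by fun_prop)
    exact Complex.ofRealCLM.contDiff.contDiffAt.comp x
      (contDiffAt_const.div (hr.pow 2) (pow_ne_zero 2 h0))

theorem IsPolarOn.hasDerivAt {c : ℝ} {σ v : ℝ → ℝ} {Z : ℝ → ℂ} {J : Set ℝ}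
    (h : S.IsPolarOn c σ v Z J) {t : ℝ} (ht : t ∈ J) :
    HasDerivAt (fun t => (σ t, v t, Z t)) (S.polarField c (σ t, v t, Z t)) t := by
  obtain ⟨-, h2, h3, -, h5⟩ := h t ht
  exact h2.prodMk (h3.prodMk h5)

/-- Away from the poles the polar field is continuously differentiable, hence locally Lipschitz, and
the uniqueness theorem for ordinary differential equations applies. -/
theorem IsPolarOn.eventuallyEq {c : ℝ} {σ₁ v₁ σ₂ v₂ : ℝ → ℝ} {Z₁ Z₂ : ℝ → ℂ} {a₁ b₁ a₂ b₂ t₀ : ℝ}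
    (h₁ : S.IsPolarOn c σ₁ v₁ Z₁ (Ioo a₁ b₁)) (h₂ : S.IsPolarOn c σ₂ v₂ Z₂ (Ioo a₂ b₂))
    (ht₁ : t₀ ∈ Ioo a₁ b₁) (ht₂ : t₀ ∈ Ioo a₂ b₂) (hσ : σ₁ t₀ = σ₂ t₀) (hv : v₁ t₀ = v₂ t₀)
    (hZ : Z₁ t₀ = Z₂ t₀) : ∀ᶠ t in nhds t₀, σ₁ t = σ₂ t ∧ Z₁ t = Z₂ t := by
  obtain ⟨K, s, hs, hK⟩ :=
    (contDiffAt_polarField c (x := (σ₁ t₀, v₁ t₀, Z₁ t₀)) (h₁ t₀ ht₁).1).exists_lipschitzOnWith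
  have heq : (σ₁ t₀, v₁ t₀, Z₁ t₀) = (σ₂ t₀, v₂ t₀, Z₂ t₀) := by rw [hσ, hv, hZ]
  have hs₂ : s ∈ nhds (σ₂ t₀, v₂ t₀, Z₂ t₀) := by rwa [← heq]
  have h := ODE_solution_unique_of_eventually (v := fun _ => S.polarField c) (s := fun _ => s)
    (f := fun t => (σ₁ t, v₁ t, Z₁ t)) (g := fun t => (σ₂ t, v₂ t, Z₂ t)) (t₀ := t₀)
    (.of_forall fun _ => hK) ?_ ?_ heq
  · filter_upwards [h] with t ht
    simp only [Prod.mk.injEq] at ht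
    exact ⟨ht.1, ht.2.2⟩
  · filter_upwards [isOpen_Ioo.mem_nhds ht₁, (h₁.hasDerivAt ht₁).continuousAt hs] with t ht ht'
      using ⟨h₁.hasDerivAt ht, ht'⟩
  · filter_upwards [isOpen_Ioo.mem_nhds ht₂, (h₂.hasDerivAt ht₂).continuousAt hs₂] with t ht ht'
      using ⟨h₂.hasDerivAt ht, ht'⟩

theorem IsPolarOn.geodesic_eventuallyEq {c : ℝ} {v₁ v₂ : ℝ → ℝ} {γ₁ γ₂ : ℝ → S.Carrier}
    {a₁ b₁ a₂ b₂ t₀ : ℝ} (h₁ : S.IsPolarOn c (height γ₁) v₁ (dir γ₁) (Ioo a₁ b₁))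
    (h₂ : S.IsPolarOn c (height γ₂) v₂ (dir γ₂) (Ioo a₂ b₂))
    (ht₁ : t₀ ∈ Ioo a₁ b₁) (ht₂ : t₀ ∈ Ioo a₂ b₂) (hσ : height γ₁ t₀ = height γ₂ t₀)
    (hv : v₁ t₀ = v₂ t₀) (hZ : dir γ₁ t₀ = dir γ₂ t₀) : γ₁ =ᶠ[nhds t₀] γ₂ := by
  filter_upwards [h₁.eventuallyEq h₂ ht₁ ht₂ hσ hv hZ, isOpen_Ioo.mem_nhds ht₁] with t ht ht'
  exact eq_of_height_eq_of_dir_eq (h₁ t ht').1 ht.1 ht.2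

theorem continuous_linePoint_snd (e : ℂ) (t₀ : ℝ) :
    Continuous fun t => (S.linePoint e (t - t₀)).2 := by
  unfold linePoint; fun_prop

theorem IsGeodesic.continuous_height {γ : ℝ → S.Carrier} (hγ : S.IsGeodesic γ) :
    Continuous (height γ) := by
  refine continuous_iff_continuousAt.2 fun t₀ => ?_
  obtain ⟨a, b, hab, ⟨c, v, h⟩ | ⟨e, he, h⟩ | ⟨e, he, h⟩⟩ := hγ.local_structure t₀
  · exact (h t₀ hab).2.1.continuousAt
  · refine (continuous_linePoint_snd (S := S) e t₀).continuousAt.congr ?_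
    filter_upwards [isOpen_Ioo.mem_nhds hab] with t ht
    rw [← (h t ht).2]; rfl
  · refine (continuous_const.sub (continuous_linePoint_snd (S := S.reflect) e t₀)).continuousAt.congr
      (f := fun t => S.M - (S.reflect.linePoint e (t - t₀)).2) ?_
    filter_upwards [isOpen_Ioo.mem_nhds hab] with t ht
    rw [← (h t ht).2]
    exact sub_sub_cancel _ _

theorem IsGeodesic.exists_polar {γ : ℝ → S.Carrier} (hγ : S.IsGeodesic γ) {t₀ : ℝ}
    (h : height γ t₀ ∈ Ioo 0 S.M) :
    ∃ a b c v, t₀ ∈ Ioo a b ∧ S.IsPolarOn c (height γ) v (dir γ) (Ioo a b) := by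
  obtain ⟨a, b, hab, ⟨c, v, h'⟩ | ⟨e, he, h'⟩ | ⟨e, he, h'⟩⟩ := hγ.local_structure t₀
  · exact ⟨a, b, c, v, hab, h'⟩
  · have h1 := congrArg Prod.snd (h' t₀ hab).2
    simp only [linePoint, sub_self, abs_zero] at h1
    exact absurd h.1 (by rw [height, h1]; exact lt_irrefl _)
  · have h1 := congrArg Prod.snd (h' t₀ hab).2
    simp only [linePoint, sub_self, abs_zero] at h1
    exact absurd h.2 (by rw [height, ← sub_eq_zero.1 h1]; exact lt_irrefl _)

theorem IsGeodesic.exists_line_zero {γ : ℝ → S.Carrier} (hγ : S.IsGeodesic γ) {t₀ : ℝ}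
    (h : height γ t₀ = 0) : ∃ a b, t₀ ∈ Ioo a b ∧ ∃ e : ℂ, ‖e‖ = 1 ∧ ∀ t ∈ Ioo a b,
      |t - t₀| < S.M ∧ (γ t : ℂ × ℝ) = S.linePoint e (t - t₀) := by
  obtain ⟨a, b, hab, ⟨c, v, h'⟩ | ⟨e, he, h'⟩ | ⟨e, he, h'⟩⟩ := hγ.local_structure t₀
  · exact absurd (h' t₀ hab).1.1 (by rw [h]; exact lt_irrefl _)
  · exact ⟨a, b, hab, e, he, h'⟩
  · have h1 := congrArg Prod.snd (h' t₀ hab).2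
    simp only [linePoint, sub_self, abs_zero] at h1
    rw [height] at h
    rw [h, sub_zero] at h1
    exact absurd h1 S.M_pos.ne'

theorem IsGeodesic.exists_line_M {γ : ℝ → S.Carrier} (hγ : S.IsGeodesic γ) {t₀ : ℝ}
    (h : height γ t₀ = S.M) : ∃ a b, t₀ ∈ Ioo a b ∧ ∃ e : ℂ, ‖e‖ = 1 ∧ ∀ t ∈ Ioo a b,
      |t - t₀| < S.M ∧ ((γ t : ℂ × ℝ).1, S.M - (γ t : ℂ × ℝ).2) =
        S.reflect.linePoint e (t - t₀) := by
  obtain ⟨a, b, hab, ⟨c, v, h'⟩ | ⟨e, he, h'⟩ | ⟨e, he, h'⟩⟩ := hγ.local_structure t₀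
  · exact absurd (h' t₀ hab).1.2 (by rw [h]; exact lt_irrefl _)
  · have h1 := congrArg Prod.snd (h' t₀ hab).2
    simp only [linePoint, sub_self, abs_zero] at h1
    rw [height, h1] at h
    exact absurd h.symm S.M_pos.ne'
  · exact ⟨a, b, hab, e, he, h'⟩

/-- A line depends on `e` only through `e ^ m`, that is, up to the chart group, and one point off
the pole determines this power. -/
theorem linePoint_eq_of_eq {e₁ e₂ : ℂ} {x : ℝ} (hx : x ≠ 0) (hxM : |x| < S.M)
    (h : S.linePoint e₁ x = S.linePoint e₂ x) (y : ℝ) : S.linePoint e₁ y = S.linePoint e₂ y := by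
  have h1 := congrArg Prod.fst h
  simp only [linePoint, mul_pow] at h1
  have hr : (S.r |x| : ℂ) ≠ 0 :=
    Complex.ofReal_ne_zero.2 (S.pos _ ⟨abs_pos.2 hx, hxM⟩).ne'
  have hs : ((x / |x| : ℝ) : ℂ) ^ S.m ≠ 0 :=
    pow_ne_zero _ (Complex.ofReal_ne_zero.2 (div_ne_zero hx (abs_ne_zero.2 hx)))
  have h2 := mul_left_cancel₀ hs (mul_left_cancel₀ hr h1)
  simp only [linePoint, mul_pow, h2]

/-- Geodesics are determined by their germ at one time. -/
theorem IsGeodesic.eq_of_eventuallyEq {γ₁ γ₂ : ℝ → S.Carrier} (h₁ : S.IsGeodesic γ₁)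
    (h₂ : S.IsGeodesic γ₂) {t₀ : ℝ} (h : γ₁ =ᶠ[nhds t₀] γ₂) : γ₁ = γ₂ := by
  set A : Set ℝ := {t | γ₁ =ᶠ[nhds t] γ₂} with hA
  have hopen : IsOpen A := isOpen_setOfPred_eventually_nhds
  -- At a limit of times with equal germs there are three cases. If the limit is a pole, both
  -- geodesics are lines there, and a common point nearby identifies them. Otherwise both solve the
  -- polar equations, and their constants and initial data agree by continuity.
  have hclosed : IsClosed A := by
    refine isClosed_of_closure_subset fun t ht => ?_
    rw [mem_closure_iff_frequently] at ht
    by_contra hcon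
    have hht : height γ₁ t = height γ₂ t := by
      have hcl : IsClosed {x | height γ₁ x = height γ₂ x} :=
        isClosed_eq h₁.continuous_height h₂.continuous_height
      refine hcl.closure_subset (mem_closure_iff_frequently.2 (ht.mono fun x hx => ?_))
      have h3 : γ₁ x = γ₂ x := Filter.EventuallyEq.eq_of_nhds hx
      show height γ₁ x = height γ₂ x
      rw [height, height, h3]
    have hne : ∀ (a b : ℝ), t ∈ Ioo a b → ∃ x ∈ Ioo a b, x ∈ A ∧ x ≠ t := by
      intro a b hab
      obtain ⟨x, hxA, hx⟩ := (ht.and_eventually (isOpen_Ioo.mem_nhds hab)).exists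
      exact ⟨x, hx, hxA, fun h' => hcon (h' ▸ hxA)⟩
    have hmem : height γ₁ t ∈ Icc 0 S.M := (γ₁ t).2.1
    rcases eq_or_lt_of_le hmem.1 with h0 | h0
    · obtain ⟨a₁, b₁, hab₁, e₁, -, hl₁⟩ := h₁.exists_line_zero h0.symm
      obtain ⟨a₂, b₂, hab₂, e₂, -, hl₂⟩ := h₂.exists_line_zero (hht.symm.trans h0.symm)
      obtain ⟨x, hx, hxA, hxt⟩ := hne (max a₁ a₂) (min b₁ b₂)
        ⟨max_lt hab₁.1 hab₂.1, lt_min hab₁.2 hab₂.2⟩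
      have hx₁ : x ∈ Ioo a₁ b₁ :=
        ⟨(le_max_left _ _).trans_lt hx.1, hx.2.trans_le (min_le_left _ _)⟩
      have hx₂ : x ∈ Ioo a₂ b₂ :=
        ⟨(le_max_right _ _).trans_lt hx.1, hx.2.trans_le (min_le_right _ _)⟩
      have hxe : γ₁ x = γ₂ x := Filter.EventuallyEq.eq_of_nhds hxA
      have heq := linePoint_eq_of_eq (sub_ne_zero.2 hxt) (hl₁ x hx₁).1
        ((hl₁ x hx₁).2.symm.trans ((congrArg Subtype.val hxe).trans (hl₂ x hx₂).2))
      refine hcon ?_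
      filter_upwards [isOpen_Ioo.mem_nhds hab₁, isOpen_Ioo.mem_nhds hab₂] with y hy₁ hy₂
      exact Subtype.ext (by rw [(hl₁ y hy₁).2, (hl₂ y hy₂).2, heq])
    rcases eq_or_lt_of_le hmem.2 with hM | hM
    · obtain ⟨a₁, b₁, hab₁, e₁, -, hl₁⟩ := h₁.exists_line_M hM
      obtain ⟨a₂, b₂, hab₂, e₂, -, hl₂⟩ := h₂.exists_line_M (hht.symm.trans hM)
      obtain ⟨x, hx, hxA, hxt⟩ := hne (max a₁ a₂) (min b₁ b₂)
        ⟨max_lt hab₁.1 hab₂.1, lt_min hab₁.2 hab₂.2⟩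
      have hx₁ : x ∈ Ioo a₁ b₁ :=
        ⟨(le_max_left _ _).trans_lt hx.1, hx.2.trans_le (min_le_left _ _)⟩
      have hx₂ : x ∈ Ioo a₂ b₂ :=
        ⟨(le_max_right _ _).trans_lt hx.1, hx.2.trans_le (min_le_right _ _)⟩
      have hxe : γ₁ x = γ₂ x := Filter.EventuallyEq.eq_of_nhds hxA
      have heq := linePoint_eq_of_eq (S := S.reflect) (sub_ne_zero.2 hxt) (hl₁ x hx₁).1
        ((hl₁ x hx₁).2.symm.trans ((congrArg (fun p : S.Carrier =>
          ((p : ℂ × ℝ).1, S.M - (p : ℂ × ℝ).2)) hxe).trans (hl₂ x hx₂).2))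
      refine hcon ?_
      filter_upwards [isOpen_Ioo.mem_nhds hab₁, isOpen_Ioo.mem_nhds hab₂] with y hy₁ hy₂
      have h3 := (hl₁ y hy₁).2.trans ((heq _).trans (hl₂ y hy₂).2.symm)
      simp only [Prod.mk.injEq, sub_right_inj] at h3
      exact Subtype.ext (Prod.ext h3.1 h3.2)
    · obtain ⟨a₁, b₁, c₁, v₁, hab₁, hp₁⟩ := h₁.exists_polar ⟨h0, hM⟩
      obtain ⟨a₂, b₂, c₂, v₂, hab₂, hp₂⟩ := h₂.exists_polar (t₀ := t) (by rw [← hht]; exact ⟨h0, hM⟩)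
      have hnear := (isOpen_Ioo.mem_nhds hab₁ : Ioo a₁ b₁ ∈ nhds t)
      have hnear₂ := (isOpen_Ioo.mem_nhds hab₂ : Ioo a₂ b₂ ∈ nhds t)
      have hfr := ht.and_eventually (Filter.inter_mem hnear hnear₂)
      have hval : ∀ x ∈ A, height γ₁ =ᶠ[nhds x] height γ₂ ∧ dir γ₁ =ᶠ[nhds x] dir γ₂ := by
        intro x hx
        constructor
        · filter_upwards [hx] with y hy
          rw [height, height, hy]
        · filter_upwards [hx] with y hy
          simp only [dir, height, hy]
      have hc : c₁ = c₂ := by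
        obtain ⟨x, hx, hx₁, hx₂⟩ := hfr.exists
        obtain ⟨hσ, hZ⟩ := hval x hx
        have h3 := ((hp₁ x hx₁).2.2.2.2.congr_of_eventuallyEq hZ.symm).unique (hp₂ x hx₂).2.2.2.2
        have hm := (hp₁ x hx₁).1
        rw [hσ.eq_of_nhds] at h3 hm
        rw [hZ.eq_of_nhds] at h3
        have hZ0 : dir γ₂ x ≠ 0 := norm_ne_zero_iff.1 (by rw [norm_dir hm]; exact one_ne_zero)
        have h4 := mul_right_cancel₀ Complex.I_ne_zero (mul_right_cancel₀ hZ0 h3)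
        exact (div_left_inj' (pow_ne_zero 2 (S.pos _ hm).ne')).1 (Complex.ofReal_injective h4)
      -- Continuous functions agreeing at times that accumulate at `t` agree at `t`.
      have hlim : ∀ {X : Type} [TopologicalSpace X] [T2Space X] (f g : ℝ → X), ContinuousAt f t →
          ContinuousAt g t → (∃ᶠ x in nhds t, f x = g x) → f t = g t := by
        intro X _ _ f g hf hg hfg
        by_contra hne
        obtain ⟨u, v, hu, hv, hfu, hgv, huv⟩ := t2_separation hne
        have h5 := Filter.inter_mem (hf.preimage_mem_nhds (hu.mem_nhds hfu))
          (hg.preimage_mem_nhds (hv.mem_nhds hgv))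
        obtain ⟨x, hx, hx1, hx2⟩ := (hfg.and_eventually h5).exists
        exact huv.le_bot ⟨hx1, by rw [mem_preimage, ← hx] at hx2; exact hx2⟩
      subst hc
      refine hcon (hp₁.geodesic_eventuallyEq hp₂ hab₁ hab₂ hht ?_ ?_)
      · refine hlim v₁ v₂ (hp₁ t hab₁).2.2.1.continuousAt (hp₂ t hab₂).2.2.1.continuousAt
          (hfr.mono fun x hx => ?_)
        exact ((hp₁ x hx.2.1).2.1.congr_of_eventuallyEq (hval x hx.1).1.symm).unique
          (hp₂ x hx.2.2).2.1
      · exact hlim _ _ (hp₁ t hab₁).2.2.2.2.continuousAt (hp₂ t hab₂).2.2.2.2.continuousAt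
          (hfr.mono fun x hx => (hval x hx.1).2.eq_of_nhds)
  have huniv : A = univ := IsClopen.eq_univ ⟨hclosed, hopen⟩ ⟨t₀, h⟩
  funext t
  have : t ∈ A := by rw [huniv]; exact mem_univ t
  exact Filter.EventuallyEq.eq_of_nhds this

end SpindleOrbifold

/-! ### Geodesics from polar data, unit tangent vectors, first returns -/

namespace SpindleOrbifold
variable {S : SpindleOrbifold}

theorem IsGeodesic.shift {γ : ℝ → S.Carrier} (hγ : S.IsGeodesic γ) (a : ℝ) :
    S.IsGeodesic fun t => γ (t + a) := by
  have key : ∀ (g : ℂ → ℂ → ℂ → ℝ) (w : ℝ → ℂ) (I : Set ℝ),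
      IsUnitGeodesicOn g (Metric.ball 0 S.M) w I →
      IsUnitGeodesicOn g (Metric.ball 0 S.M) (fun t => w (t + a)) ((· + a) ⁻¹' I) := by
    intro g w I h t ht
    obtain ⟨h1, h2, h3, h4⟩ := h (t + a) ht
    have hd : ∀ x, deriv (fun t => w (t + a)) x = deriv w (x + a) := fun x =>
      deriv_comp_add_const (f := w) (a := a) (x := x)
    refine ⟨h1, (h2.hasDerivAt.comp_add_const t a).differentiableAt, ?_, fun u => ?_⟩
    · rw [hd]; exact h3
    · simp only [hd]
      exact (h4 u).comp_add_const t a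
  intro t₀
  obtain ⟨I, hI, w, h⟩ := hγ (t₀ + a)
  have hI' : (· + a) ⁻¹' I ∈ nhds t₀ :=
    (continuous_add_const a).continuousAt.preimage_mem_nhds hI
  refine ⟨_, hI', fun t => w (t + a), h.imp ?_ ?_⟩ <;>
  · rintro ⟨h1, h2⟩
    exact ⟨key _ _ _ h1, fun t ht => h2 (t + a) ht⟩

/-- The point with coordinates `(θ, s)`. -/
noncomputable def polarPoint (θ : ℝ) {s : ℝ} (hs : s ∈ Icc 0 S.M) : S.Carrier :=
  ⟨S.Phi θ s, hs, by
    rw [Phi, norm_mul, Complex.norm_exp_ofReal_mul_I, mul_one, Complex.norm_real,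
      Real.norm_of_nonneg (S.r_nonneg hs)]⟩

/-- The solution never meets a pole, so the single chart at `s = 0`, with chart angle `θ / m`,
covers it for all times. -/
theorem isGeodesic_of_polar {c : ℝ} {σ v θ : ℝ → ℝ}
    (h : ∀ t, σ t ∈ Ioo 0 S.M ∧ HasDerivAt σ (v t) t ∧
      HasDerivAt v (c ^ 2 * deriv S.r (σ t) / S.r (σ t) ^ 3) t ∧
      v t ^ 2 = 1 - c ^ 2 / S.r (σ t) ^ 2 ∧ HasDerivAt θ (c / S.r (σ t) ^ 2) t) :
    S.IsGeodesic fun t => polarPoint (θ t) (Ioo_subset_Icc_self (h t).1) := by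
  intro t₀
  have hgeo := isUnitGeodesicOn_of_polar isOpen_univ (fun t _ => h t)
  refine ⟨univ, Filter.univ_mem, _, .inl ⟨hgeo, fun t _ => ⟨(hgeo t (mem_univ t)).1, ?_⟩⟩⟩
  have hw : (⟨σ t * Real.cos (θ t / S.m), σ t * Real.sin (θ t / S.m)⟩ : ℂ) =
      σ t * Complex.exp ((θ t / S.m : ℝ) * Complex.I) := by
    generalize θ t / S.m = x
    rw [Complex.exp_mul_I]
    apply Complex.ext <;> simp [Complex.cos_ofReal_re, Complex.sin_ofReal_re]
  have hn : ‖(⟨σ t * Real.cos (θ t / S.m), σ t * Real.sin (θ t / S.m)⟩ : ℂ)‖ = σ t := by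
    rw [hw, norm_mul, Complex.norm_exp_ofReal_mul_I, mul_one, Complex.norm_real,
      Real.norm_of_nonneg (h t).1.1.le]
  refine Subtype.ext ?_
  simp only [polarPoint, Phi, chartZero, hn]
  rw [hw, mul_div_cancel_left₀ _ (Complex.ofReal_ne_zero.2 (h t).1.1.ne'), ← Complex.exp_nat_mul]
  have hm : (S.m : ℂ) ≠ 0 := Nat.cast_ne_zero.2 S.m_pos.ne'
  congr 3
  push_cast
  field_simp

theorem dir_eq_of_eq {γ : ℝ → S.Carrier} {t θ s : ℝ} (hs : s ∈ Ioo 0 S.M)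
    (h : (γ t : ℂ × ℝ) = S.Phi θ s) : dir γ t = Complex.exp (θ * Complex.I) := by
  have h1 : height γ t = s := congrArg Prod.snd h
  rw [dir, h1, h]
  exact mul_div_cancel_left₀ _ (Complex.ofReal_ne_zero.2 (S.pos _ hs).ne')

theorem isPolarOn_polarPoint {c : ℝ} {σ v θ : ℝ → ℝ}
    (h : ∀ t, σ t ∈ Ioo 0 S.M ∧ HasDerivAt σ (v t) t ∧
      HasDerivAt v (c ^ 2 * deriv S.r (σ t) / S.r (σ t) ^ 3) t ∧
      v t ^ 2 = 1 - c ^ 2 / S.r (σ t) ^ 2 ∧ HasDerivAt θ (c / S.r (σ t) ^ 2) t) (J : Set ℝ) :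
    S.IsPolarOn c (height fun t => polarPoint (S := S) (θ t) (Ioo_subset_Icc_self (h t).1)) v
      (dir fun t => polarPoint (S := S) (θ t) (Ioo_subset_Icc_self (h t).1)) J := by
  intro t _
  obtain ⟨h1, h2, h3, h4, h5⟩ := h t
  refine ⟨h1, h2, h3, h4, ?_⟩
  have hZ : dir (fun t => polarPoint (S := S) (θ t) (Ioo_subset_Icc_self (h t).1)) =
      fun t => Complex.exp (θ t * Complex.I) := by
    funext x
    exact dir_eq_of_eq (h x).1 rfl
  rw [hZ]
  refine ((h5.ofReal_comp.mul_const Complex.I).cexp).congr_deriv ?_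
  rw [mul_comm]; rfl

theorem HasUnitTangent.mem {γ : ℝ → S.Carrier} {t θ β s : ℝ} (h : S.HasUnitTangent γ t θ β s) :
    s ∈ Ioo 0 S.M := by
  obtain ⟨Θ, σ, h1, h2, h3, h4, h5⟩ := h
  rw [← h2]; exact h5.self_of_nhds.1

theorem HasUnitTangent.height_eq {γ : ℝ → S.Carrier} {t θ β s : ℝ}
    (h : S.HasUnitTangent γ t θ β s) : height γ t = s := by
  obtain ⟨Θ, σ, h1, h2, h3, h4, h5⟩ := h
  rw [height, h5.self_of_nhds.2, ← h2]; rfl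

theorem HasUnitTangent.hasDerivAt_height {γ : ℝ → S.Carrier} {t θ β s : ℝ}
    (h : S.HasUnitTangent γ t θ β s) : HasDerivAt (height γ) (Real.sin β) t := by
  obtain ⟨Θ, σ, h1, h2, h3, h4, h5⟩ := h
  refine h4.congr_of_eventuallyEq ?_
  filter_upwards [h5] with x hx
  rw [height, hx.2]; rfl

theorem HasUnitTangent.dir_eq {γ : ℝ → S.Carrier} {t θ β s : ℝ}
    (h : S.HasUnitTangent γ t θ β s) : dir γ t = Complex.exp (θ * Complex.I) := by
  obtain ⟨Θ, σ, h1, h2, h3, h4, h5⟩ := h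
  rw [dir_eq_of_eq h5.self_of_nhds.1 h5.self_of_nhds.2, h1]

theorem HasUnitTangent.hasDerivAt_dir {γ : ℝ → S.Carrier} {t θ β s : ℝ}
    (h : S.HasUnitTangent γ t θ β s) :
    HasDerivAt (dir γ) ((Real.cos β / S.r s : ℝ) * Complex.I * dir γ t) t := by
  rw [h.dir_eq]
  obtain ⟨Θ, σ, h1, h2, h3, h4, h5⟩ := h
  have h6 := (h3.ofReal_comp.mul_const Complex.I).cexp
  rw [h1] at h6
  refine (h6.congr_of_eventuallyEq ?_).congr_deriv (mul_comm _ _)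
  filter_upwards [h5] with x hx using dir_eq_of_eq hx.1 hx.2

/-- Two geodesics with the same Clairaut constant, position and radial velocity agree. -/
theorem IsGeodesic.eq_of_polar {γ₁ γ₂ : ℝ → S.Carrier} (h₁ : S.IsGeodesic γ₁)
    (h₂ : S.IsGeodesic γ₂) {c : ℝ} {v₁ v₂ : ℝ → ℝ} {a₁ b₁ a₂ b₂ t₀ : ℝ}
    (hp₁ : S.IsPolarOn c (height γ₁) v₁ (dir γ₁) (Ioo a₁ b₁))
    (hp₂ : S.IsPolarOn c (height γ₂) v₂ (dir γ₂) (Ioo a₂ b₂))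
    (ht₁ : t₀ ∈ Ioo a₁ b₁) (ht₂ : t₀ ∈ Ioo a₂ b₂) (hσ : height γ₁ t₀ = height γ₂ t₀)
    (hv : v₁ t₀ = v₂ t₀) (hZ : dir γ₁ t₀ = dir γ₂ t₀) : γ₁ = γ₂ :=
  h₁.eq_of_eventuallyEq h₂ (hp₁.geodesic_eventuallyEq hp₂ ht₁ ht₂ hσ hv hZ)

theorem dir_ne_zero {γ : ℝ → S.Carrier} {t : ℝ} (h : height γ t ∈ Ioo 0 S.M) : dir γ t ≠ 0 :=
  norm_ne_zero_iff.1 (by rw [norm_dir h]; exact one_ne_zero)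

/-- A geodesic is determined by its unit tangent vector at one time. -/
theorem IsGeodesic.eq_of_hasUnitTangent {γ₁ γ₂ : ℝ → S.Carrier} (h₁ : S.IsGeodesic γ₁)
    (h₂ : S.IsGeodesic γ₂) {t θ β s : ℝ} (ht₁ : S.HasUnitTangent γ₁ t θ β s)
    (ht₂ : S.HasUnitTangent γ₂ t θ β s) : γ₁ = γ₂ := by
  have key : ∀ γ : ℝ → S.Carrier, S.IsGeodesic γ → S.HasUnitTangent γ t θ β s →
      ∃ a b v, t ∈ Ioo a b ∧ S.IsPolarOn (S.r s * Real.cos β) (height γ) v (dir γ) (Ioo a b) ∧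
        v t = Real.sin β := by
    intro γ hγ hu
    have hm : height γ t ∈ Ioo 0 S.M := by rw [hu.height_eq]; exact hu.mem
    obtain ⟨a, b, c, v, hab, hp⟩ := hγ.exists_polar hm
    obtain ⟨-, h2, -, -, h5⟩ := hp t hab
    have h6 := mul_right_cancel₀ Complex.I_ne_zero
      (mul_right_cancel₀ (dir_ne_zero hm) (h5.unique hu.hasDerivAt_dir))
    have h7 : c / S.r (height γ t) ^ 2 = Real.cos β / S.r s := Complex.ofReal_injective h6
    rw [hu.height_eq] at h7
    have hr := (S.pos s hu.mem).ne'
    have hc : c = S.r s * Real.cos β := by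
      field_simp at h7
      rw [h7]
    exact ⟨a, b, v, hab, hc ▸ hp, h2.unique hu.hasDerivAt_height⟩
  obtain ⟨a₁, b₁, v₁, hab₁, hp₁, hv₁⟩ := key γ₁ h₁ ht₁
  obtain ⟨a₂, b₂, v₂, hab₂, hp₂, hv₂⟩ := key γ₂ h₂ ht₂
  exact h₁.eq_of_polar h₂ hp₁ hp₂ hab₁ hab₂ (ht₁.height_eq.trans ht₂.height_eq.symm)
    (hv₁.trans hv₂.symm) (ht₁.dir_eq.trans ht₂.dir_eq.symm)

/-- A criterion for the first return to the Birkhoff annulus. -/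
theorem isFirstReturn_of_geodesic {s₀ ξ η τ ξ' : ℝ} {γ : ℝ → S.Carrier} (hγ : S.IsGeodesic γ)
    (hη : η ∈ Ioo (-1 : ℝ) 1) (hτ : 0 < τ)
    (h0 : S.HasUnitTangent γ 0 (ξ / S.r s₀) (Real.arccos (-η)) s₀)
    (h1 : S.HasUnitTangent γ τ (ξ' / S.r s₀) (Real.arccos (-η)) s₀)
    (hmin : ∀ t ∈ Ioo 0 τ, ∀ v > 0, height γ t = s₀ → ¬ HasDerivAt (height γ) v t) :
    S.IsFirstReturn s₀ ξ η τ ξ' η := by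
  refine ⟨⟨⟨hτ, ξ', η, hη, γ, hγ, h0, h1⟩, ?_⟩, hη, γ, hγ, h0, h1⟩
  rintro t ⟨ht, x, y, hy, γ', hγ', h0', h1'⟩
  by_contra! hlt
  have heq := hγ'.eq_of_hasUnitTangent hγ h0' h0
  subst heq
  -- Vectors of the open annulus have `sin β > 0`, so any return crosses the equator upwards.
  refine hmin t ⟨ht, hlt⟩ _ ?_ h1'.height_eq h1'.hasDerivAt_height
  rw [Real.sin_arccos, gt_iff_lt, Real.sqrt_pos]
  nlinarith [hy.1, hy.2]

end SpindleOrbifold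

/-! ### Oscillating orbits as geodesics: first return and closing -/

namespace SpindleOrbifold
variable {S : SpindleOrbifold}

/-- The polar geodesic equations, for all times. -/
def SolvesPolar (S : SpindleOrbifold) (c : ℝ) (σ v θ : ℝ → ℝ) : Prop :=
  ∀ t, σ t ∈ Ioo 0 S.M ∧ HasDerivAt σ (v t) t ∧
    HasDerivAt v (c ^ 2 * deriv S.r (σ t) / S.r (σ t) ^ 3) t ∧
    v t ^ 2 = 1 - c ^ 2 / S.r (σ t) ^ 2 ∧ HasDerivAt θ (c / S.r (σ t) ^ 2) t

/-- The path with the given coordinates. -/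
noncomputable def SolvesPolar.path {c : ℝ} {σ v θ : ℝ → ℝ} (h : S.SolvesPolar c σ v θ) (t : ℝ) :
    S.Carrier :=
  polarPoint (θ t) (Ioo_subset_Icc_self (h t).1)

theorem SolvesPolar.isGeodesic {c : ℝ} {σ v θ : ℝ → ℝ} (h : S.SolvesPolar c σ v θ) :
    S.IsGeodesic h.path := isGeodesic_of_polar h

theorem SolvesPolar.isPolarOn {c : ℝ} {σ v θ : ℝ → ℝ} (h : S.SolvesPolar c σ v θ) (J : Set ℝ) :
    S.IsPolarOn c (height h.path) v (dir h.path) J := isPolarOn_polarPoint h J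

theorem SolvesPolar.dir_path {c : ℝ} {σ v θ : ℝ → ℝ} (h : S.SolvesPolar c σ v θ) (t : ℝ) :
    dir h.path t = Complex.exp (θ t * Complex.I) := dir_eq_of_eq (h t).1 rfl

theorem Phi_add_int_mul_two_pi (θ s : ℝ) (k : ℤ) : S.Phi (θ + k * (2 * Real.pi)) s = S.Phi θ s := by
  rw [Phi, Phi]
  congr 2
  push_cast
  rw [add_mul, Complex.exp_add,
    show (k * (2 * Real.pi) * Complex.I : ℂ) = k * (2 * Real.pi * Complex.I) by ring,
    Complex.exp_int_mul_two_pi_mul_I, mul_one]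

theorem SolvesPolar.hasUnitTangent {c : ℝ} {σ v θ : ℝ → ℝ} (h : S.SolvesPolar c σ v θ) {t β : ℝ}
    (hc : S.r (σ t) * Real.cos β = c) (hs : Real.sin β = v t) (k : ℤ) :
    S.HasUnitTangent h.path t (θ t + k * (2 * Real.pi)) β (σ t) := by
  obtain ⟨h1, h2, -, -, h5⟩ := h t
  refine ⟨fun x => θ x + k * (2 * Real.pi), σ, rfl, rfl, ?_, hs ▸ h2, .of_forall fun x =>
    ⟨(h x).1, ?_⟩⟩
  · refine (h5.add_const _).congr_deriv ?_
    have := (S.pos _ h1).ne'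
    rw [← hc]
    field_simp
  · exact (Phi_add_int_mul_two_pi _ _ k).symm

/-- A geodesic with the same initial data as a solution of the polar equations. -/
theorem SolvesPolar.eq_path {c c' : ℝ} {σ v θ v' : ℝ → ℝ} (h : S.SolvesPolar c σ v θ)
    {γ : ℝ → S.Carrier} (hγ : S.IsGeodesic γ) {a b t₀ : ℝ} (hab : t₀ ∈ Ioo a b)
    (hp : S.IsPolarOn c' (height γ) v' (dir γ) (Ioo a b)) (hc : c' = c)
    (hσ : height γ t₀ = σ 0) (hv : v' t₀ = v 0)
    (hZ : dir γ t₀ = Complex.exp (θ 0 * Complex.I)) : (fun t => γ (t + t₀)) = h.path := by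
  subst hc
  have hp' : S.IsPolarOn c' (height fun t => γ (t + t₀)) (fun t => v' (t + t₀))
      (dir fun t => γ (t + t₀)) (Ioo (a - t₀) (b - t₀)) := by
    intro t ht
    obtain ⟨h1, h2, h3, h4, h5⟩ := hp (t + t₀) ⟨by linarith [ht.1], by linarith [ht.2]⟩
    exact ⟨h1, h2.comp_add_const t t₀, h3.comp_add_const t t₀, h4, h5.comp_add_const t t₀⟩
  refine (hγ.shift t₀).eq_of_polar h.isGeodesic hp' (h.isPolarOn (Ioo (-1) 1)) (t₀ := 0)
    ⟨by linarith [hab.1], by linarith [hab.2]⟩ (by norm_num) ?_ ?_ ?_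
  · show height γ (0 + t₀) = σ 0
    rw [zero_add, hσ]
  · simp only [zero_add, hv]
  · show dir γ (0 + t₀) = _
    rw [zero_add, hZ, h.dir_path]

namespace Orbit
variable {s₀ c : ℝ} (O : S.Orbit s₀ c)

/-- The distance to the first pole along the orbit. -/
noncomputable def radius (t : ℝ) : ℝ := swing O.p O.q (O.U t)

/-- The radial velocity along the orbit. -/
noncomputable def velocity (t : ℝ) : ℝ := (O.q - O.p) / 2 * Real.sin (O.U t) * O.g (O.U t)

theorem p_lt_q : O.p < O.q := O.p_mem.2.trans O.q_mem.1

theorem swing_mem_Ioo (u : ℝ) : swing O.p O.q u ∈ Ioo 0 S.M :=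
  ⟨O.p_mem.1.trans_le (swing_mem O.p_lt_q u).1, (swing_mem O.p_lt_q u).2.trans_lt O.q_mem.2⟩

theorem radius_mem (t : ℝ) : O.radius t ∈ Ioo 0 S.M := O.swing_mem_Ioo _

theorem hasDerivAt_radius (t : ℝ) : HasDerivAt O.radius (O.velocity t) t :=
  (hasDerivAt_swing O.p O.q (O.U t)).comp t (O.hasDerivAt_U t)

theorem radius_add (t : ℝ) : O.radius (t + O.T) = O.radius t := by
  rw [radius, O.U_add, swing_periodic]; rfl

theorem velocity_add (t : ℝ) : O.velocity (t + O.T) = O.velocity t := by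
  have h1 := (O.hasDerivAt_radius (t + O.T)).comp_add_const t O.T
  simp only [radius_add] at h1
  exact h1.unique (O.hasDerivAt_radius t)

theorem continuous_radius : Continuous O.radius :=
  continuous_iff_continuousAt.2 fun t => (O.hasDerivAt_radius t).continuousAt

theorem continuous_angular : Continuous fun t => c / S.r (O.radius t) ^ 2 := by
  have h1 := S.continuous_r
  have h2 := O.continuous_radius
  exact continuous_const.div (by fun_prop) fun t => (pow_pos (S.pos _ (O.radius_mem t)) 2).ne'

/-- The angular coordinate along the orbit. -/
noncomputable def longitude (a θ₀ t : ℝ) : ℝ :=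
  θ₀ + ∫ x in a..(t + a), c / S.r (O.radius x) ^ 2

theorem longitude_zero (a θ₀ : ℝ) : O.longitude a θ₀ 0 = θ₀ := by simp [longitude]

theorem longitude_add (a θ₀ t : ℝ) :
    O.longitude a θ₀ (t + O.T) = O.longitude a θ₀ t + S.angle c := by
  have hper : Function.Periodic (fun x => c / S.r (O.radius x) ^ 2) O.T := fun x => by
    simp only [radius_add]
  have hii : ∀ x y, IntervalIntegrable (fun x => c / S.r (O.radius x) ^ 2) volume x y :=
    fun x y => O.continuous_angular.intervalIntegrable x y
  have h1 := hper.intervalIntegral_add_eq (t + a) 0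
  rw [zero_add] at h1
  have h2 : ∫ x in (0 : ℝ)..O.T, c / S.r (O.radius x) ^ 2 = S.angle c := O.angle_eq
  have h3 := intervalIntegral.integral_add_adjacent_intervals (hii a (t + a))
    (hii (t + a) (t + a + O.T))
  rw [longitude, longitude, add_right_comm t O.T a, ← h3, h1, h2, add_assoc]

theorem solvesPolar (a θ₀ : ℝ) : S.SolvesPolar c (fun t => O.radius (t + a))
    (fun t => O.velocity (t + a)) (O.longitude a θ₀) := by
  intro t
  refine ⟨O.radius_mem _, (O.hasDerivAt_radius (t + a)).comp_add_const t a,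
    (O.hasDerivAt_velocity (t + a)).comp_add_const t a, O.energy _, ?_⟩
  exact ((O.continuous_angular.integral_hasStrictDerivAt a (t + a)).hasDerivAt.comp_add_const
    t a).const_add θ₀

/-- The energy fixes the radial velocity up to sign, and the two phases `u` and `2π - u` at the same
height realize the two signs. -/
theorem exists_phase {s v : ℝ} (hs : s ∈ Ioo 0 S.M) (hv : v ^ 2 = 1 - c ^ 2 / S.r s ^ 2) :
    ∃ a, O.radius a = s ∧ O.velocity a = v := by
  have hr := S.pos s hs
  have hle : c ^ 2 ≤ S.r s ^ 2 := by
    have h1 : c ^ 2 / S.r s ^ 2 ≤ 1 := by nlinarith [sq_nonneg v]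
    rwa [div_le_one (by positivity)] at h1
  have hpq := sub_pos.2 O.p_lt_q
  obtain ⟨h1, h2⟩ := O.mem_of_le s hs hle
  set u := Real.arccos ((O.p + O.q - 2 * s) / (O.q - O.p)) with hu
  have hsu : swing O.p O.q u = s := by
    rw [swing, hu, Real.cos_arccos]
    · field_simp
      ring
    · rw [le_div_iff₀ hpq]; linarith
    · rw [div_le_one hpq]; linarith
  have hsin : 0 ≤ Real.sin u := Real.sin_nonneg_of_nonneg_of_le_pi (Real.arccos_nonneg _)
    (Real.arccos_le_pi _)
  rcases le_total 0 v with hv0 | hv0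
  · obtain ⟨a, ha⟩ := O.U_surjective u
    refine ⟨a, by rw [radius, ha, hsu], ?_⟩
    have h3 := O.energy u
    rw [hsu, ← hv] at h3
    rw [velocity, ha]
    exact (pow_left_inj₀ (by have := O.g_pos u; positivity) hv0 two_ne_zero).1 h3
  · obtain ⟨a, ha⟩ := O.U_surjective (2 * Real.pi - u)
    refine ⟨a, by rw [radius, ha, swing_two_pi_sub, hsu], ?_⟩
    have h3 := O.energy (2 * Real.pi - u)
    rw [swing_two_pi_sub, hsu, ← hv, ← neg_sq, ← neg_sq v] at h3
    rw [velocity, ha]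
    refine neg_inj.1 ((pow_left_inj₀ ?_ (neg_nonneg.2 hv0) two_ne_zero).1 h3)
    have h4 := O.g_pos (2 * Real.pi - u)
    rw [Real.sin_two_pi_sub]
    have : 0 ≤ (O.q - O.p) / 2 * Real.sin u * O.g (2 * Real.pi - u) := by positivity
    linarith

/-- An orbit crosses each of its parallels upwards once in a period. -/
theorem no_early_return {a t v : ℝ} (ha : 0 < O.velocity a) (ht : t ∈ Ioo 0 O.T) (hv : 0 < v)
    (hr : O.radius (t + a) = O.radius a)
    (hd : HasDerivAt (fun t => O.radius (t + a)) v t) : False := by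
  have hpq := sub_pos.2 O.p_lt_q
  have hvel : O.velocity (t + a) = v := ((O.hasDerivAt_radius (t + a)).comp_add_const t a).unique hd
  have hsin : ∀ x, 0 < O.velocity x → 0 < Real.sin (O.U x) := by
    intro x hx
    rw [velocity] at hx
    have h1 := pos_of_mul_pos_left hx (O.g_pos (O.U x)).le
    exact pos_of_mul_pos_right h1 (by positivity)
  have h1 := hsin a ha
  have h2 := hsin (t + a) (by rw [hvel]; exact hv)
  have hcos : Real.cos (O.U (t + a)) = Real.cos (O.U a) := by
    rw [radius, radius, swing, swing] at hr
    have : (O.q - O.p) / 2 ≠ 0 := by positivity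
    exact mul_left_cancel₀ this (by linarith)
  have hsin2 : Real.sin (O.U (t + a)) = Real.sin (O.U a) := by
    refine (pow_left_inj₀ h2.le h1.le two_ne_zero).1 ?_
    rw [Real.sin_sq, Real.sin_sq, hcos]
  -- Equal height and upward velocity make the two phases congruent modulo `2π`, but less than one
  -- period separates them.
  have h3 : Real.cos (O.U (t + a) - O.U a) = 1 := by
    rw [Real.cos_sub, hcos, hsin2]
    linarith [Real.sin_sq_add_cos_sq (O.U a), sq (Real.sin (O.U a)), sq (Real.cos (O.U a))]
  have h4 : O.U a < O.U (t + a) := O.U_strictMono (by linarith [ht.1])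
  have h5 : O.U (t + a) < O.U a + 2 * Real.pi := by
    rw [← O.U_add]; exact O.U_strictMono (by linarith [ht.2])
  have h6 := (Real.cos_eq_one_iff_of_lt_of_lt (by linarith) (by linarith)).1 h3
  linarith

/-- The orbit starts at the phase where it crosses `s₀` upwards with speed `√(1 - η²)`; one period
later height and velocity recur and the longitude has grown by the angle of a period. The integer
`k` leaves the longitude free modulo full turns. -/
theorem isFirstReturn {ξ η : ℝ} (hs₀ : s₀ ∈ Ioo 0 S.M) (hη : η ∈ Ioo (-1 : ℝ) 1)
    (hc : c = -η * S.r s₀) {ξ' : ℝ} {k : ℤ}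
    (hξ' : ξ' / S.r s₀ = ξ / S.r s₀ + S.angle c + k * (2 * Real.pi)) :
    S.IsFirstReturn s₀ ξ η O.T ξ' η := by
  have hr := S.pos s₀ hs₀
  have hpos : 0 < 1 - (-η) ^ 2 := by nlinarith [hη.1, hη.2]
  obtain ⟨a, ha1, ha2⟩ := O.exists_phase (s := s₀) (v := √(1 - (-η) ^ 2)) hs₀ (by
    rw [Real.sq_sqrt hpos.le, hc]
    field_simp)
  have hvpos : 0 < O.velocity a := by rw [ha2]; exact Real.sqrt_pos.2 hpos
  have hsol := O.solvesPolar a (ξ / S.r s₀)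
  have hcos : S.r s₀ * Real.cos (Real.arccos (-η)) = c := by
    rw [Real.cos_arccos (by linarith [hη.2]) (by linarith [hη.1]), hc]; ring
  refine isFirstReturn_of_geodesic hsol.isGeodesic hη O.T_pos ?_ ?_ ?_
  · have h1 := hsol.hasUnitTangent (t := 0) (β := Real.arccos (-η))
      (by simp only [zero_add, ha1]; exact hcos)
      (by simp only [zero_add, ha2, Real.sin_arccos]) 0
    simpa only [zero_add, ha1, longitude_zero, Int.cast_zero, zero_mul, add_zero] using h1
  · have h1 := hsol.hasUnitTangent (t := O.T) (β := Real.arccos (-η))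
      (by simp only [add_comm O.T a, radius_add, ha1]; exact hcos)
      (by simp only [add_comm O.T a, velocity_add, ha2, Real.sin_arccos]) k
    have h2 := O.longitude_add a (ξ / S.r s₀) 0
    rw [zero_add, longitude_zero] at h2
    rw [hξ']
    simpa only [add_comm O.T a, radius_add, ha1, h2] using h1
  · intro t ht v hv hh hd
    exact O.no_early_return hvpos ht hv (hh.trans ha1.symm) hd

/-- If the angle of a period is a multiple of `π`, two periods close up. -/
theorem periodic_path {a θ₀ : ℝ} {k : ℤ} (hk : S.angle c = k * Real.pi) :
    Function.Periodic (O.solvesPolar a θ₀).path (2 * O.T) := by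
  intro t
  refine Subtype.ext ?_
  show S.Phi (O.longitude a θ₀ (t + 2 * O.T)) (O.radius (t + 2 * O.T + a)) =
    S.Phi (O.longitude a θ₀ t) (O.radius (t + a))
  rw [show t + 2 * O.T = t + O.T + O.T by ring, O.longitude_add, O.longitude_add,
    show t + O.T + O.T + a = t + a + O.T + O.T by ring, O.radius_add, O.radius_add, hk,
    show O.longitude a θ₀ t + k * Real.pi + k * Real.pi =
      O.longitude a θ₀ t + k * (2 * Real.pi) by ring, Phi_add_int_mul_two_pi]

theorem U_nat_mul (k : ℕ) : O.U (k * O.T) = k * (2 * Real.pi) := by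
  induction k with
  | zero => simp [O.U_zero]
  | succ k ih =>
    push_cast
    rw [add_mul, one_mul, O.U_add, ih]; ring

theorem longitude_nat_mul (k : ℕ) : O.longitude 0 0 (k * O.T) = k * S.angle c := by
  induction k with
  | zero => simp [longitude]
  | succ k ih =>
    push_cast
    rw [add_mul, one_mul, O.longitude_add, ih]; ring

/-- If the orbit closes up, the angle of a period is a rational multiple of `2π`. -/
theorem exists_rat_of_periodic {P : ℝ} (hP : 0 < P)
    (h : Function.Periodic (O.solvesPolar 0 0).path P) :
    ∃ x : ℚ, S.angle c = x * (2 * Real.pi) := by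
  have hpq := sub_pos.2 O.p_lt_q
  have h1 : (O.solvesPolar 0 0).path P = (O.solvesPolar 0 0).path 0 := by
    have := h 0; rwa [zero_add] at this
  have h2 : O.radius P = O.radius 0 := by
    have := congrArg (fun x : S.Carrier => (x : ℂ × ℝ).2) h1
    have h3 : O.radius (P + 0) = O.radius (0 + 0) := this
    simpa using h3
  -- The orbit starts on its lowest parallel, which it meets only at phases in `2πℤ`. Hence a
  -- closing time is a multiple of the radial period.
  have h3 : Real.cos (O.U P) = 1 := by
    rw [radius, radius, O.U_zero, swing, swing, Real.cos_zero] at h2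
    have : (O.q - O.p) / 2 ≠ 0 := by positivity
    exact mul_left_cancel₀ this (by linarith)
  obtain ⟨k, hk⟩ := (Real.cos_eq_one_iff _).1 h3
  have hU : 0 < O.U P := by rw [← O.U_zero]; exact O.U_strictMono hP
  have hk0 : 0 < k := by
    rw [← hk] at hU
    have := pos_of_mul_pos_left hU Real.two_pi_pos.le
    exact_mod_cast this
  lift k to ℕ using hk0.le
  have hPk : P = k * O.T := by
    refine O.U_strictMono.injective ?_
    rw [O.U_nat_mul, ← hk]; simp
  have h4 : dir (O.solvesPolar 0 0).path P = dir (O.solvesPolar 0 0).path 0 := by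
    rw [dir, dir, height, height, h1]
  rw [(O.solvesPolar 0 0).dir_path, (O.solvesPolar 0 0).dir_path, hPk, O.longitude_nat_mul,
    O.longitude_zero, Complex.exp_eq_exp_iff_exists_int] at h4
  obtain ⟨j, hj⟩ := h4
  have h5 : ((k * S.angle c : ℝ) : ℂ) = ((j * (2 * Real.pi) : ℝ) : ℂ) := by
    refine mul_right_cancel₀ Complex.I_ne_zero (hj.trans ?_)
    push_cast
    ring
  have h6 : k * S.angle c = j * (2 * Real.pi) := Complex.ofReal_injective h5
  have hk' : (k : ℝ) ≠ 0 := by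
    have : k ≠ 0 := by omega
    exact_mod_cast this
  refine ⟨j / k, ?_⟩
  push_cast
  field_simp
  linear_combination h6

end Orbit
end SpindleOrbifold

/-! ### Meridians -/

namespace SpindleOrbifold

/-- The sign picked up in a full period of a meridian. -/
noncomputable def flip (S : SpindleOrbifold) : ℂ := (-1) ^ (S.m + S.n)

variable {S : SpindleOrbifold}

theorem flip_ne_zero : S.flip ≠ 0 := pow_ne_zero _ (by norm_num)

theorem flip_mul_self : S.flip * S.flip = 1 := by
  rw [flip, ← mul_pow]; norm_num

theorem norm_flip : ‖S.flip‖ = 1 := by simp [flip]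

/-- The point on the meridian at time `t = 2Mk + x`. -/
theorem meridian_mem (E : ℂ) (hE : ‖E‖ = 1) {x : ℝ} (hx : x ∈ Ico (-S.M) S.M) (k : ℤ) :
    ((S.r |x| * ((x / |x| : ℝ) : ℂ) ^ S.m * (S.flip ^ k * E), |x|) : ℂ × ℝ) ∈ S.Carrier := by
  have hx' : |x| ∈ Icc 0 S.M := ⟨abs_nonneg _, abs_le.2 ⟨hx.1, hx.2.le⟩⟩
  refine ⟨hx', ?_⟩
  rcases eq_or_ne x 0 with rfl | h0
  · simp [S.r_zero]
  · have h1 : |x| ≠ 0 := abs_ne_zero.2 h0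
    simp only [norm_mul, norm_pow, norm_zpow, norm_flip, one_zpow, hE, mul_one, Complex.norm_real,
      Real.norm_eq_abs, abs_div, abs_abs, div_self h1, one_pow]
    exact abs_of_nonneg (S.r_nonneg hx')

theorem sub_floor_mem (M t : ℝ) (hM : 0 < M) :
    t - 2 * M * ⌊(t + M) / (2 * M)⌋ ∈ Ico (-M) M := by
  have h1 := Int.floor_le ((t + M) / (2 * M))
  have h2 := Int.lt_floor_add_one ((t + M) / (2 * M))
  rw [le_div_iff₀ (by positivity)] at h1
  rw [div_lt_iff₀ (by positivity)] at h2
  constructor <;> nlinarith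

/-- The geodesic through both poles. -/
noncomputable def meridian (E : ℂ) (hE : ‖E‖ = 1) (t : ℝ) : S.Carrier :=
  ⟨_, meridian_mem E hE (sub_floor_mem S.M t S.M_pos) ⌊(t + S.M) / (2 * S.M)⌋⟩

theorem meridian_eq (E : ℂ) (hE : ‖E‖ = 1) {t x : ℝ} {k : ℤ} (hx : x ∈ Ico (-S.M) S.M)
    (ht : t = x + 2 * S.M * k) : (meridian (S := S) E hE t : ℂ × ℝ) =
      (S.r |x| * ((x / |x| : ℝ) : ℂ) ^ S.m * (S.flip ^ k * E), |x|) := by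
  have hM := S.M_pos
  have hk : ⌊(t + S.M) / (2 * S.M)⌋ = k := by
    rw [Int.floor_eq_iff, le_div_iff₀ (by positivity), div_lt_iff₀ (by positivity)]
    constructor <;> nlinarith [hx.1, hx.2]
  have hx' : t - 2 * S.M * k = x := by rw [ht]; ring
  simp only [meridian, hk, hx']

theorem exists_pow_eq {k : ℕ} (hk : 0 < k) {z : ℂ} (hz : ‖z‖ = 1) : ∃ e : ℂ, ‖e‖ = 1 ∧ e ^ k = z := by
  obtain ⟨e, he⟩ := IsAlgClosed.exists_pow_nat_eq z hk
  refine ⟨e, ?_, he⟩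
  rw [← he, norm_pow] at hz
  exact (pow_eq_one_iff_of_nonneg (norm_nonneg _) hk.ne').1 hz

/-- Each passage through the first pole multiplies the direction by `(-1)^m`, each passage through
the second by `(-1)^n`, because a straight line in the chart reverses its chart direction there. The
chart at `s = 0` serves all times except the passages through `s = M`, where `x = -M`. -/
theorem isGeodesic_meridian (E : ℂ) (hE : ‖E‖ = 1) : S.IsGeodesic (meridian E hE) := by
  intro t₀
  have hM := S.M_pos
  set k := ⌊(t₀ + S.M) / (2 * S.M)⌋ with hk
  have hx₀ := sub_floor_mem S.M t₀ hM
  rw [← hk] at hx₀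
  have hnorm : ‖S.flip ^ k * E‖ = 1 := by rw [norm_mul, norm_zpow, norm_flip, one_zpow, hE, mul_one]
  rcases eq_or_lt_of_le hx₀.1 with h0 | h0
  -- The `n`-th root is chosen to match the outgoing direction, which is that of the branch `x < 0`.
  · obtain ⟨e, he, hen⟩ := exists_pow_eq S.n_pos (z := (-1) ^ S.m * (S.flip ^ k * E)) (by
      rw [norm_mul, hnorm, norm_pow, norm_neg, norm_one, one_pow, mul_one])
    have hgeo := isUnitGeodesicOn_line (S := S.reflect) t₀ he
    refine ⟨_, Ioo_mem_nhds (by rw [reflect_M]; linarith) (by rw [reflect_M]; linarith), _,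
      .inr ⟨hgeo, fun t ht => ⟨(hgeo t ht).1, Subtype.ext ?_⟩⟩⟩
    rw [reflect_M] at ht
    have h1 : ‖((t - t₀ : ℝ) : ℂ) * e‖ = |t - t₀| := by
      rw [norm_mul, he, mul_one, Complex.norm_real]; rfl
    simp only [chartM, h1]
    rw [mul_div_right_comm, mul_pow, hen, ← Complex.ofReal_div]
    rcases lt_or_ge t t₀ with hlt | hge
    · have hx : t - 2 * S.M * (k - 1) ∈ Ico (-S.M) S.M := ⟨by linarith [ht.1], by linarith⟩
      have hpos : 0 < t - 2 * S.M * (k - 1) := by linarith [ht.1]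
      rw [meridian_eq E hE (k := k - 1) hx (by push_cast; ring), abs_of_pos hpos,
        abs_of_neg (sub_neg.2 hlt), div_self hpos.ne', div_neg, div_self (sub_neg.2 hlt).ne]
      have h2 : t - 2 * S.M * (k - 1) = S.M - -(t - t₀) := by linarith
      rw [h2, zpow_sub_one₀ flip_ne_zero, inv_eq_of_mul_eq_one_right flip_mul_self]
      refine Prod.ext ?_ rfl
      simp only [Complex.ofReal_neg, Complex.ofReal_one, one_pow, mul_one]
      rw [flip, pow_add]
      ring
    · have hx : t - 2 * S.M * k ∈ Ico (-S.M) S.M := ⟨by linarith, by linarith [ht.2]⟩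
      have hneg : t - 2 * S.M * k < 0 := by linarith [ht.2]
      rw [meridian_eq E hE (k := k) hx (by ring), abs_of_neg hneg, abs_of_nonneg (sub_nonneg.2 hge),
        div_neg, div_self hneg.ne]
      have h2 : -(t - 2 * S.M * k) = S.M - (t - t₀) := by linarith
      rw [h2]
      refine Prod.ext ?_ rfl
      rcases eq_or_lt_of_le hge with h3 | h3
      · simp [h3, S.r_M]
      · simp only [div_self (sub_pos.2 h3).ne', Complex.ofReal_neg, Complex.ofReal_one, one_pow,
          one_mul]
        ring
  · obtain ⟨e, he, hem⟩ := exists_pow_eq S.m_pos hnorm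
    have hgeo := isUnitGeodesicOn_line (S := S) (2 * S.M * k) he
    refine ⟨_, Ioo_mem_nhds (by linarith) (by linarith [hx₀.2]), _,
      .inl ⟨hgeo, fun t ht => ⟨(hgeo t ht).1, Subtype.ext ?_⟩⟩⟩
    rw [chartZero_line he, meridian_eq E hE (x := t - 2 * S.M * k) (k := k)
      ⟨by linarith [ht.1], by linarith [ht.2]⟩ (by ring), linePoint, mul_pow, hem, mul_assoc]

theorem meridian_add (E : ℂ) (hE : ‖E‖ = 1) (t : ℝ) :
    (meridian (S := S) E hE (t + 2 * S.M) : ℂ × ℝ) =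
      (S.flip * (meridian (S := S) E hE t : ℂ × ℝ).1, (meridian (S := S) E hE t : ℂ × ℝ).2) := by
  have h1 := sub_floor_mem S.M t S.M_pos
  rw [meridian_eq E hE (t := t) (k := ⌊(t + S.M) / (2 * S.M)⌋) h1 (by ring),
    meridian_eq E hE (t := t + 2 * S.M) (k := ⌊(t + S.M) / (2 * S.M)⌋ + 1) h1 (by push_cast; ring),
    zpow_add_one₀ flip_ne_zero]
  refine Prod.ext ?_ rfl
  simp only
  ring

theorem periodic_meridian (E : ℂ) (hE : ‖E‖ = 1) :
    Function.Periodic (meridian (S := S) E hE) (4 * S.M) := by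
  intro t
  refine Subtype.ext ?_
  rw [show t + 4 * S.M = t + 2 * S.M + 2 * S.M by ring, meridian_add, meridian_add, ← mul_assoc,
    flip_mul_self, one_mul]

theorem meridian_eq_of_pos (E : ℂ) (hE : ‖E‖ = 1) {x : ℝ} (hx : x ∈ Ioo 0 S.M) (k : ℤ) :
    (meridian (S := S) E hE (x + 2 * S.M * k) : ℂ × ℝ) = (S.r x * (S.flip ^ k * E), x) := by
  rw [meridian_eq E hE (k := k) (x := x) ⟨by linarith [hx.1, S.M_pos], hx.2⟩ rfl,
    abs_of_pos hx.1, div_self hx.1.ne', Complex.ofReal_one, one_pow, mul_one]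

theorem meridian_eq_of_neg (E : ℂ) (hE : ‖E‖ = 1) {x : ℝ} (hx : x ∈ Ioo (-S.M) 0) (k : ℤ) :
    (meridian (S := S) E hE (x + 2 * S.M * k) : ℂ × ℝ) =
      (S.r (-x) * ((-1) ^ S.m * (S.flip ^ k * E)), -x) := by
  rw [meridian_eq E hE (k := k) (x := x) ⟨hx.1.le, by linarith [hx.2, S.M_pos]⟩ rfl,
    abs_of_neg hx.2, div_neg, div_self hx.2.ne, Complex.ofReal_neg, Complex.ofReal_one, mul_assoc]

theorem hasUnitTangent_meridian {s₀ θ θ' : ℝ} (hs₀ : s₀ ∈ Ioo 0 S.M) {k : ℤ}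
    (hθ : Complex.exp (θ' * Complex.I) = S.flip ^ k * Complex.exp (θ * Complex.I)) :
    S.HasUnitTangent (fun t => meridian (Complex.exp (θ * Complex.I))
      (Complex.norm_exp_ofReal_mul_I θ) (t + s₀)) (2 * S.M * k) θ' (Real.arccos 0) s₀ := by
  refine ⟨fun _ => θ', fun t => t + s₀ - 2 * S.M * k, rfl, by ring, ?_, ?_, ?_⟩
  · rw [Real.cos_arccos (by norm_num) (by norm_num), zero_div]
    exact hasDerivAt_const _ _
  · rw [Real.arccos_zero, Real.sin_pi_div_two]
    exact ((hasDerivAt_id _).add_const s₀).sub_const _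
  · have hc : ContinuousAt (fun t : ℝ => t + s₀ - 2 * S.M * k) (2 * S.M * k) := by fun_prop
    have hmem : Ioo 0 S.M ∈ nhds (2 * S.M * k + s₀ - 2 * S.M * k) := by
      rw [add_sub_cancel_left]; exact isOpen_Ioo.mem_nhds hs₀
    filter_upwards [hc hmem] with t ht
    refine ⟨ht, ?_⟩
    rw [show t + s₀ = (t + s₀ - 2 * S.M * k) + 2 * S.M * k by ring, meridian_eq_of_pos _ _ ht,
      Phi, hθ]
    simp only [add_sub_cancel_right]

/-- Strictly between the times `0` and `2M` the meridian meets `s₀` only on its way down from the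
second pole, where its tangent is not in the annulus. -/
theorem isFirstReturn_meridian {s₀ ξ ξ' : ℝ} (hs₀ : s₀ ∈ Ioo 0 S.M)
    (hξ' : Complex.exp ((ξ' / S.r s₀ : ℝ) * Complex.I) =
      S.flip * Complex.exp ((ξ / S.r s₀ : ℝ) * Complex.I)) :
    S.IsFirstReturn s₀ ξ 0 (2 * S.M) ξ' 0 := by
  have hM := S.M_pos
  have hgeo := (isGeodesic_meridian (S := S) (Complex.exp ((ξ / S.r s₀ : ℝ) * Complex.I))
    (Complex.norm_exp_ofReal_mul_I _)).shift s₀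
  refine isFirstReturn_of_geodesic hgeo (by norm_num) (by positivity) ?_ ?_ ?_
  · have h1 := hasUnitTangent_meridian (θ := ξ / S.r s₀) (θ' := ξ / S.r s₀) (k := 0) hs₀
      (by rw [zpow_zero, one_mul])
    rw [neg_zero]
    simpa only [Int.cast_zero, mul_zero] using h1
  · have h1 := hasUnitTangent_meridian (θ := ξ / S.r s₀) (θ' := ξ' / S.r s₀) (k := 1) hs₀
      (by rw [zpow_one, hξ'])
    rw [neg_zero]
    simpa only [Int.cast_one, mul_one] using h1
  · intro t ht v hv hh hd
    simp only [height] at hh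
    rcases lt_or_ge (t + s₀) S.M with h1 | h1
    · have := meridian_eq_of_pos (Complex.exp ((ξ / S.r s₀ : ℝ) * Complex.I))
        (Complex.norm_exp_ofReal_mul_I _) (S := S) (x := t + s₀) ⟨by linarith [ht.1, hs₀.1], h1⟩ 0
      simp only [Int.cast_zero, mul_zero, add_zero] at this
      rw [this] at hh
      linarith [ht.1]
    · have h2 : t + s₀ - 2 * S.M ∈ Ico (-S.M) S.M := ⟨by linarith, by linarith [ht.2, hs₀.2]⟩
      have h3 : t + s₀ = (t + s₀ - 2 * S.M) + 2 * S.M * (1 : ℤ) := by push_cast; ring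
      rw [meridian_eq _ _ h2 h3] at hh
      have h4 : t + s₀ - 2 * S.M < 0 := by
        by_contra! h5
        rw [abs_of_nonneg h5] at hh
        linarith [ht.2]
      rw [abs_of_neg h4] at hh
      have h5 : Ioo (-S.M) 0 ∈ nhds (t + s₀ - 2 * S.M) :=
        isOpen_Ioo.mem_nhds ⟨by linarith [hs₀.2], h4⟩
      have h6 : ContinuousAt (fun t : ℝ => t + s₀ - 2 * S.M) t := by fun_prop
      have h7 : HasDerivAt (fun t : ℝ => -(t + s₀ - 2 * S.M)) (-1) t :=
        (((hasDerivAt_id t).add_const s₀).sub_const _).neg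
      have h8 := hd.unique (h7.congr_of_eventuallyEq (by
        filter_upwards [h6 h5] with x hx
        have h9 : x + s₀ = (x + s₀ - 2 * S.M) + 2 * S.M * (1 : ℤ) := by push_cast; ring
        rw [height, h9, meridian_eq_of_neg _ _ hx]
        simp only [Int.cast_one, mul_one, add_sub_cancel_right]))
      linarith

/-- A geodesic with vanishing Clairaut constant is a meridian. -/
theorem IsGeodesic.exists_eq_meridian {γ : ℝ → S.Carrier} (hγ : S.IsGeodesic γ) {a b t₀ : ℝ}
    {v : ℝ → ℝ} (hab : t₀ ∈ Ioo a b) (hp : S.IsPolarOn 0 (height γ) v (dir γ) (Ioo a b)) :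
    ∃ (E : ℂ) (hE : ‖E‖ = 1) (t₁ : ℝ), γ = fun t => meridian E hE (t + t₁) := by
  obtain ⟨h1, -, -, h4, -⟩ := hp t₀ hab
  have hZ := norm_dir h1
  have hv : v t₀ = 1 ∨ v t₀ = -1 := by
    rw [zero_pow two_ne_zero, zero_div, sub_zero] at h4
    have h5 : (v t₀ - 1) * (v t₀ + 1) = 0 := by linear_combination h4
    rcases mul_eq_zero.1 h5 with h6 | h6
    · exact .inl (by linarith)
    · exact .inr (by linarith)
  have key : ∀ (E : ℂ) (hE : ‖E‖ = 1) (x v₀ : ℝ) (J : Set ℝ), IsOpen J → x ∈ J → (∀ y ∈ J,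
      (meridian (S := S) E hE y : ℂ × ℝ) = (S.r (v₀ * y) * dir γ t₀, v₀ * y)) →
      (∀ y ∈ J, v₀ * y ∈ Ioo 0 S.M) → v₀ * x = height γ t₀ → v t₀ = v₀ → v₀ ^ 2 = 1 →
      γ = fun t => meridian E hE (t + (x - t₀)) := by
    intro E hE x v₀ J hJ hx hJm hJM hxh hv₀ hv₁
    obtain ⟨a', b', hab', hsub⟩ := mem_nhds_iff_exists_Ioo_subset.1 (hJ.mem_nhds hx)
    have hheight : ∀ y ∈ J, height (meridian (S := S) E hE) y = v₀ * y := fun y hy => by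
      rw [height, hJm y hy]
    have hdir : ∀ y ∈ J, dir (meridian (S := S) E hE) y = dir γ t₀ := fun y hy => by
      rw [dir, hheight y hy, hJm y hy]
      exact mul_div_cancel_left₀ _ (Complex.ofReal_ne_zero.2 (S.pos _ (hJM y hy)).ne')
    have hpol : S.IsPolarOn 0 (fun y => v₀ * y) (fun _ => v₀) (fun _ => dir γ t₀) J := by
      intro y hy
      refine ⟨hJM y hy, ((hasDerivAt_id y).const_mul v₀).congr_deriv (mul_one _),
        (hasDerivAt_const y v₀).congr_deriv (by simp), by simp [hv₁],
        (hasDerivAt_const y _).congr_deriv (by simp)⟩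
    have hpol' := hpol.congr hJ hheight hdir
    have hpol2 : S.IsPolarOn 0 (height fun t => meridian (S := S) E hE (t + (x - t₀)))
        (fun _ => v₀) (dir fun t => meridian (S := S) E hE (t + (x - t₀)))
        (Ioo (a' - (x - t₀)) (b' - (x - t₀))) := by
      intro t ht
      obtain ⟨k1, k2, k3, k4, k5⟩ := hpol' (t + (x - t₀))
        (hsub ⟨by linarith [ht.1], by linarith [ht.2]⟩)
      exact ⟨k1, k2.comp_add_const t (x - t₀), (hasDerivAt_const t v₀).congr_deriv (by simp), k4,
        k5.comp_add_const t (x - t₀)⟩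
    refine hγ.eq_of_polar ((isGeodesic_meridian E hE).shift (x - t₀)) hp hpol2 hab
      ⟨by linarith [hab'.1], by linarith [hab'.2]⟩ ?_ hv₀ ?_
    · show _ = height (meridian E hE) (t₀ + (x - t₀))
      rw [add_sub_cancel, hheight x hx, hxh]
    · show _ = dir (meridian E hE) (t₀ + (x - t₀))
      rw [add_sub_cancel, hdir x hx]
  rcases hv with hv | hv
  · refine ⟨dir γ t₀, hZ, height γ t₀ - t₀, ?_⟩
    refine key _ hZ (height γ t₀) 1 (Ioo 0 S.M) isOpen_Ioo h1 ?_ ?_ (one_mul _) hv (one_pow 2)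
    · intro y hy
      have := meridian_eq_of_pos (dir γ t₀) hZ hy 0
      simpa using this
    · intro y hy; rwa [one_mul]
  -- A descending geodesic is matched with the branch `x < 0`; the factor `(-1)^m` cancels the sign
  -- which that branch carries.
  · have hE : ‖(-1 : ℂ) ^ S.m * dir γ t₀‖ = 1 := by simp [hZ]
    refine ⟨_, hE, -height γ t₀ - t₀, ?_⟩
    refine key _ hE (-height γ t₀) (-1) (Ioo (-S.M) 0) isOpen_Ioo
      ⟨by linarith [h1.2], by linarith [h1.1]⟩ ?_ ?_ (by ring) hv (by norm_num)
    · intro y hy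
      have h5 := meridian_eq_of_neg ((-1 : ℂ) ^ S.m * dir γ t₀) hE hy 0
      have h6 : (-1 : ℂ) ^ S.m * ((-1) ^ S.m * dir γ t₀) = dir γ t₀ := by
        rw [← mul_assoc, ← mul_pow]; norm_num
      rw [zpow_zero, one_mul, h6] at h5
      simpa using h5
    · intro y hy
      exact ⟨by linarith [hy.2], by linarith [hy.1]⟩

end SpindleOrbifold

/-! ### The generating function: existence, uniqueness, constancy in the Besse case -/

namespace SpindleOrbifold
variable {S : SpindleOrbifold} {s₀ : ℝ}

/-- The generating function of the first return map of the Birkhoff annulus over `s = s₀`. -/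
noncomputable def generatingFunction (S : SpindleOrbifold) (s₀ η : ℝ) : ℝ :=
  S.potential (S.r s₀ * η)

theorem IsMinimalEquator.mul_mem (h : S.IsMinimalEquator s₀) {η : ℝ} (hη : η ∈ Ioo (-1 : ℝ) 1) :
    S.r s₀ * η ∈ Ioo (-S.r s₀) (S.r s₀) := by
  have := h.r_pos
  constructor <;> nlinarith [hη.1, hη.2]

theorem IsMinimalEquator.hasDerivAt_generatingFunction (h : S.IsMinimalEquator s₀) {η : ℝ}
    (hη : η ∈ Ioo (-1 : ℝ) 1) :
    HasDerivAt (S.generatingFunction s₀) (S.r s₀ * S.excess (-η * S.r s₀)) η := by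
  have h1 := (h.hasDerivAt_potential (h.mul_mem hη)).comp η ((hasDerivAt_id η).const_mul (S.r s₀))
  refine h1.congr_deriv ?_
  rw [neg_mul η, mul_comm η, excess_neg]
  ring

theorem IsMinimalEquator.potential_add_of_ne_zero (h : S.IsMinimalEquator s₀) {c : ℝ}
    (hc : c ∈ Ioo (-S.r s₀) (S.r s₀)) (hc0 : c ≠ 0) :
    S.potential c + c * S.excess c = S.action c + c * S.angle c := by
  rcases lt_or_gt_of_ne hc0 with h0 | h0
  · have h1 := h.potential_add (c := -c) ⟨by linarith, by linarith [hc.1]⟩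
    rwa [potential_neg, excess_neg, action_neg, angle_neg, neg_mul_neg, neg_mul_neg] at h1
  · exact h.potential_add ⟨h0, hc.2⟩

/-- The angle of a period and the normalized angle agree up to the half turn of the odd case. -/
theorem exists_angle_eq_excess_add {c : ℝ} (hc : c ≠ 0) : ∃ k : ℤ,
    S.excess c + ((S.m + S.n) % 2 : ℕ) * Real.pi = S.angle c + k * (2 * Real.pi) := by
  have hN : ((S.m + S.n : ℕ) : ℝ) = 2 * ((S.m + S.n) / 2 : ℕ) + ((S.m + S.n) % 2 : ℕ) := by
    exact_mod_cast (Nat.div_add_mod (S.m + S.n) 2).symm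
  push_cast at hN
  rcases lt_or_gt_of_ne hc with h0 | h0
  · refine ⟨((S.m + S.n) % 2 : ℕ) + ((S.m + S.n) / 2 : ℕ), ?_⟩
    rw [excess, Real.sign_of_neg h0, Int.cast_add, Int.cast_natCast, Int.cast_natCast]
    linear_combination Real.pi * hN
  · refine ⟨-((S.m + S.n) / 2 : ℕ), ?_⟩
    rw [excess, Real.sign_of_pos h0, Int.cast_neg, Int.cast_natCast]
    linear_combination -Real.pi * hN

theorem exp_mod_two_mul_pi (k : ℕ) : Complex.exp (((k % 2 : ℕ) * Real.pi : ℝ) * Complex.I) =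
    (-1) ^ k := by
  rcases Nat.mod_two_eq_zero_or_one k with h | h
  · rw [h, (Nat.even_iff.2 h).neg_one_pow]; simp
  · rw [h, (Nat.odd_iff.2 h).neg_one_pow]; simp [Complex.exp_pi_mul_I]

/-- For `η ≠ 0` this is the orbit with `c = -η R`, whose period is the potential plus `c` times the
excess. For `η = 0` the excess vanishes and the meridian returns after `2M`, turned by half a turn
exactly when `m + n` is odd. -/
theorem IsMinimalEquator.isGeneratingFunction (h : S.IsMinimalEquator s₀) :
    S.IsGeneratingFunction s₀ (S.generatingFunction s₀) := by
  have hr := h.r_pos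
  refine ⟨?_, fun η _ => ?_, fun ξ η hη => ?_⟩
  · exact h.contDiffOn_potential.comp (by fun_prop) fun η hη => h.mul_mem hη
  · rw [generatingFunction, generatingFunction, mul_neg, potential_neg]
  have hdiv : ∀ x y α : ℝ, (x + S.r s₀ * y + α * (S.equatorLength s₀ / 2)) / S.r s₀ =
      x / S.r s₀ + (y + α * Real.pi) := by
    intro x y α
    rw [equatorLength]
    field_simp
    ring
  rw [(h.hasDerivAt_generatingFunction hη).deriv]
  rcases eq_or_ne η 0 with rfl | hη0
  · rw [zero_mul, sub_zero, generatingFunction, mul_zero, potential_zero, neg_zero, zero_mul,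
      excess_zero]
    refine isFirstReturn_meridian h.1 ?_
    rw [hdiv, zero_add, Complex.ofReal_add, add_mul, Complex.exp_add, exp_mod_two_mul_pi, mul_comm]
    rfl
  · have hc : -η * S.r s₀ ∈ Ioo (-S.r s₀) (S.r s₀) := by
      have := h.mul_mem (η := -η) ⟨by linarith [hη.2], by linarith [hη.1]⟩
      rwa [mul_comm] at this
    have hc0 : -η * S.r s₀ ≠ 0 := mul_ne_zero (neg_ne_zero.2 hη0) hr.ne'
    obtain ⟨O⟩ := h.exists_orbit hc hc0
    obtain ⟨k, hk⟩ := S.exists_angle_eq_excess_add hc0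
    have hT : S.generatingFunction s₀ η - η * (S.r s₀ * S.excess (-η * S.r s₀)) = O.T := by
      rw [O.T_eq, ← h.potential_add_of_ne_zero hc hc0, generatingFunction, ← S.potential_neg,
        show -(S.r s₀ * η) = -η * S.r s₀ by ring]
      ring
    rw [hT]
    exact O.isFirstReturn h.1 hη rfl (by rw [hdiv, hk]; ring)

/-- An even differentiable solution of `h = η h'` vanishes. -/
theorem eq_zero_of_eq_mul_deriv {h : ℝ → ℝ} (hd : DifferentiableOn ℝ h (Ioo (-1) 1))
    (heven : ∀ η ∈ Ioo (-1 : ℝ) 1, h (-η) = h η)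
    (heq : ∀ η ∈ Ioo (-1 : ℝ) 1, h η = η * deriv h η) : ∀ η ∈ Ioo (-1 : ℝ) 1, h η = 0 := by
  have hd' : ∀ η ∈ Ioo (-1 : ℝ) 1, HasDerivAt h (deriv h η) η := fun η hη =>
    ((hd η hη).differentiableAt (isOpen_Ioo.mem_nhds hη)).hasDerivAt
  have h0 : (0 : ℝ) ∈ Ioo (-1 : ℝ) 1 := by norm_num
  -- The quotient `h / η` is constant on `(0, 1)`; this constant is the right derivative of `h` at
  -- `0`, which evenness forces to vanish.
  have hq : ∀ η ∈ Ioo (0 : ℝ) 1, HasDerivAt (fun x => h x / x) 0 η := by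
    intro η hη
    have hη' : η ∈ Ioo (-1 : ℝ) 1 := ⟨by linarith [hη.1], hη.2⟩
    refine ((hd' η hη').div (hasDerivAt_id η) hη.1.ne').congr_deriv ?_
    rw [heq η hη']
    simp only [id]
    ring
  obtain ⟨a, ha⟩ := isOpen_Ioo.exists_is_const_of_deriv_eq_zero isPreconnected_Ioo
    (fun η hη => (hq η hη).differentiableAt.differentiableWithinAt) fun η hη => (hq η hη).deriv
  have ha' : ∀ η ∈ Ioo (0 : ℝ) 1, h η = a * η := fun η hη => by
    have := ha η hη
    rwa [div_eq_iff hη.1.ne'] at this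
  have hh0 : h 0 = 0 := by rw [heq 0 h0, zero_mul]
  have hder0 : deriv h 0 = 0 := by
    have h1 : HasDerivAt (fun x => h (-x)) (-deriv h 0) 0 := by
      have := hd' 0 h0
      rw [← neg_zero] at this
      simpa [Function.comp_def] using this.comp (0 : ℝ) (hasDerivAt_neg 0)
    have h2 : HasDerivAt h (-deriv h 0) 0 := h1.congr_of_eventuallyEq (by
      filter_upwards [isOpen_Ioo.mem_nhds h0] with x hx using (heven x hx).symm)
    linarith [h2.unique (hd' 0 h0)]
  have ha0 : a = 0 := by
    have h1 : HasDerivWithinAt (fun x => a * x) a (Ioi 0) 0 := by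
      simpa using ((hasDerivAt_id (0 : ℝ)).const_mul a).hasDerivWithinAt
    have h2 : HasDerivWithinAt h a (Ioi 0) 0 := by
      refine h1.congr_of_eventuallyEq ?_ (by rw [hh0, mul_zero])
      filter_upwards [Ioo_mem_nhdsGT (zero_lt_one' ℝ)] with x hx using ha' x hx
    rw [← hder0]
    exact (uniqueDiffWithinAt_Ioi (0 : ℝ)).eq_deriv _ h2 (hd' 0 h0).hasDerivWithinAt
  have hpos : ∀ η ∈ Ioo (0 : ℝ) 1, h η = 0 := fun η hη => by rw [ha' η hη, ha0, zero_mul]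
  intro η hη
  rcases lt_trichotomy η 0 with h1 | rfl | h1
  · rw [← heven η hη]
    exact hpos _ ⟨by linarith, by linarith [hη.1]⟩
  · exact hh0
  · exact hpos _ ⟨h1, hη.2⟩

/-- First return times are least elements, hence unique, so the difference `h` satisfies `h = η h'`.
The return map itself is not needed. -/
theorem IsGeneratingFunction.eqOn {F G : ℝ → ℝ} (hF : S.IsGeneratingFunction s₀ F)
    (hG : S.IsGeneratingFunction s₀ G) : EqOn G F (Ioo (-1) 1) := by
  have hFd := hF.1.differentiableOn (by simp)
  have hGd := hG.1.differentiableOn (by simp)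
  have key := eq_zero_of_eq_mul_deriv (h := fun η => G η - F η) (hGd.sub hFd)
    (fun η hη => by rw [hF.2.1 η hη, hG.2.1 η hη]) fun η hη => by
      have h1 := (hF.2.2 0 η hη).1.unique (hG.2.2 0 η hη).1
      have h2 := (hFd η hη).differentiableAt (isOpen_Ioo.mem_nhds hη)
      have h3 := (hGd η hη).differentiableAt (isOpen_Ioo.mem_nhds hη)
      rw [deriv_fun_sub h3 h2]
      linarith
  exact fun η hη => sub_eq_zero.1 (key η hη)

/-- Closing makes the angle a rational multiple of `2π`, so the excess is continuous with countably
many values on `(0, R)` and therefore constant. Continuity at `0`, where it vanishes, makes the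
constant zero. -/
theorem IsMinimalEquator.generatingFunction_const_of_isBesse (h : S.IsMinimalEquator s₀)
    (hB : S.IsBesse) {η : ℝ} (hη : η ∈ Ioo (-1 : ℝ) 1) :
    S.generatingFunction s₀ η = 2 * S.M := by
  have hr := h.r_pos
  have hrat : ∀ c ∈ Ioo 0 (S.r s₀), ∃ x : ℚ,
      S.excess c = x * (2 * Real.pi) - (S.m + S.n) * Real.pi := by
    intro c hc
    obtain ⟨O⟩ := h.exists_orbit ⟨by linarith [hc.1], hc.2⟩ hc.1.ne'
    obtain ⟨P, hP, hper⟩ := hB _ (O.solvesPolar 0 0).isGeodesic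
    obtain ⟨x, hx⟩ := O.exists_rat_of_periodic hP hper
    exact ⟨x, by rw [excess_of_pos S hc.1, hx]⟩
  have hsub : Ioo 0 (S.r s₀) ⊆ Ioo (-S.r s₀) (S.r s₀) := Ioo_subset_Ioo_left (by linarith)
  have hcont := h.contDiffOn_excess.continuousOn
  have hss : (S.excess '' Ioo 0 (S.r s₀)).Subsingleton := by
    have h1 : (S.excess '' Ioo 0 (S.r s₀)).Countable := by
      refine (countable_range fun x : ℚ => (x * (2 * Real.pi) - (S.m + S.n) * Real.pi : ℝ)).mono ?_
      rintro _ ⟨c, hc, rfl⟩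
      obtain ⟨x, hx⟩ := hrat c hc
      exact ⟨x, hx.symm⟩
    exact h1.isTotallyDisconnected _ subset_rfl
      (isPreconnected_Ioo.image _ (hcont.mono hsub))
  have h0 : (0 : ℝ) ∈ Ioo (-S.r s₀) (S.r s₀) := ⟨by linarith, hr⟩
  have hpos : ∀ c ∈ Ioo 0 (S.r s₀), S.excess c = 0 := by
    intro c hc
    have h1 : Filter.Tendsto S.excess (nhdsWithin 0 (Ioi 0)) (nhds 0) := by
      have := (hcont.continuousAt (isOpen_Ioo.mem_nhds h0)).tendsto
      rw [excess_zero] at this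
      exact this.mono_left nhdsWithin_le_nhds
    refine tendsto_nhds_unique (tendsto_const_nhds.congr' ?_) h1
    filter_upwards [Ioo_mem_nhdsGT hr] with x hx
    exact hss (mem_image_of_mem _ hc) (mem_image_of_mem _ hx)
  have hzero : ∀ c ∈ Ioo (-S.r s₀) (S.r s₀), S.excess c = 0 := by
    intro c hc
    rcases lt_trichotomy c 0 with h1 | rfl | h1
    · rw [← neg_eq_zero, ← excess_neg]
      exact hpos _ ⟨by linarith, by linarith [hc.1]⟩
    · exact S.excess_zero
    · exact hpos c ⟨h1, hc.2⟩
  rw [generatingFunction, ← S.potential_zero]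
  refine isOpen_Ioo.is_const_of_deriv_eq_zero isPreconnected_Ioo
    (fun c hc => (h.hasDerivAt_potential hc).differentiableAt.differentiableWithinAt)
    (fun c hc => ?_) (h.mul_mem hη) h0
  rw [(h.hasDerivAt_potential hc).deriv, hzero c hc, neg_zero]
  rfl

theorem IsMinimalEquator.excess_eq_zero (h : S.IsMinimalEquator s₀) {C : ℝ}
    (hC : ∀ η ∈ Ioo (-1 : ℝ) 1, S.generatingFunction s₀ η = C) {c : ℝ}
    (hc : c ∈ Ioo (-S.r s₀) (S.r s₀)) : S.excess c = 0 := by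
  have hr := h.r_pos
  have hη : -c / S.r s₀ ∈ Ioo (-1 : ℝ) 1 := by
    constructor
    · rw [lt_div_iff₀ hr]; linarith [hc.2]
    · rw [div_lt_iff₀ hr]; linarith [hc.1]
  have h1 := h.hasDerivAt_generatingFunction hη
  have h2 : HasDerivAt (S.generatingFunction s₀) 0 (-c / S.r s₀) :=
    (hasDerivAt_const _ C).congr_of_eventuallyEq (by
      filter_upwards [isOpen_Ioo.mem_nhds hη] with x hx using hC x hx)
  have h3 := h1.unique h2
  rw [show -(-c / S.r s₀) * S.r s₀ = c by field_simp] at h3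
  exact (mul_eq_zero.1 h3).resolve_left hr.ne'

end SpindleOrbifold

/-! ### Divergence of the angle, and the Besse property from vanishing excess -/

/-- Near a critical point, a smooth function deviates at most quadratically. -/
theorem exists_abs_sub_le_sq {f : ℝ → ℝ} (hf : ContDiff ℝ ∞ f) {a b : ℝ} (hb : deriv f b = 0) :
    ∃ K, 0 < K ∧ ∀ s ∈ Icc a b, |f s - f b| ≤ K * (b - s) ^ 2 := by
  have hf1 := (contDiff_infty_iff_deriv.1 hf).2
  have hf2 := (contDiff_infty_iff_deriv.1 hf1).2
  obtain ⟨K, hK⟩ := isCompact_Icc.exists_bound_of_continuousOn (s := Icc a b)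
    hf2.continuous.continuousOn
  refine ⟨|K| + 1, by positivity, fun s hs => ?_⟩
  have hsb : b ∈ Icc a b := ⟨hs.1.trans hs.2, le_rfl⟩
  have h1 : ∀ x ∈ Icc a b, ‖deriv f x‖ ≤ (|K| + 1) * (b - x) := by
    intro x hx
    have := (convex_Icc a b).norm_image_sub_le_of_norm_deriv_le (f := deriv f) (C := |K| + 1)
      (fun y _ => (hf1.differentiable (by simp)).differentiableAt)
      (fun y hy => (hK y hy).trans (by linarith [le_abs_self K])) hx hsb
    rwa [hb, zero_sub, norm_neg, Real.norm_of_nonneg (sub_nonneg.2 hx.2)] at this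
  have h2 := (convex_Icc s b).norm_image_sub_le_of_norm_deriv_le (f := f)
    (C := (|K| + 1) * (b - s))
    (fun y _ => (hf.differentiable (by simp)).differentiableAt)
    (fun y hy => (h1 y ⟨hs.1.trans hy.1, hy.2⟩).trans (by gcongr; exact hy.1))
    (right_mem_Icc.2 hs.2) (left_mem_Icc.2 hs.2)
  rw [Real.norm_eq_abs, Real.norm_eq_abs, abs_sub_comm s b, abs_of_nonneg (sub_nonneg.2 hs.2)] at h2
  linarith

/-- The logarithm here is what makes the angle unbounded as `ε → 0`. -/
theorem integral_inv_add_mul {ε K a b : ℝ} (hε : 0 < ε) (hK : 0 < K) (hab : a ≤ b) :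
    ∫ s in a..b, (ε + K * (b - s))⁻¹ = Real.log ((ε + K * (b - a)) / ε) / K := by
  have hpos : ∀ s ∈ uIcc a b, 0 < ε + K * (b - s) := by
    intro s hs
    rw [uIcc_of_le hab] at hs
    have := mul_nonneg hK.le (sub_nonneg.2 hs.2)
    linarith
  rw [intervalIntegral.integral_eq_sub_of_hasDerivAt
    (f := fun s => -Real.log (ε + K * (b - s)) / K)]
  · have h1 := hpos a left_mem_uIcc
    rw [Real.log_div h1.ne' hε.ne', sub_self, mul_zero, add_zero]
    ring
  · intro s hs
    have h1 := (hpos s hs).ne'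
    refine ((((((hasDerivAt_id s).const_sub b).const_mul K).const_add ε).log h1).neg.div_const
      K).congr_deriv ?_
    simp only [id]
    field_simp
  · refine ContinuousOn.intervalIntegrable ?_
    exact ContinuousOn.inv₀ (by fun_prop) fun s hs => (hpos s hs).ne'

namespace SpindleOrbifold
variable {S : SpindleOrbifold} {s₀ : ℝ}

theorem angleDensity_nonneg {c s : ℝ} (hc : 0 ≤ c) (hs : s ∈ Ioo 0 S.M) : 0 ≤ S.angleDensity c s :=
  div_nonneg hc (mul_nonneg (S.pos s hs).le (Real.sqrt_nonneg _))

/-- The angle of a period diverges at the level of a critical point that is not a strict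
maximum from the left. -/
theorem IsMinimalEquator.exists_lt_angle (h : S.IsMinimalEquator s₀) {s₁ : ℝ} (hs₁ : 0 < s₁)
    (hlt : s₁ < s₀) (hge : ∀ s ∈ Icc s₁ s₀, S.r s₀ ≤ S.r s) (C : ℝ) :
    ∃ c ∈ Ioo 0 (S.r s₀), C < S.angle c := by
  have hr := h.r_pos
  set R := S.r s₀ with hR
  obtain ⟨K₀, hK₀, hKf⟩ := exists_abs_sub_le_sq (a := s₁) (b := s₀) (f := fun s => S.r s ^ 2)
    (S.smooth.pow 2) (by
      rw [((S.hasDerivAt_r s₀).fun_pow 2).deriv, h.2.1, mul_zero])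
  obtain ⟨B₀, hB₀⟩ := isCompact_Icc.exists_bound_of_continuousOn (s := Icc s₁ s₀)
    S.continuous_r.continuousOn
  set B := |B₀| + 1 with hB
  have hBpos : 0 < B := by positivity
  set K := √K₀ with hK
  have hKpos : 0 < K := Real.sqrt_pos.2 hK₀
  have hd := sub_pos.2 hlt
  -- With `c² = R² - ε²`, the quadratic bound gives `√(r² - c²) ≤ ε + K (s₀ - s)`. The bound `ε ≤
  -- R/2` keeps `c ≥ R/2`, and the exponential bound makes the logarithm at least `X`; then `X` is
  -- exactly what yields an integral of at least `(|C| + 1)/2`.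
  set X := (|C| + 1) * B * K / R with hX
  set ε := min (R / 2) (K * (s₀ - s₁) * Real.exp (-X)) with hε
  have hεpos : 0 < ε := lt_min (by positivity) (by positivity)
  have hεR : ε ≤ R / 2 := min_le_left _ _
  have hsq : 0 < R ^ 2 - ε ^ 2 := by nlinarith
  set c := √(R ^ 2 - ε ^ 2) with hc
  have hc2 : c ^ 2 = R ^ 2 - ε ^ 2 := Real.sq_sqrt hsq.le
  have hcR : c ∈ Ioo 0 R := ⟨Real.sqrt_pos.2 hsq, by
    rw [hc, Real.sqrt_lt' hr]; nlinarith⟩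
  have hcR2 : R / 2 ≤ c := Real.le_sqrt_of_sq_le (by nlinarith)
  refine ⟨c, hcR, ?_⟩
  have hint := h.integrableOn_angleDensity hcR
  have hsub : Ioc s₁ s₀ ⊆ Ioo 0 S.M := fun s hs => ⟨hs₁.trans hs.1, hs.2.trans_lt h.1.2⟩
  have hpos : ∀ s ∈ Icc s₁ s₀, 0 < ε + K * (s₀ - s) := fun s hs => by
    have := mul_nonneg hKpos.le (sub_nonneg.2 hs.2)
    linarith
  have hle : ∀ s ∈ Icc s₁ s₀, c / B * (ε + K * (s₀ - s))⁻¹ ≤ S.angleDensity c s := by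
    intro s hs
    have h1 := S.pos s ⟨hs₁.trans_le hs.1, hs.2.trans_lt h.1.2⟩
    have h2 : S.r s ≤ B := by
      have := (le_abs_self _).trans (hB₀ s hs)
      linarith [le_abs_self B₀]
    have h3 : S.r s ^ 2 - c ^ 2 ≤ (ε + K * (s₀ - s)) ^ 2 := by
      have h4 := (le_abs_self _).trans (hKf s hs)
      have h5 : K ^ 2 = K₀ := Real.sq_sqrt hK₀.le
      have h6 : 0 ≤ ε * (K * (s₀ - s)) :=
        mul_nonneg hεpos.le (mul_nonneg hKpos.le (sub_nonneg.2 hs.2))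
      simp only [← hR] at h4
      rw [hc2, add_sq, mul_pow, h5]
      linarith
    have h4 : √(S.r s ^ 2 - c ^ 2) ≤ ε + K * (s₀ - s) := Real.sqrt_le_iff.2 ⟨(hpos s hs).le, h3⟩
    have h5 : 0 < √(S.r s ^ 2 - c ^ 2) := by
      refine Real.sqrt_pos.2 ?_
      have := hge s hs
      nlinarith [hcR.1, hcR.2]
    rw [angleDensity, ← div_eq_mul_inv, div_div]
    have := hcR.1
    gcongr
  have h1 : (∫ s in s₁..s₀, c / B * (ε + K * (s₀ - s))⁻¹) ≤ ∫ s in Ioo 0 S.M, S.angleDensity c s := by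
    refine (intervalIntegral.integral_mono_on hlt.le ?_ ?_ hle).trans ?_
    · refine ContinuousOn.intervalIntegrable ?_
      rw [uIcc_of_le hlt.le]
      exact continuousOn_const.mul (ContinuousOn.inv₀ (by fun_prop) fun s hs => (hpos s hs).ne')
    · exact (intervalIntegrable_iff_integrableOn_Ioc_of_le hlt.le).2 (hint.mono_set hsub)
    · rw [intervalIntegral.integral_of_le hlt.le]
      refine setIntegral_mono_set hint ?_ hsub.eventuallyLE
      filter_upwards [ae_restrict_mem measurableSet_Ioo] with s hs
      exact angleDensity_nonneg hcR.1.le hs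
  rw [intervalIntegral.integral_const_mul, integral_inv_add_mul hεpos hKpos hlt.le] at h1
  have h2 : X ≤ Real.log ((ε + K * (s₀ - s₁)) / ε) := by
    rw [Real.le_log_iff_exp_le (by positivity), le_div_iff₀ hεpos]
    have h3 : Real.exp X * ε ≤ Real.exp X * (K * (s₀ - s₁) * Real.exp (-X)) :=
      mul_le_mul_of_nonneg_left (min_le_right _ _) (Real.exp_pos _).le
    have h4 : Real.exp X * (K * (s₀ - s₁) * Real.exp (-X)) = K * (s₀ - s₁) := by
      rw [Real.exp_neg]; field_simp
    linarith
  have h3 : (|C| + 1) / 2 ≤ c / B * (Real.log ((ε + K * (s₀ - s₁)) / ε) / K) := by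
    calc (|C| + 1) / 2 = R / 2 / B * (X / K) := by rw [hX]; field_simp
      _ ≤ _ := by
        have : 0 ≤ X := by positivity
        gcongr
  rw [angle]
  linarith [le_abs_self C]

theorem angle_reflect (c : ℝ) : S.reflect.angle c = S.angle c := by
  have h1 := integral_angleDensity_reflect (S := S) c S.M
  rw [sub_self, intervalIntegral.integral_of_le S.M_pos.le,
    intervalIntegral.integral_of_le S.M_pos.le, integral_Ioc_eq_integral_Ioo,
    integral_Ioc_eq_integral_Ioo] at h1
  rw [angle, angle, h1]
  rfl

/-- If the profile reached the level of the equator before `s₀`, the angle would be unbounded. So it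
stays below this level on the left, and by reflection on the right. -/
theorem IsMinimalEquator.r_lt_of_angle_le (h : S.IsMinimalEquator s₀) {C : ℝ}
    (hC : ∀ c ∈ Ioo 0 (S.r s₀), S.angle c ≤ C) {s : ℝ} (hs : s ∈ Ioo 0 S.M) (hne : s ≠ s₀) :
    S.r s < S.r s₀ := by
  have key : ∀ {S : SpindleOrbifold} {s₀ : ℝ}, S.IsMinimalEquator s₀ →
      (∀ c ∈ Ioo 0 (S.r s₀), S.angle c ≤ C) → ∀ s ∈ Ioo 0 s₀, S.r s < S.r s₀ := by
    intro S s₀ h hC s hs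
    obtain ⟨s₁, h1, h2, -, -, h3, h4⟩ := h.exists_left
    rcases eq_or_lt_of_le h2 with rfl | h5
    · exact h3 s ⟨hs.1.le, hs.2⟩
    · obtain ⟨c, hc, hcC⟩ := h.exists_lt_angle h1 h5 h4 C
      exact absurd (hC c hc) (not_le.2 hcC)
  rcases lt_or_gt_of_ne hne with h1 | h1
  · exact key h hC s ⟨hs.1, h1⟩
  · have h2 := key h.reflect (fun c hc => by
      rw [reflect_r, sub_sub_cancel] at hc
      rw [angle_reflect]
      exact hC c hc) (S.M - s) ⟨by linarith [hs.2], by linarith⟩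
    rwa [reflect_r, reflect_r, sub_sub_cancel, sub_sub_cancel] at h2

/-- A geodesic at a pole leaves it at once, being a unit speed line there. -/
theorem IsGeodesic.exists_height_mem {γ : ℝ → S.Carrier} (hγ : S.IsGeodesic γ) :
    ∃ t₀, height γ t₀ ∈ Ioo 0 S.M := by
  have hM := S.M_pos
  have h0 : height γ 0 ∈ Icc 0 S.M := (γ 0).2.1
  rcases eq_or_lt_of_le h0.1 with h1 | h1
  · obtain ⟨a, b, hab, e, he, h2⟩ := hγ.exists_line_zero h1.symm
    have hb : b / 2 ∈ Ioo a b := ⟨by linarith [hab.1, hab.2], by linarith [hab.2]⟩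
    obtain ⟨h3, h4⟩ := h2 (b / 2) hb
    have h5 : height γ (b / 2) = |b / 2 - 0| := congrArg Prod.snd h4
    refine ⟨b / 2, ?_⟩
    rw [h5]
    exact ⟨by rw [sub_zero]; exact abs_pos.2 (by linarith [hab.2]), h3⟩
  · rcases eq_or_lt_of_le h0.2 with h1' | h1'
    · obtain ⟨a, b, hab, e, he, h2⟩ := hγ.exists_line_M h1'
      have hb : b / 2 ∈ Ioo a b := ⟨by linarith [hab.1, hab.2], by linarith [hab.2]⟩
      obtain ⟨h3, h4⟩ := h2 (b / 2) hb
      have h5 : S.M - height γ (b / 2) = |b / 2 - 0| := congrArg Prod.snd h4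
      have h6 : 0 < |b / 2 - 0| := by rw [sub_zero]; exact abs_pos.2 (by linarith [hab.2])
      exact ⟨b / 2, by linarith, by linarith⟩
    · exact ⟨0, h1, h1'⟩

theorem solvesPolar_equator (hs₀ : s₀ ∈ Ioo 0 S.M) (hd : deriv S.r s₀ = 0) {c : ℝ}
    (hc : c ^ 2 = S.r s₀ ^ 2) (θ₀ : ℝ) :
    S.SolvesPolar c (fun _ => s₀) (fun _ => 0) fun t => θ₀ + t * (c / S.r s₀ ^ 2) := by
  intro t
  have hr := (S.pos _ hs₀).ne'
  refine ⟨hs₀, hasDerivAt_const _ _, ?_, ?_, ?_⟩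
  · rw [hd, mul_zero, zero_div]; exact hasDerivAt_const _ _
  · rw [hc, div_self (by positivity)]; norm_num
  · exact (((hasDerivAt_id t).mul_const _).const_add θ₀).congr_deriv (one_mul _)

theorem periodic_equator (hs₀ : s₀ ∈ Ioo 0 S.M) (hd : deriv S.r s₀ = 0) {c : ℝ}
    (hc : c ^ 2 = S.r s₀ ^ 2) (θ₀ : ℝ) :
    Function.Periodic (solvesPolar_equator hs₀ hd hc θ₀).path (S.equatorLength s₀) := by
  intro t
  refine Subtype.ext ?_
  show S.Phi (θ₀ + (t + S.equatorLength s₀) * (c / S.r s₀ ^ 2)) s₀ =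
    S.Phi (θ₀ + t * (c / S.r s₀ ^ 2)) s₀
  have hr := (S.pos _ hs₀).ne'
  obtain ⟨k, hk⟩ : ∃ k : ℤ, c = k * S.r s₀ := by
    rcases sq_eq_sq_iff_eq_or_eq_neg.1 hc with h | h
    · exact ⟨1, by simp [h]⟩
    · exact ⟨-1, by simp [h]⟩
  rw [← Phi_add_int_mul_two_pi (θ₀ + t * (c / S.r s₀ ^ 2)) s₀ k, equatorLength, hk]
  congr 1
  field_simp
  ring

/-- Vanishing excess bounds the angle, so `s₀` is the strict maximum of the profile and no geodesic
has `|c| > R`. The cases `c = 0`, `0 < |c| < R` and `|c| = R` are meridians, closing after `4M`,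
orbits closing after two periods, and the equator. -/
theorem IsMinimalEquator.isBesse_of_excess_eq_zero (h : S.IsMinimalEquator s₀)
    (hex : ∀ c ∈ Ioo (-S.r s₀) (S.r s₀), S.excess c = 0) : S.IsBesse := by
  have hr := h.r_pos
  have hlt : ∀ s ∈ Ioo 0 S.M, s ≠ s₀ → S.r s < S.r s₀ := by
    intro s hs hne
    refine h.r_lt_of_angle_le (C := (S.m + S.n) * Real.pi) (fun c hc => ?_) hs hne
    have h1 := hex c ⟨by linarith [hc.1], hc.2⟩
    rw [excess_of_pos S hc.1] at h1
    linarith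
  intro γ hγ
  obtain ⟨t₀, ht₀⟩ := hγ.exists_height_mem
  obtain ⟨a, b, c, v, hab, hp⟩ := hγ.exists_polar ht₀
  obtain ⟨-, -, -, hv, -⟩ := hp t₀ hab
  have hrs := S.pos _ ht₀
  have hcr : c ^ 2 ≤ S.r (height γ t₀) ^ 2 := by
    have h1 : c ^ 2 / S.r (height γ t₀) ^ 2 ≤ 1 := by nlinarith [sq_nonneg (v t₀)]
    rwa [div_le_one (by positivity)] at h1
  have hle : S.r (height γ t₀) ≤ S.r s₀ := by
    rcases eq_or_ne (height γ t₀) s₀ with h1 | h1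
    · rw [h1]
    · exact (hlt _ ht₀ h1).le
  have hdir : ∃ θ₀ : ℝ, dir γ t₀ = Complex.exp (θ₀ * Complex.I) := by
    refine ⟨Complex.arg (dir γ t₀), ?_⟩
    have := Complex.norm_mul_exp_arg_mul_I (dir γ t₀)
    rw [norm_dir ht₀, Complex.ofReal_one, one_mul] at this
    exact this.symm
  obtain ⟨θ₀, hθ₀⟩ := hdir
  have of_shift : ∀ {T t : ℝ} {δ : ℝ → S.Carrier}, 0 < T → (fun x => γ (x + t)) = δ →
      Function.Periodic δ T → ∃ T : ℝ, 0 < T ∧ Function.Periodic γ T := by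
    intro T t δ hT hδ hper
    subst hδ
    refine ⟨T, hT, fun x => ?_⟩
    have := hper (x - t)
    simp only [sub_add_cancel] at this
    rwa [show x - t + T + t = x + T by ring] at this
  rcases eq_or_ne c 0 with rfl | hc0
  · obtain ⟨E, hE, t₁, rfl⟩ := hγ.exists_eq_meridian hab hp
    have hM := S.M_pos
    refine ⟨4 * S.M, by positivity, fun t => ?_⟩
    have := periodic_meridian (S := S) E hE (t + t₁)
    rwa [show t + t₁ + 4 * S.M = t + 4 * S.M + t₁ by ring] at this
  rcases lt_or_ge (c ^ 2) (S.r s₀ ^ 2) with hc | hc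
  · have hc' : c ∈ Ioo (-S.r s₀) (S.r s₀) := abs_lt.1 (abs_lt_of_sq_lt_sq hc hr.le)
    obtain ⟨O⟩ := h.exists_orbit hc' hc0
    obtain ⟨x, hx1, hx2⟩ := O.exists_phase ht₀ hv
    have hk : ∃ k : ℤ, S.angle c = k * Real.pi := by
      have h1 := hex c hc'
      rw [excess, sub_eq_zero] at h1
      rcases lt_or_gt_of_ne hc0 with h2 | h2
      · exact ⟨-(S.m + S.n), by rw [h1, Real.sign_of_neg h2]; push_cast; ring⟩
      · exact ⟨S.m + S.n, by rw [h1, Real.sign_of_pos h2]; push_cast; ring⟩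
    obtain ⟨k, hk⟩ := hk
    have hT := O.T_pos
    refine of_shift (by positivity) ((O.solvesPolar x θ₀).eq_path hγ hab hp rfl ?_ ?_ ?_)
      (O.periodic_path hk)
    · rw [zero_add, hx1]
    · rw [zero_add, hx2]
    · rw [O.longitude_zero, hθ₀]
  -- From `R² ≤ c² ≤ r² ≤ R²` the geodesic sits at the strict maximum with zero radial velocity, so
  -- it is the equator.
  · have hsq : S.r (height γ t₀) ^ 2 ≤ S.r s₀ ^ 2 := pow_le_pow_left₀ hrs.le hle 2
    have hs : height γ t₀ = s₀ := by
      by_contra hne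
      have := pow_lt_pow_left₀ (hlt _ ht₀ hne) hrs.le two_ne_zero
      linarith
    have hcs : c ^ 2 = S.r s₀ ^ 2 := by linarith
    have hv0 : v t₀ = 0 := by
      rw [hs, hcs, div_self (by positivity), sub_self] at hv
      exact pow_eq_zero_iff two_ne_zero |>.1 hv
    have hL : 0 < S.equatorLength s₀ := by
      have := Real.pi_pos
      rw [equatorLength]; positivity
    refine of_shift hL ((solvesPolar_equator h.1 h.2.1 hcs θ₀).eq_path hγ hab hp rfl hs hv0 ?_)
      (periodic_equator h.1 h.2.1 hcs θ₀)
    rw [zero_mul, add_zero, hθ₀]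

end SpindleOrbifold

end

theorem mainTheorem5 (S : SpindleOrbifold) (s₀ : ℝ) (hs₀ : S.IsMinimalEquator s₀) :
    ∃ F : ℝ → ℝ, S.IsGeneratingFunction s₀ F ∧
      (∀ G : ℝ → ℝ, S.IsGeneratingFunction s₀ G → Set.EqOn G F (Set.Ioo (-1) 1)) ∧
      ((∃ c : ℝ, ∀ η ∈ Set.Ioo (-1 : ℝ) 1, F η = c) ↔ S.IsBesse) := by
  refine ⟨_, hs₀.isGeneratingFunction, fun G hG => hs₀.isGeneratingFunction.eqOn hG, ?_, ?_⟩
  · rintro ⟨C, hC⟩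
    exact hs₀.isBesse_of_excess_eq_zero fun c hc => hs₀.excess_eq_zero hC hc
  · intro hB
    exact ⟨2 * S.M, fun η hη => hs₀.generatingFunction_const_of_isBesse hB hη⟩
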